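/- Let $D$ be an even positive integer. Let $\mathfrak c_D$ be the complex Lie algebra spanned by $T_\alpha, C_\alpha, H, \Omega_{\alpha\beta}=-\Omega_{\beta\alpha}$ ($1\le\alpha,\beta\le D$) with relations $[H,\Omega_{\alpha\beta}]=[T_\alpha,T_\beta]=[C_\alpha,C_\beta]=0$, $[\Omega_{\alpha\beta},T_\gamma]=\delta_{\alpha\gamma}T_\beta-\delta_{\beta\gamma}T_\alpha$, $[\Omega_{\alpha\beta},C_\gamma]=\delta_{\alpha\gamma}C_\beta-\delta_{\beta\gamma}C_\alpha$, $[H,T_\alpha]=T_\alpha$, $[H,C_\alpha]=-C_\alpha$, $[T_\alpha,C_\beta]=2\delta_{\alpha\beta}H-2\Omega_{\alpha\beta}$, $[\Omega_{\alpha_1\beta_1},\Omega_{\alpha_2\beta_2}]=\delta_{\alpha_1\alpha_2}\Omega_{\beta_1\beta_2}+\delta_{\beta_1\beta_2}\Omega_{\alpha_1\alpha_2}-\delta_{\alpha_1\beta_2}\Omega_{\beta_1\alpha_2}-\delta_{\beta_1\alpha_2}\Omega_{\alpha_1\beta_2}$. Let $(V,Y_1,\mathbf 1)$ be a vertex algebra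 in dimension one over $\mathbb C$ (on a vector superspace), with modes $Y_1(a,x)b=\sum_n a_{(n)}b\,x^{-n-1}$, and put $\mu^1_n(a\otimes b):=a_{(-n-1)}b$. Let $\mathfrak c_D$ act on $V$ by even operators such that: - every $X\in\mathfrak c_D$ is local, i.e. $[X,Y_1(a,x)]$ is local with respect to $Y_1(b,y)$ for all $a,b\in V$; $X\mathbf 1=0$ for all $X\in\mathfrak c_D$; and $T_1$ is the translation operator $a\mapsto a_{(-2)}\mathbf 1$; - (strong integrability) every vector lies in a finite-dimensional subspace invariant under all $\Omega_{\alpha\beta}$, $H$ is diagonalizable, and the spectrum of $H+\mathrm i(\Omega_{12}+\Omega_{34}+\dots+\Omega_{D-1,D})$ consists of even integers; - (positive energy) the eigenvalues of $H$ lie in $\frac12\mathbb Z_{\ge0}$; - (unitarity) there is a positive-definite Hermitian form on $V$ with $H^*=H$, $\Omega_{\alpha\beta}^*=-\Omega_{\alpha\beta}$, $T_\alpha^*=-C_\alpha$. For each $m\ge0$ let $\{h_{m,\sigma}\}_\sigma$ be a basis of the homogeneous harmonic polynomials of degree $m$ in $\mathrm z=(z^1,\dots,z^D)$. Then there is a unique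 family of bilinear maps $\mu^D_{n;m,\sigma}$ on $V$ ($n\in\mathbb Z$) such that, for all $n,a,b$, only finitely many $\mu^D_{n;m,\sigma}(a\otimes b)$ are non-zero and $$\sum_{m,\sigma}\mu^D_{n;m,\sigma}(a\otimes b)\,h_{m,\sigma}(\mathrm u)=e^{\vartheta\Omega_{1,v}}\,\mu^1_n\bigl(e^{-\vartheta\Omega_{1,v}}a\otimes e^{-\vartheta\Omega_{1,v}}b\bigr),\qquad \mathrm u=(\cos\vartheta,\ \sin\vartheta\, v),$$ for all $\vartheta\in\mathbb C$ and all $v=(v^2,\dots,v^D)\in\mathbb C^{D-1}$ with $\sum_\alpha (v^\alpha)^2=1$, where $\Omega_{1,v}=\sum_{\alpha\ge2}v^\alpha\Omega_{1\alpha}$. For all $a,b\in V$ there is an integer $N=N^D_{a,b}\ge0$ such that $\mu^D_{n;m,\sigma}(a\otimes b)=0$ for all $n,m,\sigma$ with $\frac{m-n}2>N$. Moreover $$Y_D(a,\mathrm z)b:=\sum_{n,m,\sigma}\mu^D_{n;m,\sigma}(a\otimes b)\,(\mathrm z^2)^{\frac{n-m}2}h_{m,\sigma}(\mathrm z)$$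 involves only integral powers of $\mathrm z^2=\sum_\alpha(z^\alpha)^2$ and equals $(\mathrm z^2)^{-N}f(\mathrm z)$ for some $f\in V[[\mathrm z]]$; that is, $Y_D(a,\mathrm z)b\in V[[\mathrm z]]_{\mathrm z^2}$. Explicitly, let $W'$, $W''$ be finite-dimensional subspaces of $V$, invariant under all $\Omega_{\alpha\beta}$, with $H=\Delta'$ on $W'$ and $H=\Delta''$ on $W''$, and let $a\in W'$, $b\in W''$. If $\mu^D_{n;m,\sigma}(a\otimes b)\ne0$, then $$\frac{m-n}2\le\frac12\bigl(\Delta'+J'+\Delta''+J''\bigr),$$ where, for $D\ge4$, $-J'$ and $-J''$ are the minimal eigenvalues of $\mathrm i\Omega_{12}$ on $W'\neq 0$ and $W''\neq0$, and, for $D=2$, $J'$ and $J''$ are the maximal absolute values of these eigenvalues. -/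

import Mathlib

noncomputable section

/-! ### Formal distributions and vertex algebras in dimension one -/

section VertexAlgebras

variable {V : Type*} [AddCommGroup V] [Module ℂ V]

/-- Two formal distributions `A(z) = ∑ A n z^(-n-1)` and `B(w) = ∑ B n w^(-n-1)` with modes in
`End V` satisfy `(z - w)^N A(z) B(w) = s (z - w)^N B(w) A(z)` for some `N`, where `s` is the sign
of the exchange. The identity is written out for the coefficient of `z^(-m-1) w^(-n-1)`, using
`(z - w)^N = ∑ j, (N choose j) (-1)^j z^(N-j) w^j`. -/
def MutuallyLocal (s : ℂ) (A B : ℤ → Module.End ℂ V) : Prop :=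
  ∃ N : ℕ, ∀ m n : ℤ,
    ∑ j ∈ Finset.range (N + 1), ((-1 : ℂ) ^ j * (N.choose j : ℂ)) •
        (A (m + N - j) * B (n + j)) =
    s • ∑ j ∈ Finset.range (N + 1), ((-1 : ℂ) ^ j * (N.choose j : ℂ)) •
        (B (n + j) * A (m + N - j))

/-- The sign `(-1)^(p q)` of the exchange of homogeneous elements of parities `p` and `q`. -/
def exchangeSign (p q : ZMod 2) : ℂ := (-1 : ℂ) ^ (p.val * q.val)

/-- A vertex algebra (in dimension one) on the complex vector superspace `V`. The state-field
correspondence takes values in `V((z))` through Mathlib's `VertexOperator`; the mode `a_(n)`,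
the coefficient of `z^(-n-1)` in `Y(a,z)`, is `VertexOperator.ncoeff (Y a) n`. -/
structure VertexAlgebra (V : Type*) [AddCommGroup V] [Module ℂ V] where
  /-- the even part (index `0`) and the odd part (index `1`) of `V` -/
  parity : ZMod 2 → Submodule ℂ V
  parity_isInternal : DirectSum.IsInternal parity
  /-- the state-field correspondence -/
  Y : V →ₗ[ℂ] VertexOperator ℂ V
  /-- the vacuum vector -/
  vac : V
  vac_even : vac ∈ parity 0
  Y_even : ∀ (p q : ZMod 2), ∀ a ∈ parity p, ∀ b ∈ parity q, ∀ n : ℤ,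
    VertexOperator.ncoeff (Y a) n b ∈ parity (p + q)
  mode_vac : ∀ (a : V) (m : ℤ), -1 ≤ m →
    VertexOperator.ncoeff (Y a) m vac = if m = -1 then a else 0
  vac_mode : ∀ (a : V) (n : ℤ),
    VertexOperator.ncoeff (Y vac) n a = if n = -1 then a else 0
  /-- `[T, Y(a,z)] = ∂_z Y(a,z)`, where `T a = a_(-2) 1` -/
  translation_covariance : ∀ (a b : V) (n : ℤ),
    VertexOperator.ncoeff (Y (VertexOperator.ncoeff (Y a) n b)) (-2) vac
      - VertexOperator.ncoeff (Y a) n (VertexOperator.ncoeff (Y b) (-2) vac)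
      = (-n : ℂ) • VertexOperator.ncoeff (Y a) (n - 1) b
  locality : ∀ (p q : ZMod 2), ∀ a ∈ parity p, ∀ b ∈ parity q,
    MutuallyLocal (exchangeSign p q)
      (VertexOperator.ncoeff (Y a)) (VertexOperator.ncoeff (Y b))

namespace VertexAlgebra

/-- The translation operator `T a = a_(-2) 1`. -/
def translation (𝒱 : VertexAlgebra V) : Module.End ℂ V where
  toFun a := VertexOperator.ncoeff (𝒱.Y a) (-2) 𝒱.vac
  map_add' a b := by simp
  map_smul' r a := by simp

/-- The coefficient `μ¹_n (a ⊗ b)` of `x^n` in `Y₁(a,x)b`, that is, `a_(-n-1) b`. -/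
def mu1 (𝒱 : VertexAlgebra V) (n : ℤ) (a b : V) : V :=
  HVertexOperator.coeff (𝒱.Y a) n b

/-- `X` preserves the parity. -/
def IsEvenEnd (𝒱 : VertexAlgebra V) (X : Module.End ℂ V) : Prop :=
  ∀ (p : ZMod 2), ∀ a ∈ 𝒱.parity p, X a ∈ 𝒱.parity p

/-- The even operator `X` is a local endomorphism: each field `[X, Y(a,z)]`, whose modes are
`[X, a_(n)]`, is local with respect to each `Y(b,w)`. -/
def IsLocalEnd (𝒱 : VertexAlgebra V) (X : Module.End ℂ V) : Prop :=
  ∀ (p q : ZMod 2), ∀ a ∈ 𝒱.parity p, ∀ b ∈ 𝒱.parity q,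
    MutuallyLocal (exchangeSign p q)
      (fun n => ⁅X, (VertexOperator.ncoeff (𝒱.Y a) n : Module.End ℂ V)⁆)
      (VertexOperator.ncoeff (𝒱.Y b))

end VertexAlgebra

end VertexAlgebras

/-! ### Representations of the conformal Lie algebra -/

/-- A representation on `V` of the complex Lie algebra of infinitesimal conformal transformations
of `ℂ^D`: operators representing its spanning elements (translations `T`, special conformal
transformations `C`, dilation `H`, rotations `Ω`) and satisfying its defining relations. The
indices `1, …, D` are represented by the elements `0, …, D - 1` of `Fin D`. -/
structure ConformalAction (D : ℕ) (V : Type*) [AddCommGroup V] [Module ℂ V] where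
  T : Fin D → Module.End ℂ V
  C : Fin D → Module.End ℂ V
  H : Module.End ℂ V
  Ω : Fin D → Fin D → Module.End ℂ V
  Ω_antisymm : ∀ α β, Ω α β = -Ω β α
  H_Ω : ∀ α β, ⁅H, Ω α β⁆ = 0
  T_T : ∀ α β, ⁅T α, T β⁆ = 0
  C_C : ∀ α β, ⁅C α, C β⁆ = 0
  Ω_T : ∀ α β γ, ⁅Ω α β, T γ⁆ =
    (if α = γ then T β else 0) - (if β = γ then T α else 0)
  Ω_C : ∀ α β γ, ⁅Ω α β, C γ⁆ =
    (if α = γ then C β else 0) - (if β = γ then C α else 0)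
  H_T : ∀ α, ⁅H, T α⁆ = T α
  H_C : ∀ α, ⁅H, C α⁆ = -C α
  T_C : ∀ α β, ⁅T α, C β⁆ = (if α = β then (2 : ℂ) • H else 0) - (2 : ℂ) • Ω α β
  Ω_Ω : ∀ α₁ β₁ α₂ β₂, ⁅Ω α₁ β₁, Ω α₂ β₂⁆ =
    (if α₁ = α₂ then Ω β₁ β₂ else 0) + (if β₁ = β₂ then Ω α₁ α₂ else 0)
      - (if α₁ = β₂ then Ω β₁ α₂ else 0) - (if β₁ = α₂ then Ω α₁ β₂ else 0)

namespace ConformalAction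

variable {D : ℕ} {V : Type*} [AddCommGroup V] [Module ℂ V]

/-- The space of all operators by which elements of the conformal Lie algebra act. -/
def operators (A : ConformalAction D V) : Submodule ℂ (Module.End ℂ V) :=
  Submodule.span ℂ (Set.range A.T ∪ Set.range A.C ∪ {A.H} ∪
    Set.range (fun p : Fin D × Fin D => A.Ω p.1 p.2))

/-- The subspace `W` is invariant under all infinitesimal rotations. -/
def RotationInvariant (A : ConformalAction D V) (W : Submodule ℂ V) : Prop :=
  ∀ α β, ∀ w ∈ W, A.Ω α β w ∈ W

/-- Every vector lies in a finite-dimensional rotation-invariant subspace. -/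
def Integrable (A : ConformalAction D V) : Prop :=
  ∀ v : V, ∃ W : Submodule ℂ V, FiniteDimensional ℂ W ∧ v ∈ W ∧ A.RotationInvariant W

/-- The sum `Ω₁₂ + Ω₃₄ + ⋯ + Ω_{2k-1,2k}` with `k = ⌊D/2⌋`. -/
def cartanSum (A : ConformalAction D V) : Module.End ℂ V :=
  ∑ j : Fin (D / 2), A.Ω ⟨2 * j.val, by omega⟩ ⟨2 * j.val + 1, by omega⟩

/-- Integrability, diagonalizability of `H`, and the condition that the spectrum of
`H + i (Ω₁₂ + Ω₃₄ + ⋯)` consists of even integers. -/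
def StronglyIntegrable (A : ConformalAction D V) : Prop :=
  A.Integrable ∧ (⨆ c : ℂ, A.H.eigenspace c = ⊤) ∧
    ∀ c ∈ spectrum ℂ (A.H + Complex.I • A.cartanSum), ∃ k : ℤ, c = 2 * (k : ℂ)

/-- `H` is diagonalizable with eigenvalues in `{0, 1/2, 1, 3/2, …}`. -/
def PositiveEnergy (A : ConformalAction D V) : Prop :=
  ⨆ k : ℕ, A.H.eigenspace ((k : ℂ) / 2) = ⊤

/-- There is a positive-definite Hermitian form on `V` for which `H* = H`, `Ω* = -Ω` and
`T* = -C`. -/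
def Unitary (A : ConformalAction D V) : Prop :=
  ∃ B : InnerProductSpace.Core ℂ V,
    (∀ x y, B.inner (A.H x) y = B.inner x (A.H y)) ∧
    (∀ α β x y, B.inner (A.Ω α β x) y = -B.inner x (A.Ω α β y)) ∧
    (∀ α x y, B.inner (A.T α x) y = -B.inner x (A.C α y))

/-- The infinitesimal rotation `Ω_{1,v} = ∑ v^α Ω_{1α}`. -/
def rotationTo [NeZero D] (A : ConformalAction D V) (v : Fin D → ℂ) : Module.End ℂ V :=
  ∑ α, v α • A.Ω 0 α

/-- The real eigenvalues of `i Ω₁₂` on the subspace `W`. (If the action is unitary, all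
eigenvalues of `i Ω₁₂` are real.) -/
def spins [NeZero D] (A : ConformalAction D V) (W : Submodule ℂ V) : Set ℝ :=
  {j | ∃ w ∈ W, w ≠ 0 ∧ Complex.I • A.Ω 0 1 w = (j : ℂ) • w}

end ConformalAction

/-! ### The exponential of a locally finite operator -/

section Exponential

variable {V : Type*} [AddCommGroup V] [Module ℂ V]

/-- `w = ∑ X^k v / k!`, the convergence being tested on all linear functionals. For `v` in a
finite-dimensional `X`-invariant subspace this is the usual convergence in that subspace. -/
def IsExpApply (X : Module.End ℂ V) (v w : V) : Prop :=
  ∀ l : Module.Dual ℂ V, HasSum (fun k : ℕ => ((k.factorial : ℂ))⁻¹ * l ((X ^ k) v)) (l w)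

theorem IsExpApply.unique {X : Module.End ℂ V} {v w w' : V}
    (h : IsExpApply X v w) (h' : IsExpApply X v w') : w = w' := by
  rw [← sub_eq_zero, ← Module.forall_dual_apply_eq_zero_iff ℂ]
  intro l
  rw [map_sub, (h l).unique (h' l), sub_self]

open Classical in
/-- The vector `exp(X) v`. -/
def expApply (X : Module.End ℂ V) (v : V) : V :=
  if h : ∃ w, IsExpApply X v w then h.choose else 0

theorem IsExpApply.expApply_eq {X : Module.End ℂ V} {v w : V}
    (h : IsExpApply X v w) : expApply X v = w := by
  have hw : ∃ w, IsExpApply X v w := ⟨w, h⟩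
  rw [expApply, dif_pos hw]
  exact hw.choose_spec.unique h

end Exponential

/-! ### Harmonic polynomials and the reconstruction -/

open MvPolynomial in
/-- The space of homogeneous harmonic polynomials of degree `m` in `D` variables. -/
def harmonicSubmodule (D m : ℕ) : Submodule ℂ (MvPolynomial (Fin D) ℂ) :=
  homogeneousSubmodule (Fin D) ℂ m ⊓
    LinearMap.ker (∑ α : Fin D, (pderiv (R := ℂ) α).toLinearMap ∘ₗ (pderiv α).toLinearMap)

/-- The dimension of the space of homogeneous harmonic polynomials of degree `m`. -/
abbrev harmonicDim (D m : ℕ) : ℕ := Module.finrank ℂ (harmonicSubmodule D m)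

/-- A choice of a basis `h_{m,σ}` of the harmonic polynomials of each degree `m`. -/
abbrev HarmonicBasis (D : ℕ) : Type :=
  ∀ m : ℕ, Module.Basis (Fin (harmonicDim D m)) ℂ (harmonicSubmodule D m)

section Reconstruction

variable {D : ℕ} {V : Type*} [AddCommGroup V] [Module ℂ V]

/-- The point `u = (cos θ, sin θ · v)` for a vector `v` whose first coordinate is zero. -/
def spherePoint [NeZero D] (θ : ℂ) (v : Fin D → ℂ) : Fin D → ℂ :=
  fun α => if α = 0 then Complex.cos θ else Complex.sin θ * v α

/-- The bilinear maps `μ n m σ` are the coefficients reconstructed from `Y₁` and the conformal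
action: for fixed `n`, `a`, `b` only finitely many are non-zero, and
`∑_{m,σ} μ_{n;m,σ}(a ⊗ b) h_{m,σ}(u) = U(g_u) μ¹_n (U(g_u)⁻¹ a ⊗ U(g_u)⁻¹ b)`
for `u = (cos θ, sin θ · v)` with `v² = 1`, where `U(g_u) = exp(θ Ω_{1,v})`. -/
def IsReconstruction [NeZero D] (𝒱 : VertexAlgebra V) (A : ConformalAction D V)
    (h : HarmonicBasis D)
    (μ : ℤ → (m : ℕ) → Fin (harmonicDim D m) → V →ₗ[ℂ] V →ₗ[ℂ] V) : Prop :=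
  (∀ (n : ℤ) (a b : V),
    {s : Σ m : ℕ, Fin (harmonicDim D m) | μ n s.1 s.2 a b ≠ 0}.Finite) ∧
  ∀ (n : ℤ) (a b : V) (θ : ℂ) (v : Fin D → ℂ), v 0 = 0 → ∑ α, v α ^ 2 = 1 →
    ∑ᶠ s : Σ m : ℕ, Fin (harmonicDim D m),
        MvPolynomial.eval (spherePoint θ v) (h s.1 s.2 : MvPolynomial (Fin D) ℂ) •
          μ n s.1 s.2 a b =
      expApply (θ • A.rotationTo v)
        (𝒱.mu1 n (expApply (-(θ • A.rotationTo v)) a) (expApply (-(θ • A.rotationTo v)) b))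

/-- The polynomial `z² = (z^1)² + ⋯ + (z^D)²`. -/
def zSq (D : ℕ) : MvPolynomial (Fin D) ℂ := ∑ α : Fin D, MvPolynomial.X α ^ 2

/-- The generalized series `∑_{n,m,σ} c_{n;m,σ} (z²)^((n-m)/2) h_{m,σ}(z)` equals
`(z²)^(-N) f(z)` for the formal power series `f ∈ V[[z]]`, given by its coefficients:
after multiplication by `(z²)^N` each term `c_{n;m,σ} ≠ 0` carries a non-negative integral power
`(z²)^((n-m)/2+N)`, each coefficient gets finitely many contributions, and these add up to the
coefficient of `f`. -/
def EqualsLocalizedSeries (h : HarmonicBasis D)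
    (c : ℤ → (m : ℕ) → Fin (harmonicDim D m) → V) (N : ℕ) (f : (Fin D →₀ ℕ) → V) : Prop :=
  (∀ n m σ, c n m σ ≠ 0 → ∃ k : ℕ, n - m + 2 * N = 2 * (k : ℤ)) ∧
  ∀ e : Fin D →₀ ℕ,
    {s : ℤ × Σ m : ℕ, Fin (harmonicDim D m) |
      MvPolynomial.coeff e (zSq D ^ ((s.1 - s.2.1 + 2 * N) / 2).toNat *
        (h s.2.1 s.2.2 : MvPolynomial (Fin D) ℂ)) • c s.1 s.2.1 s.2.2 ≠ 0}.Finite ∧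
    f e = ∑ᶠ s : ℤ × Σ m : ℕ, Fin (harmonicDim D m),
      MvPolynomial.coeff e (zSq D ^ ((s.1 - s.2.1 + 2 * N) / 2).toNat *
        (h s.2.1 s.2.2 : MvPolynomial (Fin D) ℂ)) • c s.1 s.2.1 s.2.2

end Reconstruction

end

/-! Write `μ` for `μ¹_n`, restricted to finite-dimensional rotation-invariant spaces `W'`, `W''` of
energies `Δ'`, `Δ''`. A local even operator that kills the vacuum and satisfies `[X, T] = c T` acts
on modes as a derivation up to a degree term (`VertexAlgebra.commutator_mode`, by the uniqueness of
a field local to all others that kills the vacuum). For `H` this puts the values of `μ` in energy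
`Δ' + Δ'' + n`. For rotations fixing the first axis `c = 0`, so `μ` is an `so(D-1)`-invariant vector
of `Hom(W' ⊗ W'', W)`, where `W` is a finite-dimensional invariant space of that energy containing
the values.

The orbit of such a vector under `SO(D)` is a function on the sphere, and its matrix coefficients
are harmonic polynomials. The proof is infinitesimal: a functional `l` on the Hom space is
represented by a polynomial `q` if all iterated rotation derivatives of `g ↦ l (g μ)` at the
identity are those of `g ↦ q (g e₁)`. Represented functionals form an invariant subspace. Were it
proper, its annihilator would contain a highest weight vector `x`; but pairing with `x` is
represented either by `0` or by a multiple of a power of the isotropic form `z¹ ± i z²`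
(`representedFunctionals_eq_top`). Taylor expansion along one-parameter subgroups turns
representation into the identity on the sphere, and harmonic polynomials of different degrees are
independent there because the Casimir operator separates them. This gives uniqueness, and uniqueness
gives bilinearity.

The same highest weight vectors show which degrees occur. A degree `m` comes from a common
eigenvector of `i Ω₁₂` and of `i (Ω₁₂ + Ω₃₄ + ⋯)` with the same eigenvalue `z`, `|z| = m` (and `z ≥
0` unless `D = 2`). Comparing the even spectrum of `H + i (Ω₁₂ + Ω₃₄ + ⋯)` on the two arguments and
on the value gives `m ≡ n` mod 2. Unitarity and positive energy give `|j| ≤ Δ` for every eigenvalue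
`j` of `i Ω₁₂` in energy `Δ` (`ConformalAction.abs_weight_le`). Applied to a non-zero value, whose
weight is `z + j' + j''` with `j'`, `j''` weights of the arguments, it yields `m - n ≤ Δ' + J' + Δ''
+ J''`. -/

noncomputable section

/-! ### Local fields and derivations of vertex algebras -/

section LocalFields

variable {M : Type*} [AddCommGroup M] [Module ℂ M]

/-- The coefficient of `z^(-m-1) w^(-n-1)` in `(z - w)^N ∑ Φ p q z^(-p-1) w^(-q-1)`. -/
def diffPowCoeff (N : ℕ) (Φ : ℤ → ℤ → M) (m n : ℤ) : M :=
  ∑ j ∈ Finset.range (N + 1), ((-1 : ℂ) ^ j * (N.choose j : ℂ)) • Φ (m + N - j) (n + j)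

theorem diffPowCoeff_succ (N : ℕ) (Φ : ℤ → ℤ → M) (m n : ℤ) :
    diffPowCoeff (N + 1) Φ m n = diffPowCoeff N Φ (m + 1) n - diffPowCoeff N Φ m (n + 1) := by
  unfold diffPowCoeff
  rw [Finset.sum_range_succ' _ N, Finset.sum_range_succ' _ (N + 1)]
  have h : ∀ i : ℕ, ((-1 : ℂ) ^ (i + 1) * ((N + 1).choose (i + 1) : ℂ)) •
      Φ (m + (N + 1 : ℕ) - (i + 1 : ℕ)) (n + (i + 1 : ℕ)) =
      ((-1 : ℂ) ^ (i + 1) * (N.choose (i + 1) : ℂ)) •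
        Φ (m + 1 + N - (i + 1 : ℕ)) (n + (i + 1 : ℕ)) -
      ((-1 : ℂ) ^ i * (N.choose i : ℂ)) • Φ (m + N - i) (n + 1 + i) := by
    intro i
    have e1 : m + (N + 1 : ℕ) - (i + 1 : ℕ) = m + N - i := by push_cast; ring
    have e2 : m + 1 + N - (i + 1 : ℕ) = m + N - i := by push_cast; ring
    have e3 : n + (i + 1 : ℕ) = n + 1 + i := by push_cast; ring
    rw [e1, e2, e3, ← sub_smul, Nat.choose_succ_succ]
    congr 1
    push_cast
    ring
  simp only [h, Finset.sum_sub_distrib]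
  rw [Finset.sum_range_succ (fun i : ℕ => ((-1 : ℂ) ^ (i + 1) * (N.choose (i + 1) : ℂ)) •
        Φ (m + 1 + N - (i + 1 : ℕ)) (n + (i + 1 : ℕ))) N]
  have e4 : m + ((N + 1 : ℕ) : ℤ) - ((0 : ℕ) : ℤ) = m + 1 + N - ((0 : ℕ) : ℤ) := by
    push_cast; ring
  rw [e4]
  simp only [Nat.choose_succ_self, Nat.choose_zero_right, Nat.cast_zero, mul_zero, zero_smul,
    add_zero]
  abel

theorem diffPowCoeff_eq_zero_of_le {Φ : ℤ → ℤ → M} {N N' : ℕ} (hN : N ≤ N')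
    (h : ∀ m n, diffPowCoeff N Φ m n = 0) (m n : ℤ) : diffPowCoeff N' Φ m n = 0 := by
  induction N', hN using Nat.le_induction generalizing m n with
  | base => exact h m n
  | succ k _ ih => rw [diffPowCoeff_succ, ih, ih, sub_zero]

theorem diffPowCoeff_sub (N : ℕ) (Φ Ψ : ℤ → ℤ → M) (m n : ℤ) :
    diffPowCoeff N (fun p q => Φ p q - Ψ p q) m n =
      diffPowCoeff N Φ m n - diffPowCoeff N Ψ m n := by
  simp [diffPowCoeff, smul_sub, Finset.sum_sub_distrib]

theorem diffPowCoeff_smul (N : ℕ) (c : ℂ) (Φ : ℤ → ℤ → M) (m n : ℤ) :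
    diffPowCoeff N (fun p q => c • Φ p q) m n = c • diffPowCoeff N Φ m n := by
  simp only [diffPowCoeff, Finset.smul_sum]
  exact Finset.sum_congr rfl fun j _ => smul_comm _ _ _

/-- Multiplication by the mode index `p` is `-(z ∂_z + 1)`. This is the product rule for `z ∂_z` on
`(z - w)^(N+1) Φ`, with the factor `z` written as `(z - w) + w`; one power of `z - w` is lost, so
the order of locality grows by one. -/
theorem diffPowCoeff_degree_smul (N : ℕ) (Φ : ℤ → ℤ → M) (m n : ℤ) :
    diffPowCoeff (N + 1) (fun p q => (p : ℂ) • Φ p q) m n =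
      ((m : ℂ) + N + 1) • diffPowCoeff (N + 1) Φ m n +
        ((N : ℂ) + 1) • diffPowCoeff N Φ m (n + 1) := by
  have h : ∀ j : ℕ, ((-1 : ℂ) ^ j * ((N + 1).choose j : ℂ)) •
      (((m + (N + 1 : ℕ) - j : ℤ) : ℂ) • Φ (m + (N + 1 : ℕ) - j) (n + j)) =
      ((m : ℂ) + N + 1) • (((-1 : ℂ) ^ j * ((N + 1).choose j : ℂ)) •
        Φ (m + (N + 1 : ℕ) - j) (n + j)) -
      ((-1 : ℂ) ^ j * (j * (N + 1).choose j : ℂ)) • Φ (m + (N + 1 : ℕ) - j) (n + j) := by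
    intro j
    rw [smul_smul, smul_smul, ← sub_smul]
    congr 1
    push_cast
    ring
  simp only [diffPowCoeff]
  rw [Finset.sum_congr rfl (fun j _ => h j), Finset.sum_sub_distrib, ← Finset.smul_sum,
    sub_eq_add_neg]
  congr 1
  rw [Finset.sum_range_succ' _ (N + 1)]
  simp only [Nat.cast_zero, zero_mul, mul_zero, zero_smul, add_zero]
  rw [Finset.smul_sum, ← Finset.sum_neg_distrib]
  refine Finset.sum_congr rfl fun i _ => ?_
  have e1 : m + (N + 1 : ℕ) - (i + 1 : ℕ) = m + N - i := by push_cast; ring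
  have e3 : n + (i + 1 : ℕ) = n + 1 + i := by push_cast; ring
  have e4 : ((i + 1 : ℕ) : ℂ) * ((N + 1).choose (i + 1) : ℂ) = (N + 1) * (N.choose i : ℂ) := by
    have := Nat.add_one_mul_choose_eq N i
    have h2 : (((N + 1) * N.choose i : ℕ) : ℂ) = (((N + 1).choose (i + 1) * (i + 1) : ℕ) : ℂ) := by
      rw [this]
    push_cast at h2 ⊢
    rw [h2]; ring
  rw [e1, e3, e4, smul_smul, ← neg_smul]
  congr 1
  ring

end LocalFields

section VertexDerivations

theorem lie_end_apply {M : Type*} [AddCommGroup M] [Module ℂ M] (X Y : Module.End ℂ M) (v : M) :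
    ⁅X, Y⁆ v = X (Y v) - Y (X v) := rfl

variable {V : Type*} [AddCommGroup V] [Module ℂ V]

theorem mutuallyLocal_iff {s : ℂ} {A B : ℤ → Module.End ℂ V} :
    MutuallyLocal s A B ↔
      ∃ N, ∀ m n, diffPowCoeff N (fun p q => A p * B q - s • (B q * A p)) m n = 0 := by
  simp only [MutuallyLocal, diffPowCoeff_sub, diffPowCoeff_smul, sub_eq_zero]
  rfl

theorem MutuallyLocal.sub {s : ℂ} {A A' B : ℤ → Module.End ℂ V}
    (h : MutuallyLocal s A B) (h' : MutuallyLocal s A' B) :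
    MutuallyLocal s (fun n => A n - A' n) B := by
  rw [mutuallyLocal_iff] at *
  obtain ⟨N, hN⟩ := h
  obtain ⟨N', hN'⟩ := h'
  refine ⟨max N N', fun m n => ?_⟩
  have := diffPowCoeff_sub (max N N') (fun p q => A p * B q - s • (B q * A p))
    (fun p q => A' p * B q - s • (B q * A' p)) m n
  rw [diffPowCoeff_eq_zero_of_le (le_max_left _ _) hN,
    diffPowCoeff_eq_zero_of_le (le_max_right _ _) hN', sub_zero] at this
  rw [← this]
  congr 1
  ext p q v
  simp only [sub_mul, mul_sub, smul_sub]
  abel_nf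

theorem MutuallyLocal.smul {s : ℂ} {A B : ℤ → Module.End ℂ V}
    (h : MutuallyLocal s A B) (c : ℂ) : MutuallyLocal s (fun n => c • A n) B := by
  rw [mutuallyLocal_iff] at *
  obtain ⟨N, hN⟩ := h
  refine ⟨N, fun m n => ?_⟩
  have := diffPowCoeff_smul N c (fun p q => A p * B q - s • (B q * A p)) m n
  rw [hN, smul_zero] at this
  rw [← this]
  congr 1
  ext p q v
  simp [smul_sub, smul_comm s c]

theorem MutuallyLocal.degree_smul {s : ℂ} {A B : ℤ → Module.End ℂ V}
    (h : MutuallyLocal s A B) : MutuallyLocal s (fun n => (n : ℂ) • A n) B := by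
  rw [mutuallyLocal_iff] at *
  obtain ⟨N, hN⟩ := h
  refine ⟨N + 1, fun m n => ?_⟩
  have := diffPowCoeff_degree_smul N (fun p q => A p * B q - s • (B q * A p)) m n
  rw [hN, diffPowCoeff_eq_zero_of_le N.le_succ hN, smul_zero, smul_zero, add_zero] at this
  rw [← this]
  congr 1
  ext p q v
  simp [smul_sub, smul_comm s (p : ℂ)]

namespace VertexAlgebra

variable (𝒱 : VertexAlgebra V)

/-- The mode `a_(n)`. -/
abbrev mode (a : V) (n : ℤ) : Module.End ℂ V := VertexOperator.ncoeff (𝒱.Y a) n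

theorem mode_add (a b : V) (n : ℤ) : 𝒱.mode (a + b) n = 𝒱.mode a n + 𝒱.mode b n := by
  simp [mode]

theorem induction_parity {p : V → Prop} (v : V) (h0 : ∀ i, ∀ a ∈ 𝒱.parity i, p a)
    (hadd : ∀ a b, p a → p b → p (a + b)) : p v := by
  have hv : v ∈ ⨆ i, 𝒱.parity i := by
    rw [𝒱.parity_isInternal.submodule_iSup_eq_top]; trivial
  exact Submodule.iSup_induction _ (motive := p) hv h0 (h0 0 0 (zero_mem _)) hadd

/-- A field which is local with respect to all `Y(b,w)` and annihilates the vacuum is zero. -/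
theorem eq_zero_of_mutuallyLocal (A : ℤ → Module.End ℂ V) (s : ZMod 2 → ℂ)
    (hA : ∀ q, ∀ b ∈ 𝒱.parity q, MutuallyLocal (s q) A (𝒱.mode b))
    (hvac : ∀ n, A n 𝒱.vac = 0) (n : ℤ) : A n = 0 := by
  ext b
  refine 𝒱.induction_parity (p := fun b => A n b = 0) b (fun q b hb => ?_) (fun a b ha hb => ?_)
  · obtain ⟨N, hN⟩ := hA q b hb
    -- Index `-1` selects `w^0`. Since `b_(j-1) 1` is zero for `j > 0` and is `b` for `j = 0`, one
    -- term survives on the left, `A n b`; the right side is zero because `A` kills the vacuum.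
    have h := LinearMap.congr_fun (hN (n - N) (-1)) 𝒱.vac
    simp only [LinearMap.sum_apply, LinearMap.smul_apply, Module.End.mul_apply, hvac, map_zero,
      smul_zero, Finset.sum_const_zero] at h
    rw [Finset.sum_range_succ', Finset.sum_eq_zero] at h
    · rw [𝒱.mode_vac b _ (by simp)] at h
      simpa using h
    · intro j _
      rw [𝒱.mode_vac b _ (by push_cast; linarith), if_neg (by push_cast; linarith), map_zero,
        smul_zero]
  · rw [map_add, ha, hb]; simp

theorem translation_apply (a : V) : 𝒱.translation a = 𝒱.mode a (-2) 𝒱.vac := rfl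

theorem translation_vac : 𝒱.translation 𝒱.vac = 0 := by
  rw [translation_apply, mode, 𝒱.vac_mode]; simp

theorem translation_mode_vac (a : V) (n : ℤ) :
    𝒱.translation (𝒱.mode a n 𝒱.vac) = (-n : ℂ) • 𝒱.mode a (n - 1) 𝒱.vac := by
  have h := 𝒱.translation_covariance a 𝒱.vac n
  have h2 := 𝒱.translation_vac
  rw [translation_apply] at h2 ⊢
  rw [h2, map_zero, sub_zero] at h
  exact h

/-- A local even operator `X` with `X 1 = 0` and `[X, T] = c T` satisfies
`[X, a_(n)] = (X a)_(n) - c (n + 1) a_(n)`. -/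
theorem commutator_mode {X : Module.End ℂ V} (heven : 𝒱.IsEvenEnd X) (hloc : 𝒱.IsLocalEnd X)
    (hvac : X 𝒱.vac = 0) (c : ℂ) (hT : ⁅X, 𝒱.translation⁆ = c • 𝒱.translation) (a : V) (n : ℤ) :
    ⁅X, 𝒱.mode a n⁆ = 𝒱.mode (X a) n - (c * (n + 1)) • 𝒱.mode a n := by
  revert n
  refine 𝒱.induction_parity (p := fun a => ∀ n,
    ⁅X, 𝒱.mode a n⁆ = 𝒱.mode (X a) n - (c * (n + 1)) • 𝒱.mode a n) a
    (fun p a ha => ?_) (fun a b ha hb n => ?_)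
  · intro n
    -- The difference of the two sides is a combination of fields local to every `Y(b,w)`; the term
    -- with `n` needs locality of the degree-weighted field. It remains to test it on the vacuum.
    have key := 𝒱.eq_zero_of_mutuallyLocal
      (fun n => (⁅X, 𝒱.mode a n⁆ - 𝒱.mode (X a) n) -
        ((-c) • ((n : ℂ) • 𝒱.mode a n) - c • 𝒱.mode a n))
      (exchangeSign p)
      (fun q b hb => ((hloc p q a ha b hb).sub (𝒱.locality p q _ (heven p a ha) b hb)).sub
        (((𝒱.locality p q a ha b hb).degree_smul.smul (-c)).sub
          ((𝒱.locality p q a ha b hb).smul c))) ?_ n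
    · rw [sub_eq_zero, sub_eq_iff_eq_add] at key
      rw [key]
      module
    · have hX : ∀ v, X (𝒱.translation v) = 𝒱.translation (X v) + c • 𝒱.translation v := by
        intro v
        have := LinearMap.congr_fun hT v
        rw [lie_end_apply, LinearMap.smul_apply, sub_eq_iff_eq_add] at this
        rw [this, add_comm]
      -- The vectors `a_(-k-1) 1` are the coefficients of `e^(zT) a`, so commuting `X` past `T`
      -- settles them by recursion on `k`.
      have hneg : ∀ k : ℕ, X (𝒱.mode a (-k - 1) 𝒱.vac) =
          𝒱.mode (X a) (-k - 1) 𝒱.vac + (c * k) • 𝒱.mode a (-k - 1) 𝒱.vac := by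
        intro k
        induction k with
        | zero =>
          simp only [Nat.cast_zero, neg_zero, zero_sub, mul_zero, zero_smul, add_zero]
          rw [mode, mode, 𝒱.mode_vac a _ le_rfl, 𝒱.mode_vac (X a) _ le_rfl]
          simp
        | succ k ih =>
          have hk : ((k : ℂ) + 1) ≠ 0 := by exact_mod_cast k.succ_ne_zero
          have e : (-((k + 1 : ℕ) : ℤ) - 1) = -(k : ℤ) - 1 - 1 := by push_cast; ring
          have h1 := 𝒱.translation_mode_vac a (-k - 1)
          have h2 := 𝒱.translation_mode_vac (X a) (-k - 1)
          have h3 := hX (𝒱.mode a (-k - 1) 𝒱.vac)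
          rw [ih, map_add, map_smul, h1, h2, map_smul] at h3
          rw [e]
          push_cast at h3 ⊢
          have e5 : (-(-(k : ℂ) - 1)) = k + 1 := by ring
          rw [e5] at h3
          apply smul_right_injective V hk
          simp only
          rw [h3]
          module
      intro n
      simp only [LinearMap.sub_apply, LinearMap.smul_apply, lie_end_apply, hvac, map_zero,
        sub_zero]
      rcases le_or_gt 0 n with hn | hn
      · rw [mode, mode, 𝒱.mode_vac a n (by linarith), 𝒱.mode_vac (X a) n (by linarith),
          if_neg (by linarith), if_neg (by linarith)]
        simp
      · obtain ⟨k, hk⟩ : ∃ k : ℕ, n = -k - 1 := ⟨(-n - 1).toNat, by omega⟩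
        rw [hk, hneg]
        push_cast
        module
  · rw [mode_add]
    have h : ⁅X, 𝒱.mode a n + 𝒱.mode b n⁆ = ⁅X, 𝒱.mode a n⁆ + ⁅X, 𝒱.mode b n⁆ := by
      simp only [Ring.lie_def]
      noncomm_ring
    rw [h, ha, hb, map_add, mode_add]
    module

theorem mu1_eq_mode (n : ℤ) (a b : V) : 𝒱.mu1 n a b = 𝒱.mode a (-n - 1) b := by
  rw [mu1, mode, VertexOperator.coeff_eq_ncoeff]

/-- `μ¹_n` as a bilinear map. -/
def mu1Bilin (n : ℤ) : V →ₗ[ℂ] V →ₗ[ℂ] V :=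
  LinearMap.mk₂ ℂ (𝒱.mu1 n) (fun a b c => by simp [mu1]) (fun r a b => by simp [mu1])
    (fun a b c => by simp only [mu1, map_add]) (fun r a b => by simp only [mu1, map_smul])

@[simp]
theorem mu1Bilin_apply (n : ℤ) (a b : V) : 𝒱.mu1Bilin n a b = 𝒱.mu1 n a b := rfl

theorem map_mu1 {X : Module.End ℂ V} (heven : 𝒱.IsEvenEnd X) (hloc : 𝒱.IsLocalEnd X)
    (hvac : X 𝒱.vac = 0) (c : ℂ) (hT : ⁅X, 𝒱.translation⁆ = c • 𝒱.translation) (n : ℤ) (a b : V) :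
    X (𝒱.mu1 n a b) = 𝒱.mu1 n (X a) b + 𝒱.mu1 n a (X b) + (c * n) • 𝒱.mu1 n a b := by
  have h := LinearMap.congr_fun (𝒱.commutator_mode heven hloc hvac c hT a (-n - 1)) b
  rw [lie_end_apply, sub_eq_iff_eq_add] at h
  simp only [mu1_eq_mode]
  rw [h, LinearMap.sub_apply, LinearMap.smul_apply]
  push_cast
  module

end VertexAlgebra

end VertexDerivations

/-! ### Infinitesimal rotations of harmonic polynomials -/

section HarmonicPolynomials

open MvPolynomial

variable {D : ℕ}

theorem pderiv_pderiv_comm (i j : Fin D) (p : MvPolynomial (Fin D) ℂ) :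
    pderiv i (pderiv j p) = pderiv j (pderiv i p) := by
  have h : ⁅(pderiv i : Derivation ℂ (MvPolynomial (Fin D) ℂ) (MvPolynomial (Fin D) ℂ)),
      (pderiv j : Derivation ℂ (MvPolynomial (Fin D) ℂ) (MvPolynomial (Fin D) ℂ))⁆ = 0 := by
    refine derivation_ext fun k => ?_
    rw [Derivation.commutator_apply, pderiv_X, pderiv_X]
    simp only [Pi.single_apply]
    split_ifs <;> simp
  have := Derivation.congr_fun h p
  rwa [Derivation.commutator_apply, Derivation.zero_apply, sub_eq_zero] at this

theorem mem_harmonicSubmodule {m : ℕ} {p : MvPolynomial (Fin D) ℂ} :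
    p ∈ harmonicSubmodule D m ↔ p.IsHomogeneous m ∧ ∑ α, pderiv α (pderiv α p) = 0 := by
  simp [harmonicSubmodule]

/-- The infinitesimal rotation `z^α ∂_β - z^β ∂_α`. -/
def polyRotD (α β : Fin D) : Derivation ℂ (MvPolynomial (Fin D) ℂ) (MvPolynomial (Fin D) ℂ) :=
  (X α : MvPolynomial (Fin D) ℂ) • pderiv β - (X β : MvPolynomial (Fin D) ℂ) • pderiv α

theorem polyRotD_apply (α β : Fin D) (p : MvPolynomial (Fin D) ℂ) :
    polyRotD α β p = X α * pderiv β p - X β * pderiv α p := by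
  simp [polyRotD]

/-- The infinitesimal rotation `z^α ∂_β - z^β ∂_α` as a linear operator. -/
def polyRot (α β : Fin D) : Module.End ℂ (MvPolynomial (Fin D) ℂ) := (polyRotD α β).toLinearMap

theorem polyRot_apply (α β : Fin D) (p : MvPolynomial (Fin D) ℂ) :
    polyRot α β p = X α * pderiv β p - X β * pderiv α p := polyRotD_apply α β p

theorem polyRot_antisymm (α β : Fin D) (p : MvPolynomial (Fin D) ℂ) :
    polyRot α β p = -polyRot β α p := by
  rw [polyRot_apply, polyRot_apply]; ring

theorem polyRotD_X (α β γ : Fin D) :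
    polyRotD α β (X γ) = (if β = γ then X α else 0) - (if α = γ then X β else 0) := by
  rw [polyRotD_apply, pderiv_X, pderiv_X]
  simp only [Pi.single_apply, eq_comm (a := γ)]
  split_ifs <;> simp

/-- The commutator is in the order opposite to that of the `Ω`: the vector fields are used through
their transposes, and transposition reverses products. -/
theorem polyRot_commutator (α₁ β₁ α₂ β₂ : Fin D) (p : MvPolynomial (Fin D) ℂ) :
    polyRot α₂ β₂ (polyRot α₁ β₁ p) - polyRot α₁ β₁ (polyRot α₂ β₂ p) =
      (if α₁ = α₂ then polyRot β₁ β₂ p else 0) + (if β₁ = β₂ then polyRot α₁ α₂ p else 0)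
      - (if α₁ = β₂ then polyRot β₁ α₂ p else 0) - (if β₁ = α₂ then polyRot α₁ β₂ p else 0) := by
  have h : ⁅polyRotD α₂ β₂, polyRotD α₁ β₁⁆ =
      (if α₁ = α₂ then polyRotD β₁ β₂ else 0) + (if β₁ = β₂ then polyRotD α₁ α₂ else 0)
      - (if α₁ = β₂ then polyRotD β₁ α₂ else 0) - (if β₁ = α₂ then polyRotD α₁ β₂ else 0) := by
    refine derivation_ext fun γ => ?_
    have hite : ∀ (P : Prop) [Decidable P] (d : Derivation ℂ (MvPolynomial (Fin D) ℂ)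
        (MvPolynomial (Fin D) ℂ)), (if P then d else 0) (X γ) = if P then d (X γ) else 0 := by
      intro P _ d; split_ifs <;> simp
    have hite2 : ∀ (P : Prop) [Decidable P] (d : Derivation ℂ (MvPolynomial (Fin D) ℂ)
        (MvPolynomial (Fin D) ℂ)) (x : MvPolynomial (Fin D) ℂ),
        d (if P then x else 0) = if P then d x else 0 := by
      intro P _ d x; split_ifs <;> simp
    simp only [Derivation.commutator_apply, Derivation.sub_apply, Derivation.add_apply, hite,
      polyRotD_X, map_sub, hite2]
    simp only [eq_comm (a := α₂) (b := α₁), eq_comm (a := β₂) (b := β₁),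
      eq_comm (a := β₂) (b := α₁), eq_comm (a := α₂) (b := β₁)]
    by_cases h1 : α₁ = γ <;> by_cases h2 : β₁ = γ <;> by_cases h3 : α₂ = γ <;>
      by_cases h4 : β₂ = γ <;> simp only [h1, h2, h3, h4, if_true, if_false] <;>
      (try split_ifs) <;> simp_all
  have h2 := Derivation.congr_fun h p
  have hite : ∀ (P : Prop) [Decidable P] (d : Derivation ℂ (MvPolynomial (Fin D) ℂ)
      (MvPolynomial (Fin D) ℂ)), (if P then d else 0) p = if P then d p else 0 := by
    intro P _ d; split_ifs <;> simp
  simp only [Derivation.commutator_apply, Derivation.sub_apply, Derivation.add_apply, hite] at h2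
  exact h2

theorem polyRot_mem_harmonicSubmodule (α β : Fin D) {m : ℕ} {p : MvPolynomial (Fin D) ℂ}
    (hp : p ∈ harmonicSubmodule D m) : polyRot α β p ∈ harmonicSubmodule D m := by
  rw [mem_harmonicSubmodule] at hp ⊢
  obtain ⟨hm, hΔ⟩ := hp
  have hd : ∀ i j, (X i * pderiv j p : MvPolynomial (Fin D) ℂ).IsHomogeneous m := by
    intro i j
    rcases m with _ | m
    · have : pderiv j p = 0 := by
        rw [← totalDegree_zero_iff_isHomogeneous, totalDegree_eq_zero_iff_eq_C] at hm
        rw [hm, pderiv_C]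
      rw [this, mul_zero]
      exact isHomogeneous_zero _ _ _
    · have := (isHomogeneous_X ℂ i).mul (hm.pderiv (i := j))
      rwa [Nat.add_sub_cancel, add_comm] at this
  have hL : ∀ i j, ∑ γ, pderiv γ (pderiv γ (X i * pderiv j p)) =
      2 * pderiv i (pderiv j p) := by
    intro i j
    have : ∀ γ, pderiv γ (pderiv γ (X i * pderiv j p)) =
        (if γ = i then 2 * pderiv γ (pderiv j p) else 0) +
          X i * pderiv j (pderiv γ (pderiv γ p)) := by
      intro γ
      simp only [pderiv_mul, map_add, pderiv_X, Pi.single_apply]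
      rw [pderiv_pderiv_comm γ j p, pderiv_pderiv_comm γ j (pderiv γ p)]
      by_cases h : γ = i
      · subst h; simp; ring
      · rw [if_neg h, if_neg (Ne.symm h)]; simp
    simp only [this, Finset.sum_add_distrib, Finset.sum_ite_eq', Finset.mem_univ, if_true]
    rw [← Finset.mul_sum, ← map_sum, hΔ, map_zero, mul_zero, add_zero]
  rw [polyRot_apply]
  refine ⟨(hd α β).sub (hd β α), ?_⟩
  simp only [map_sub, Finset.sum_sub_distrib, hL]
  rw [pderiv_pderiv_comm α β, sub_self]

/-- The span of the homogeneous harmonic polynomials whose degree belongs to `K`. -/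
def harmonicsOfDegrees (D : ℕ) (K : Set ℕ) : Submodule ℂ (MvPolynomial (Fin D) ℂ) :=
  ⨆ m ∈ K, harmonicSubmodule D m

theorem mem_harmonicsOfDegrees {K : Set ℕ} {m : ℕ} (hm : m ∈ K) {p : MvPolynomial (Fin D) ℂ}
    (hp : p ∈ harmonicSubmodule D m) : p ∈ harmonicsOfDegrees D K :=
  Submodule.mem_iSup_of_mem m (Submodule.mem_iSup_of_mem hm hp)

theorem polyRot_mem_harmonicsOfDegrees {K : Set ℕ} (α β : Fin D) {p : MvPolynomial (Fin D) ℂ}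
    (hp : p ∈ harmonicsOfDegrees D K) : polyRot α β p ∈ harmonicsOfDegrees D K := by
  have : harmonicsOfDegrees D K ≤ (harmonicsOfDegrees D K).comap (polyRot α β) :=
    iSup₂_le fun m hm p hp =>
      mem_harmonicsOfDegrees hm (polyRot_mem_harmonicSubmodule α β hp)
  exact this hp

/-! ### Powers of isotropic linear forms -/

section IsotropicPowers

variable [NeZero D]

/-- The linear form `z^1 + c z^2`. -/
def isotropicForm (D : ℕ) [NeZero D] (c : ℂ) : MvPolynomial (Fin D) ℂ := X 0 + C c * X 1

/-- The Laplacian of the power contains the squared length `1 + c²` of the coefficient vector, which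
is zero. These powers are the extremal weight vectors of the harmonic polynomials. -/
theorem isotropicForm_pow_mem (hD : 2 ≤ D) {c : ℂ} (hc : c * c = -1) (m : ℕ) :
    isotropicForm D c ^ m ∈ harmonicSubmodule D m := by
  have h01 : (0 : Fin D) ≠ 1 := by
    obtain ⟨k, rfl⟩ := Nat.exists_eq_add_of_le' hD
    exact Fin.zero_ne_one
  rw [mem_harmonicSubmodule]
  constructor
  · have h1 : (isotropicForm D c).IsHomogeneous 1 :=
      (isHomogeneous_X ℂ _).add (isHomogeneous_C_mul_X c 1)
    simpa using h1.pow m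
  · have hd : ∀ α, pderiv α (isotropicForm D c) =
        C ((if α = 0 then 1 else 0) + (if α = 1 then c else 0)) := by
      intro α
      simp only [isotropicForm, map_add, pderiv_C_mul, pderiv_X, Pi.single_apply,
        eq_comm (b := α)]
      split_ifs <;> simp
    have h2 : ∀ α : Fin D, pderiv α (pderiv α (isotropicForm D c ^ m)) =
        (m : MvPolynomial (Fin D) ℂ) * ((m - 1 : ℕ) : MvPolynomial (Fin D) ℂ) *
          isotropicForm D c ^ (m - 1 - 1) *
          C ((if α = 0 then 1 else 0) + (if α = 1 then c * c else 0)) := by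
      intro α
      have e : (C ((if α = 0 then 1 else 0) + (if α = 1 then c * c else 0)) :
          MvPolynomial (Fin D) ℂ) = C ((if α = 0 then 1 else 0) + (if α = 1 then c else 0)) *
            C ((if α = 0 then 1 else 0) + (if α = 1 then c else 0)) := by
        rw [← C_mul]
        congr 1
        by_cases h0 : α = 0
        · have h1 : α ≠ 1 := by rw [h0]; exact h01
          simp [h0, h01]
        · by_cases h1 : α = 1 <;> simp [h0, h1, h01.symm, -Fin.one_eq_zero_iff]
      rw [e, pderiv_pow, pderiv_mul, pderiv_mul, pderiv_pow, hd, pderiv_C]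
      have : pderiv α ((m : ℕ) : MvPolynomial (Fin D) ℂ) = 0 := by
        rw [← map_natCast (C : ℂ →+* MvPolynomial (Fin D) ℂ), pderiv_C]
      rw [this]
      ring
    simp only [h2]
    rw [← Finset.mul_sum, ← map_sum, Finset.sum_add_distrib]
    simp [hc]

theorem polyRot_isotropicForm_pow (c : ℂ) (α β : Fin D) (m : ℕ) :
    polyRot α β (isotropicForm D c ^ m) =
      m • isotropicForm D c ^ (m - 1) • polyRot α β (isotropicForm D c) :=
  (polyRotD α β).leibniz_pow _ _

theorem polyRot_zero_one_isotropicForm_pow (hD : 2 ≤ D) {c : ℂ} (hc : c * c = -1) (m : ℕ) :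
    polyRot 0 1 (isotropicForm D c ^ m) = (m * c : ℂ) • isotropicForm D c ^ m := by
  have h01 : (0 : Fin D) ≠ 1 := by
    obtain ⟨k, rfl⟩ := Nat.exists_eq_add_of_le' hD
    exact Fin.zero_ne_one
  have h : polyRot 0 1 (isotropicForm D c) = c • isotropicForm D c := by
    have e : C c * C c = (-1 : MvPolynomial (Fin D) ℂ) := by rw [← C_mul, hc]; simp
    rw [polyRot_apply, isotropicForm]
    simp only [map_add, pderiv_C_mul, pderiv_X_self, pderiv_X_of_ne h01, pderiv_X_of_ne h01.symm,
      smul_eq_C_mul]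
    linear_combination (-X 1) * e
  rw [polyRot_isotropicForm_pow, h]
  rcases m with _ | m
  · simp
  · simp only [Nat.add_sub_cancel, smul_eq_mul, smul_eq_C_mul, nsmul_eq_mul, C_mul, map_natCast,
      pow_succ]
    ring

/-- The linear form is annihilated by this first order operator, hence so are its powers. For `c =
-i` this is the highest weight condition imposed on functionals below. -/
theorem polyRot_isotropicForm_pow_eq_zero {c : ℂ} (hc : c * c = -1) {k : Fin D}
    (hk0 : k ≠ 0) (hk1 : k ≠ 1) (m : ℕ) :
    polyRot 0 k (isotropicForm D c ^ m) + c • polyRot 1 k (isotropicForm D c ^ m) = 0 := by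
  by_cases h01 : (0 : Fin D) = 1
  · have : ∀ D : ℕ, ∀ _ : NeZero D, (0 : Fin D) = 1 → D = 1 := by
      intro D _ h
      by_contra hne
      obtain ⟨k, rfl⟩ := Nat.exists_eq_add_of_le' (show 2 ≤ D by have := NeZero.pos D; omega)
      exact Fin.zero_ne_one h
    have hD := this D _ h01
    subst hD
    exact absurd (Subsingleton.elim k 0) hk0
  have h : polyRot 0 k (isotropicForm D c) + c • polyRot 1 k (isotropicForm D c) = 0 := by
    have e : C c * C c = (-1 : MvPolynomial (Fin D) ℂ) := by rw [← C_mul, hc]; simp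
    simp only [polyRot_apply, isotropicForm]
    simp only [map_add, pderiv_C_mul, pderiv_X_self, pderiv_X_of_ne h01,
      pderiv_X_of_ne (Ne.symm h01), smul_eq_C_mul, pderiv_X_of_ne hk0.symm,
      pderiv_X_of_ne hk1.symm]
    linear_combination (-X k) * e
  rw [polyRot_isotropicForm_pow, polyRot_isotropicForm_pow]
  have : ∀ x y P : MvPolynomial (Fin D) ℂ, m • P • x + c • m • P • y =
      m • P • (x + c • y) := by
    intro x y P
    simp only [smul_eq_mul, nsmul_eq_mul, smul_eq_C_mul]; ring
  rw [this, h]; simp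

theorem eval_isotropicForm_pow (hD : 2 ≤ D) (c : ℂ) (m : ℕ) :
    eval (Pi.single 0 1) (isotropicForm D c ^ m) = 1 := by
  have h01 : (1 : Fin D) ≠ 0 := by
    obtain ⟨k, rfl⟩ := Nat.exists_eq_add_of_le' hD
    exact Fin.zero_ne_one.symm
  simp [isotropicForm, h01]

end IsotropicPowers

/-! ### Harmonic polynomials are determined by their values on the real sphere -/

theorem hasDerivAt_eval {γ : ℂ → Fin D → ℂ} {γ' : Fin D → ℂ} {t : ℂ}
    (hγ : ∀ i, HasDerivAt (fun s => γ s i) (γ' i) t) (p : MvPolynomial (Fin D) ℂ) :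
    HasDerivAt (fun s => eval (γ s) p) (∑ i, γ' i * eval (γ t) (pderiv i p)) t := by
  induction p using MvPolynomial.induction_on with
  | C a => simpa using hasDerivAt_const t a
  | add p q hp hq =>
    simp only [map_add, mul_add, Finset.sum_add_distrib]
    exact hp.add hq
  | mul_X p i hp =>
    have h := hp.mul (hγ i)
    simp only [pderiv_mul, map_add, map_mul, eval_X, pderiv_X]
    refine h.congr_deriv ?_
    simp only [mul_add, Finset.sum_add_distrib, Finset.sum_mul, mul_assoc]
    congr 1
    rw [Finset.sum_eq_single i]
    · simp; ring
    · intro j _ hj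
      simp [hj.symm]
    · simp

/-- The polynomials vanishing on the real unit sphere. -/
def sphereVanishing (D : ℕ) : Submodule ℂ (MvPolynomial (Fin D) ℂ) where
  carrier := {p | ∀ x : Fin D → ℝ, ∑ i, x i ^ 2 = 1 → eval (fun i => (x i : ℂ)) p = 0}
  add_mem' hp hq x hx := by rw [map_add, hp x hx, hq x hx, add_zero]
  zero_mem' x _ := map_zero _
  smul_mem' c p hp x hx := by rw [smul_eval, hp x hx, mul_zero]

/-- The vector field is tangent to the sphere: differentiate along the rotation in the `(α,
β)`-plane, which stays on the sphere. -/
theorem polyRot_mem_sphereVanishing (α β : Fin D) {p : MvPolynomial (Fin D) ℂ}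
    (hp : p ∈ sphereVanishing D) : polyRot α β p ∈ sphereVanishing D := by
  intro x hx
  by_cases hαβ : α = β
  · rw [hαβ, polyRot_apply, sub_self, map_zero]
  let γ : ℂ → Fin D → ℂ := fun t i =>
    if i = α then Complex.cos t * x α - Complex.sin t * x β
    else if i = β then Complex.cos t * x β + Complex.sin t * x α else x i
  let γ' : Fin D → ℂ := fun i => if i = α then -(x β : ℂ) else if i = β then (x α : ℂ) else 0
  have hγ0 : γ 0 = fun i => (x i : ℂ) := by
    funext i
    simp only [γ]
    split_ifs with h1 h2 <;> simp_all
  have hγ : ∀ i, HasDerivAt (fun s => γ s i) (γ' i) 0 := by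
    intro i
    have hc := Complex.hasDerivAt_cos 0
    have hs := Complex.hasDerivAt_sin 0
    simp only [Complex.sin_zero, Complex.cos_zero, neg_zero] at hc hs
    simp only [γ, γ']
    split_ifs
    · exact ((hc.mul_const (x α : ℂ)).sub (hs.mul_const (x β : ℂ))).congr_deriv (by ring)
    · exact ((hc.mul_const (x β : ℂ)).add (hs.mul_const (x α : ℂ))).congr_deriv (by ring)
    · exact hasDerivAt_const _ _
  have h1 := hasDerivAt_eval hγ p
  have h2 : (fun t : ℝ => eval (γ t) p) = fun _ => 0 := by
    funext t
    have hreal : γ t = fun i => (((if i = α then Real.cos t * x α - Real.sin t * x β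
        else if i = β then Real.cos t * x β + Real.sin t * x α else x i : ℝ)) : ℂ) := by
      funext i
      simp only [γ]
      split_ifs <;> push_cast <;> rfl
    rw [hreal]
    refine hp _ ?_
    rw [← hx, ← sub_eq_zero, ← Finset.sum_sub_distrib,
      ← Finset.sum_subset (Finset.subset_univ {α, β}), Finset.sum_pair hαβ]
    · simp only [if_true, if_neg (Ne.symm hαβ)]
      linear_combination (x α ^ 2 + x β ^ 2) * Real.sin_sq_add_cos_sq t
    · intro i _ hi
      simp only [Finset.mem_insert, Finset.mem_singleton, not_or] at hi
      rw [if_neg hi.1, if_neg hi.2, sub_self]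
  have h3 := HasDerivAt.comp_ofReal (z := (0 : ℝ)) (by simpa using h1)
  rw [h2] at h3
  have h4 := h3.unique (hasDerivAt_const _ _)
  rw [hγ0, ← Finset.sum_subset (Finset.subset_univ {α, β}), Finset.sum_pair hαβ] at h4
  · simp only [γ', if_true, if_neg (Ne.symm hαβ)] at h4
    rw [polyRot_apply, map_sub, map_mul, map_mul, eval_X, eval_X, ← h4]
    ring
  · intro i _ hi
    simp only [Finset.mem_insert, Finset.mem_singleton, not_or] at hi
    simp [γ', hi.1, hi.2]

/-- The Casimir operator is a combination of the squared length times the Laplacian, and of the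
Euler operator, so harmonicity and homogeneity make it a scalar. -/
theorem sum_polyRot_polyRot {m : ℕ} {p : MvPolynomial (Fin D) ℂ}
    (hp : p ∈ harmonicSubmodule D m) :
    ∑ α, ∑ β, polyRot α β (polyRot α β p) = (-2 * (m * (m + D - 2)) : ℂ) • p := by
  obtain ⟨hm, hΔ⟩ := mem_harmonicSubmodule.1 hp
  have hE := hm.sum_X_mul_pderiv
  have hE2 : ∑ α, ∑ β, (X α * X β * pderiv α (pderiv β p) : MvPolynomial (Fin D) ℂ) =
      (m : MvPolynomial (Fin D) ℂ) * (m - 1) * p := by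
    have h1 : ∀ α, ∑ β, X β * pderiv α (pderiv β p) = ((m : MvPolynomial (Fin D) ℂ) - 1) *
        pderiv α p := by
      intro α
      have h2 := congrArg (pderiv α) hE
      rw [map_sum, map_nsmul] at h2
      simp only [pderiv_mul, pderiv_X, Pi.single_apply, Finset.sum_add_distrib, ite_mul, one_mul,
        zero_mul, Finset.sum_ite_eq', Finset.mem_univ, if_true,
        nsmul_eq_mul] at h2
      linear_combination h2
    simp only [mul_assoc, ← Finset.mul_sum, h1]
    have h3 : ∀ α, (X α * (((m : MvPolynomial (Fin D) ℂ) - 1) * pderiv α p)) =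
      ((m : MvPolynomial (Fin D) ℂ) - 1) * (X α * pderiv α p) := fun α => by ring
    simp only [h3, ← Finset.mul_sum]
    rw [hE, nsmul_eq_mul]; ring
  have hterm : ∀ α β, polyRot α β (polyRot α β p) =
      (if α = β then 2 * (X β * pderiv β p) else 0) + X α * X α * pderiv β (pderiv β p)
      + X β * X β * pderiv α (pderiv α p) - X α * pderiv α p - X β * pderiv β p
      - 2 * (X α * X β * pderiv α (pderiv β p)) := by
    intro α β
    simp only [polyRot_apply, map_sub, pderiv_mul, pderiv_X_self]
    rw [pderiv_pderiv_comm β α]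
    by_cases h : α = β
    · subst h; simp; ring
    · rw [if_neg h, pderiv_X_of_ne h, pderiv_X_of_ne (Ne.symm h)]; ring
  simp only [hterm, Finset.sum_add_distrib, Finset.sum_sub_distrib, Finset.sum_ite_eq,
    Finset.mem_univ, if_true, ← Finset.mul_sum, ← Finset.smul_sum, hΔ, hE, hE2, mul_zero,
    Finset.sum_const_zero, Finset.sum_const, Finset.card_univ, Fintype.card_fin]
  rw [Finset.sum_comm]
  have hE3 : ∑ α, X α * (D • pderiv α p) = D • m • p := by
    simp only [mul_smul_comm, ← Finset.smul_sum, hE]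
  simp only [← Finset.mul_sum, hE3, hΔ, mul_zero, Finset.sum_const_zero]
  simp only [smul_eq_C_mul, nsmul_eq_mul]
  simp only [map_mul, map_neg, map_sub, map_add, map_natCast, map_ofNat]
  ring

/-- By scaling, the polynomial vanishes on the open positive orthant, a product of infinite sets. -/
theorem eq_zero_of_mem_sphereVanishing {m : ℕ} {p : MvPolynomial (Fin D) ℂ} (hD : 0 < D)
    (hp : p.IsHomogeneous m) (h : p ∈ sphereVanishing D) : p = 0 := by
  refine funext_set (fun _ => (fun r : ℝ => (r : ℂ)) '' Set.Ioi 0)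
    (fun _ => (Set.Ioi_infinite _).image Complex.ofReal_injective.injOn) fun x hx => ?_
  choose y hy hyx using fun i => hx i trivial
  have hpos : 0 < ∑ i, y i ^ 2 :=
    Finset.sum_pos (fun i _ => pow_pos (hy i) 2) ⟨⟨0, hD⟩, Finset.mem_univ _⟩
  set r := Real.sqrt (∑ i, y i ^ 2) with hr
  have hr0 : 0 < r := Real.sqrt_pos.2 hpos
  have h1 := h (fun i => y i / r) (by
    simp only [div_pow, ← Finset.sum_div]
    rw [hr, Real.sq_sqrt hpos.le, div_self hpos.ne'])
  have h2 : eval (fun i => (r : ℂ) * ((y i / r : ℝ) : ℂ)) p =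
      (r : ℂ) ^ m * eval (fun i => ((y i / r : ℝ) : ℂ)) p := by
    simp only [eval_eq, Finset.mul_sum]
    refine Finset.sum_congr rfl fun d hd => ?_
    simp only [mul_pow, Finset.prod_mul_distrib, Finset.prod_pow_eq_pow_sum]
    have : ∑ i ∈ d.support, d i = m := (hp.degree_eq_sum_deg_support hd).symm
    rw [this]; ring
  have h3 : x = fun i => (r : ℂ) * ((y i / r : ℝ) : ℂ) := by
    funext i
    rw [← hyx i]
    push_cast
    have : (r : ℂ) ≠ 0 := by exact_mod_cast hr0.ne'
    field_simp
  rw [h3, h2, h1, mul_zero, map_zero]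

/-- Harmonic polynomials of different degrees are linearly independent on the real sphere. -/
theorem harmonic_eq_zero_of_sum_mem_sphereVanishing (hD : 2 ≤ D) (s : Finset ℕ) :
    ∀ q : ℕ → MvPolynomial (Fin D) ℂ, (∀ m ∈ s, q m ∈ harmonicSubmodule D m) →
      ∑ m ∈ s, q m ∈ sphereVanishing D → ∀ m ∈ s, q m = 0 := by
  suffices H : ∀ q : ℕ → MvPolynomial (Fin D) ℂ, (∀ m ∈ s, q m ∈ harmonicSubmodule D m) →
      ∑ m ∈ s, q m ∈ sphereVanishing D → ∀ m ∈ s, q m ∈ sphereVanishing D by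
    intro q hq hs m hm
    exact eq_zero_of_mem_sphereVanishing (by omega) (mem_harmonicSubmodule.1 (hq m hm)).1
      (H q hq hs m hm)
  induction s using Finset.induction_on with
  | empty => intro q _ _ m hm; simp at hm
  | insert k s hk ih =>
    intro q hq hs
    -- Casimir eigenvalues. They differ for different degrees since `c m - c k = -2 (m - k)(m + k +
    -- D - 2)` and `D ≥ 2`; subtracting `c k` times the sum from its Casimir image removes degree
    -- `k`.
    let c : ℕ → ℂ := fun m => -2 * (m * (m + D - 2))
    have hc : ∀ m ∈ s, c m - c k ≠ 0 := by
      intro m hm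
      have hmk : (m : ℂ) - k ≠ 0 := by
        rw [sub_ne_zero]
        exact fun h => hk (by rwa [← Nat.cast_injective h])
      have hsum : (m : ℂ) + k + D - 2 ≠ 0 := by
        intro h0
        have h1 : (((m + k + D : ℕ)) : ℂ) = ((2 : ℕ) : ℂ) := by
          push_cast; linear_combination h0
        have h2 := Nat.cast_injective h1
        have : m = k := by omega
        exact hk (this ▸ hm)
      have : c m - c k = -2 * (((m : ℂ) - k) * (m + k + D - 2)) := by simp only [c]; ring
      rw [this]
      exact mul_ne_zero (by norm_num) (mul_ne_zero hmk hsum)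
    have h1 : ∑ α, ∑ β, polyRot α β (polyRot α β (∑ m ∈ insert k s, q m)) ∈ sphereVanishing D :=
      sum_mem fun α _ => sum_mem fun β _ =>
        polyRot_mem_sphereVanishing α β (polyRot_mem_sphereVanishing α β hs)
    have h2 : ∑ α, ∑ β, polyRot α β (polyRot α β (∑ m ∈ insert k s, q m)) =
        ∑ m ∈ insert k s, c m • q m := by
      simp only [map_sum]
      rw [Finset.sum_congr rfl fun α _ => Finset.sum_comm, Finset.sum_comm]
      exact Finset.sum_congr rfl fun m hm => sum_polyRot_polyRot (hq m hm)
    have h3 : ∑ m ∈ s, (c m - c k) • q m ∈ sphereVanishing D := by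
      have := sub_mem (h2 ▸ h1) ((sphereVanishing D).smul_mem (c k) hs)
      rw [Finset.smul_sum, ← Finset.sum_sub_distrib, Finset.sum_insert hk, sub_self, zero_add]
        at this
      simpa only [sub_smul] using this
    have h4 : ∀ m ∈ s, q m ∈ sphereVanishing D := by
      intro m hm
      have := ih (fun m => (c m - c k) • q m)
        (fun m hm => Submodule.smul_mem _ _ (hq m (Finset.mem_insert_of_mem hm))) h3 m hm
      exact ((sphereVanishing D).smul_mem_iff (hc m hm)).1 this
    intro m hm
    rcases Finset.mem_insert.1 hm with rfl | hm
    · rw [Finset.sum_insert hk] at hs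
      exact (Submodule.add_mem_iff_left _ (sum_mem h4)).1 hs
    · exact h4 m hm

end HarmonicPolynomials

/-! ### Actions of infinitesimal rotations -/

section RotationActions

variable {D : ℕ} {M : Type*} [AddCommGroup M] [Module ℂ M]

/-- The operators `Ω α β` satisfy the commutation relations of the infinitesimal rotations. -/
structure IsRotationAction (Ω : Fin D → Fin D → Module.End ℂ M) : Prop where
  antisymm : ∀ α β x, Ω α β x = -Ω β α x
  comm : ∀ α₁ β₁ α₂ β₂ x, Ω α₁ β₁ (Ω α₂ β₂ x) - Ω α₂ β₂ (Ω α₁ β₁ x) =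
    (if α₁ = α₂ then Ω β₁ β₂ x else 0) + (if β₁ = β₂ then Ω α₁ α₂ x else 0)
      - (if α₁ = β₂ then Ω β₁ α₂ x else 0) - (if β₁ = α₂ then Ω α₁ β₂ x else 0)

/-- The smallest subspace containing `Φ` and invariant under all `Ω α β`. -/
def rotationClosure (Ω : Fin D → Fin D → Module.End ℂ M) (Φ : M) : Submodule ℂ M :=
  sInf {Z | Φ ∈ Z ∧ ∀ α β, ∀ x ∈ Z, Ω α β x ∈ Z}

theorem mem_rotationClosure_self (Ω : Fin D → Fin D → Module.End ℂ M) (Φ : M) :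
    Φ ∈ rotationClosure Ω Φ :=
  Submodule.mem_sInf.2 fun _ hZ => hZ.1

theorem map_mem_rotationClosure {Ω : Fin D → Fin D → Module.End ℂ M} {Φ x : M}
    (hx : x ∈ rotationClosure Ω Φ) (α β : Fin D) : Ω α β x ∈ rotationClosure Ω Φ :=
  Submodule.mem_sInf.2 fun Z hZ => hZ.2 α β x (Submodule.mem_sInf.1 hx Z hZ)

theorem rotationClosure_le {Ω : Fin D → Fin D → Module.End ℂ M} {Φ : M} {Z : Submodule ℂ M}
    (h0 : Φ ∈ Z) (h : ∀ α β, ∀ x ∈ Z, Ω α β x ∈ Z) : rotationClosure Ω Φ ≤ Z :=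
  sInf_le ⟨h0, h⟩

namespace IsRotationAction

variable {Ω : Fin D → Fin D → Module.End ℂ M}

theorem self_eq_zero (hΩ : IsRotationAction Ω) (α : Fin D) (x : M) : Ω α α x = 0 := by
  have h : Ω α α x + Ω α α x = 0 := by
    nth_rewrite 1 [hΩ.antisymm α α x]
    exact neg_add_cancel _
  have h2 : (2 : ℂ) • Ω α α x = 0 := by rw [two_smul, h]
  exact (smul_eq_zero.1 h2).resolve_left two_ne_zero

/-- A functional of highest weight which vanishes on a vector `Φ` invariant under the rotations
fixing the first basis vector vanishes on everything generated by `Φ`. -/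
theorem eq_zero_of_highestWeight [NeZero D] (hΩ : IsRotationAction Ω) {Φ : M}
    (hΦ : ∀ α β, α ≠ 0 → β ≠ 0 → Ω α β Φ = 0) (l : Module.Dual ℂ M) (c : ℂ) (h0 : l Φ = 0)
    (h1 : ∀ x, l (Ω 0 1 x) = c * l x)
    (h2 : ∀ k, k ≠ 0 → k ≠ 1 → ∀ x, l (Ω 0 k x - Complex.I • Ω 1 k x) = 0)
    {x : M} (hx : x ∈ rotationClosure Ω Φ) : l x = 0 := by
  -- The operators in `P`, together with the rotations fixing the first axis, span all rotations.
  -- Instead of ordering products, it is shown that the smallest space `Z` closed under the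
  -- operators in `P` alone is already invariant under every rotation.
  let P : Submodule ℂ M → Prop := fun Z => Φ ∈ Z ∧ (∀ x ∈ Z, Ω 0 1 x ∈ Z) ∧
    ∀ k, k ≠ 0 → k ≠ 1 → ∀ x ∈ Z, Ω 0 k x - Complex.I • Ω 1 k x ∈ Z
  let Z : Submodule ℂ M := sInf {Z | P Z}
  have hZP : P Z := ⟨Submodule.mem_sInf.2 fun _ h => h.1,
    fun x hx => Submodule.mem_sInf.2 fun Z' h => h.2.1 x (Submodule.mem_sInf.1 hx Z' h),
    fun k hk hk' x hx => Submodule.mem_sInf.2 fun Z' h =>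
      h.2.2 k hk hk' x (Submodule.mem_sInf.1 hx Z' h)⟩
  have hZle : ∀ Z', P Z' → Z ≤ Z' := fun Z' h => sInf_le h
  have hker : Z ≤ LinearMap.ker l := hZle _ ⟨h0, fun x hx => by
    rw [LinearMap.mem_ker] at hx ⊢; rw [h1, hx, mul_zero], fun k hk hk' x _ => h2 k hk hk' x⟩
  -- The vectors of `Z` that rotations keep in `Z`. Commutators of rotations are rotations, so `G`
  -- is again closed under the operators in `P`, and minimality gives `Z ≤ G`.
  let G : Submodule ℂ M := Z ⊓ ⨅ α, ⨅ β, Z.comap (Ω α β)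
  have hG : ∀ x, x ∈ G ↔ x ∈ Z ∧ ∀ α β, Ω α β x ∈ Z := by
    intro x
    simp [G, Submodule.mem_iInf]
  have hcomm : ∀ x ∈ G, ∀ α₁ β₁ α₂ β₂, Ω α₁ β₁ (Ω α₂ β₂ x) - Ω α₂ β₂ (Ω α₁ β₁ x) ∈ Z := by
    intro x hx α₁ β₁ α₂ β₂
    have hx' := ((hG x).1 hx).2
    have hite : ∀ (Q : Prop) [Decidable Q] (α β : Fin D), (if Q then Ω α β x else 0) ∈ Z := by
      intro Q _ α β
      split_ifs
      · exact hx' α β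
      · exact zero_mem _
    rw [hΩ.comm]
    exact sub_mem (sub_mem (add_mem (hite _ _ _) (hite _ _ _)) (hite _ _ _)) (hite _ _ _)
  have hGP : P G := by
    refine ⟨(hG Φ).2 ⟨hZP.1, ?_⟩, fun x hx => (hG _).2 ⟨((hG x).1 hx).2 0 1, fun α β => ?_⟩,
      fun k hk hk' x hx => (hG _).2 ⟨hZP.2.2 k hk hk' x ((hG x).1 hx).1, fun α β => ?_⟩⟩
    · have h0β : ∀ β, Ω 0 β Φ ∈ Z := by
        intro β
        by_cases hβ0 : β = 0
        · rw [hβ0, hΩ.self_eq_zero]; exact zero_mem _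
        by_cases hβ1 : β = 1
        · rw [hβ1]; exact hZP.2.1 Φ hZP.1
        have h := hZP.2.2 β hβ0 hβ1 Φ hZP.1
        by_cases h10 : (1 : Fin D) = 0
        · have h' : Ω 1 β Φ = Ω 0 β Φ := by rw [h10]
          have hne : (1 - Complex.I) ≠ 0 := by
            intro h; have := congrArg Complex.re h; simp at this
          rw [h'] at h
          have h3 : Ω 0 β Φ - Complex.I • Ω 0 β Φ = (1 - Complex.I) • Ω 0 β Φ := by module
          rw [h3] at h
          exact (Z.smul_mem_iff hne).1 h
        · rwa [hΦ 1 β h10 hβ0, smul_zero, sub_zero] at h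
      intro α β
      by_cases hα : α = 0
      · rw [hα]; exact h0β β
      by_cases hβ : β = 0
      · rw [hβ, hΩ.antisymm]; exact neg_mem (h0β α)
      · rw [hΦ α β hα hβ]; exact zero_mem _
    · have := add_mem (hcomm x hx α β 0 1) (hZP.2.1 _ (((hG x).1 hx).2 α β))
      rwa [sub_add_cancel] at this
    · have h3 := add_mem (sub_mem (hcomm x hx α β 0 k)
        (Z.smul_mem Complex.I (hcomm x hx α β 1 k))) (hZP.2.2 k hk hk' _ (((hG x).1 hx).2 α β))
      have e : Ω α β (Ω 0 k x) - Ω 0 k (Ω α β x) -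
          Complex.I • (Ω α β (Ω 1 k x) - Ω 1 k (Ω α β x)) +
          (Ω 0 k (Ω α β x) - Complex.I • Ω 1 k (Ω α β x)) =
          Ω α β (Ω 0 k x - Complex.I • Ω 1 k x) := by
        rw [map_sub, map_smul, smul_sub]; abel
      rwa [e] at h3
  have hZG := hZle G hGP
  exact hker (rotationClosure_le hZP.1 (fun α β x hx => ((hG x).1 (hZG hx)).2 α β) hx)

/-- A functional of highest weight `c` which does not vanish on a vector invariant under the
rotations fixing the first basis vector has a weight `c ∈ ℕ`. -/
theorem exists_nat_weight [NeZero D] [FiniteDimensional ℂ M] (hΩ : IsRotationAction Ω) {k : Fin D}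
    (h01 : (0 : Fin D) ≠ 1) (hk0 : k ≠ 0) (hk1 : k ≠ 1) {φ : M} (hφ : Ω 1 k φ = 0)
    (l : Module.Dual ℂ M) (c : ℂ) (h0 : l φ ≠ 0)
    (h1 : ∀ x, l (Complex.I • Ω 0 1 x) = c * l x)
    (h2 : ∀ x, l (Ω 0 k x - Complex.I • Ω 1 k x) = 0) : ∃ m : ℕ, c = m := by
  set h : Module.End ℂ M := Complex.I • Ω 0 1 with hh
  set f : Module.End ℂ M := Ω 0 k + Complex.I • Ω 1 k with hf
  have hI : Complex.I * Complex.I = -1 := Complex.I_mul_I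
  have c1 : ∀ x, Ω 0 1 (Ω 0 k x) = Ω 0 k (Ω 0 1 x) + Ω 1 k x := by
    intro x
    have := hΩ.comm 0 1 0 k x
    simp only [if_true, if_neg hk1.symm, if_neg hk0.symm, if_neg h01.symm] at this
    rw [sub_eq_iff_eq_add] at this
    rw [this]; abel
  have c2 : ∀ x, Ω 0 1 (Ω 1 k x) = Ω 1 k (Ω 0 1 x) - Ω 0 k x := by
    intro x
    have := hΩ.comm 0 1 1 k x
    simp only [if_true, if_neg hk1.symm, if_neg hk0.symm, if_neg h01] at this
    rw [sub_eq_iff_eq_add] at this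
    rw [this]; abel
  have c3 : ∀ x, Ω 1 k (Ω 0 k x) = Ω 0 k (Ω 1 k x) - Ω 0 1 x := by
    intro x
    have := hΩ.comm 1 k 0 k x
    simp only [if_true, if_neg hk1.symm, if_neg hk0, if_neg h01.symm] at this
    rw [sub_eq_iff_eq_add] at this
    rw [this, hΩ.antisymm 1 0]; abel
  -- `h` and `f` are the weight and raising operators of the `so(3)` on the axes `0, 1, k`. In terms
  -- of these, `l` has weight `c` and vanishes on the image of the lowering operator, while `Ω 1 k`
  -- annihilates `φ`.
  have hhf : ∀ x, h (f x) = f (h x) + f x := by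
    intro x
    simp only [hh, hf, LinearMap.add_apply, LinearMap.smul_apply, map_add, map_smul, c1, c2]
    have : Complex.I • Complex.I • Ω 0 k x = -Ω 0 k x := by rw [smul_smul, hI]; module
    simp only [smul_add, smul_sub, this]
    abel
  have hκf : ∀ x, Ω 1 k (f x) = f (Ω 1 k x) + Complex.I • h x := by
    intro x
    simp only [hh, hf, LinearMap.add_apply, LinearMap.smul_apply, map_add, map_smul, c3]
    have : Complex.I • Complex.I • Ω 0 1 x = -Ω 0 1 x := by rw [smul_smul, hI]; module
    rw [this]
    abel
  have hlh : ∀ x, l (h x) = c * l x := h1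
  have hlf : ∀ (j : ℕ) x, l ((f ^ j) (h x)) = (c - j) * l ((f ^ j) x) := by
    intro j
    induction j with
    | zero => intro x; simpa using hlh x
    | succ j ih =>
      intro x
      have e : f (h x) = h (f x) - f x := by rw [hhf]; abel
      rw [pow_succ, Module.End.mul_apply, Module.End.mul_apply, e, map_sub, map_sub, ih]
      push_cast; ring
  let a : ℕ → ℂ := fun j => l ((f ^ j) φ)
  -- Moving `Ω 1 k` to the right through `f^(j+1)` collects the weights `c - i, …, c - i - j`, whose
  -- sum is `(j + 1)(c - i - j/2)`.
  have hg : ∀ j i : ℕ, l ((f ^ i) (Ω 1 k ((f ^ (j + 1)) φ))) =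
      Complex.I * ((j + 1) * (c - i - j / 2)) * a (i + j) := by
    have step : ∀ i j : ℕ, l ((f ^ i) (Ω 1 k ((f ^ (j + 1)) φ))) =
        l ((f ^ (i + 1)) (Ω 1 k ((f ^ j) φ))) + Complex.I * ((c - i) * a (i + j)) := by
      intro i j
      rw [pow_succ' f j, Module.End.mul_apply, hκf, map_add, map_add, map_smul, map_smul, hlf,
        ← Module.End.mul_apply, ← pow_succ, ← Module.End.mul_apply (f ^ i) (f ^ j), ← pow_add]
      rfl
    intro j
    induction j with
    | zero =>
      intro i
      rw [step, pow_zero, Module.End.one_apply, hφ]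
      simp [mul_assoc]
    | succ j ih =>
      intro i
      rw [step, ih, add_right_comm i 1 j, add_assoc]
      push_cast; ring
  -- Under `l`, the operator `f` may be replaced by `2i Ω 1 k`, since they differ by the lowering
  -- operator.
  have hrec : ∀ j : ℕ, a (j + 2) = -((j + 1) * (2 * c - j)) * a j := by
    intro j
    have e : ∀ x, f x = (Ω 0 k x - Complex.I • Ω 1 k x) + (2 * Complex.I) • Ω 1 k x := by
      intro x
      simp only [hf, LinearMap.add_apply, LinearMap.smul_apply]; module
    have h3 : a (j + 2) = 2 * Complex.I * l (Ω 1 k ((f ^ (j + 1)) φ)) := by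
      simp only [a]
      rw [pow_succ' f (j + 1), Module.End.mul_apply, e, map_add, h2, zero_add, map_smul]
      rfl
    have h4 := hg j 0
    rw [pow_zero, Module.End.one_apply, zero_add] at h4
    rw [h3, h4]
    push_cast
    linear_combination (2 * ((j : ℂ) + 1) * (c - j / 2)) * a j * hI
  -- Otherwise the functionals `l ∘ f^j` would be eigenvectors of the transpose of `h` with
  -- infinitely many eigenvalues `c - j`.
  obtain ⟨J, hJ⟩ : ∃ J : ℕ, l ∘ₗ (f ^ J) = 0 := by
    by_contra hne
    push Not at hne
    have hev : ∀ j : ℕ, Module.End.HasEigenvalue (h.dualMap) (c - j) := by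
      intro j
      refine Module.End.hasEigenvalue_of_hasEigenvector (x := l ∘ₗ (f ^ j))
        ⟨Module.End.mem_eigenspace_iff.2 ?_, hne j⟩
      ext x
      exact hlf j x
    have hfin : {μ : ℂ | Module.End.HasEigenvalue (h.dualMap) μ}.Finite :=
      Module.End.finite_hasEigenvalue _
    refine Set.infinite_range_of_injective (f := fun j : ℕ => c - (j : ℂ)) ?_
      (hfin.subset ?_)
    · intro i j hij
      simpa using hij
    · rintro _ ⟨j, rfl⟩
      exact hev j
  -- If `c` is not a natural number, no factor `2c - 2t` of the recursion is zero, so every even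
  -- term is non-zero, against `l ∘ f^J = 0`.
  by_contra hc
  push Not at hc
  have hne : ∀ t : ℕ, a (2 * t) ≠ 0 := by
    intro t
    induction t with
    | zero => simpa [a] using h0
    | succ t ih =>
      rw [mul_add, mul_one, hrec]
      refine mul_ne_zero (neg_ne_zero.2 (mul_ne_zero (Nat.cast_add_one_ne_zero _) ?_)) ih
      intro h
      refine hc t ?_
      push_cast at h
      linear_combination h / 2
  refine hne J ?_
  have : a (2 * J) = (l ∘ₗ (f ^ J)) ((f ^ J) φ) := by
    simp only [a]
    rw [two_mul, pow_add]; rfl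
  rw [this, hJ, LinearMap.zero_apply]

end IsRotationAction

end RotationActions

/-! ### Matrix coefficients of an invariant vector as harmonic polynomials -/

section PolynomialRepresentation

open MvPolynomial

variable {D : ℕ} {M : Type*} [AddCommGroup M] [Module ℂ M]

/-- The action of the infinitesimal rotations on `M × ℂ[z]*`. -/
def withPolyDual (Ω : Fin D → Fin D → Module.End ℂ M) (α β : Fin D) :
    Module.End ℂ (M × Module.Dual ℂ (MvPolynomial (Fin D) ℂ)) :=
  (Ω α β).prodMap (polyRot α β).dualMap

theorem IsRotationAction.withPolyDual {Ω : Fin D → Fin D → Module.End ℂ M}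
    (hΩ : IsRotationAction Ω) : IsRotationAction (withPolyDual Ω) where
  antisymm α β x := by
    refine Prod.ext (hΩ.antisymm α β x.1) ?_
    refine LinearMap.ext fun p => ?_
    change x.2 (polyRot α β p) = -x.2 (polyRot β α p)
    rw [polyRot_antisymm, map_neg]
  comm α₁ β₁ α₂ β₂ x := by
    have hite : ∀ (P : Prop) [Decidable P] (α β : Fin D),
        (if P then _root_.withPolyDual Ω α β x else 0) =
          ((if P then Ω α β x.1 else 0), x.2 ∘ₗ (if P then polyRot α β else 0)) := by
      intro P _ α β
      split_ifs
      · rfl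
      · exact Prod.ext rfl (LinearMap.comp_zero _).symm
    rw [hite, hite, hite, hite]
    refine Prod.ext (hΩ.comm α₁ β₁ α₂ β₂ x.1) ?_
    refine LinearMap.ext fun p => ?_
    have h := congrArg x.2 (polyRot_commutator α₁ β₁ α₂ β₂ p)
    rw [map_sub, map_sub, map_sub, map_add] at h
    have hite2 : ∀ (P : Prop) [Decidable P] (α β : Fin D),
        (if P then polyRot α β else 0) p = if P then polyRot α β p else 0 := by
      intro P _ α β; split_ifs <;> rfl
    simp only [Prod.snd_sub, Prod.snd_add, LinearMap.sub_apply, LinearMap.add_apply,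
      LinearMap.comp_apply, hite2]
    exact h

/-- Evaluation at the first basis vector. -/
def evalPole (D : ℕ) [NeZero D] : Module.Dual ℂ (MvPolynomial (Fin D) ℂ) :=
  (aeval (Pi.single (0 : Fin D) (1 : ℂ))).toLinearMap

theorem evalPole_apply [NeZero D] (p : MvPolynomial (Fin D) ℂ) :
    evalPole D p = eval (Pi.single 0 1) p := by
  simp [evalPole]

/-- The pair `(l, q)` of a functional and a polynomial is such that iterated derivatives of
`g ↦ l (g φ)` and of `g ↦ q (g e₁)` along infinitesimal rotations agree at the identity. -/
def IsRepresentedBy [NeZero D] (Ω : Fin D → Fin D → Module.End ℂ M) (φ : M) (l : Module.Dual ℂ M)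
    (q : MvPolynomial (Fin D) ℂ) : Prop :=
  ∀ z ∈ rotationClosure (withPolyDual Ω) (φ, evalPole D), l z.1 = z.2 q

/-- The functionals represented by harmonic polynomials with degrees in `K`. -/
def representedFunctionals [NeZero D] (Ω : Fin D → Fin D → Module.End ℂ M) (φ : M) (K : Set ℕ) :
    Submodule ℂ (Module.Dual ℂ M) where
  carrier := {l | ∃ q ∈ harmonicsOfDegrees D K, IsRepresentedBy Ω φ l q}
  add_mem' := by
    rintro l l' ⟨q, hq, h⟩ ⟨q', hq', h'⟩
    exact ⟨q + q', add_mem hq hq', fun z hz => by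
      rw [LinearMap.add_apply, h z hz, h' z hz, map_add]⟩
  zero_mem' := ⟨0, zero_mem _, fun z _ => by simp⟩
  smul_mem' := by
    rintro c l ⟨q, hq, h⟩
    exact ⟨c • q, Submodule.smul_mem _ c hq, fun z hz => by
      rw [LinearMap.smul_apply, h z hz, map_smul]⟩

/-- The closure is invariant, and on its second component a rotation acts by the transpose of
`polyRot`, which can be moved onto the polynomial. -/
theorem comp_mem_representedFunctionals [NeZero D] {Ω : Fin D → Fin D → Module.End ℂ M} {φ : M}
    {K : Set ℕ} {l : Module.Dual ℂ M} (hl : l ∈ representedFunctionals Ω φ K) (α β : Fin D) :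
    l ∘ₗ Ω α β ∈ representedFunctionals Ω φ K := by
  obtain ⟨q, hq, h⟩ := hl
  exact ⟨polyRot α β q, polyRot_mem_harmonicsOfDegrees α β hq,
    fun z hz => h _ (map_mem_rotationClosure hz α β)⟩

/-- `i (Ω₁₂ + Ω₃₄ + ⋯)`. -/
def cartanOf (Ω : Fin D → Fin D → Module.End ℂ M) : Module.End ℂ M :=
  Complex.I • ∑ j : Fin (D / 2), Ω ⟨2 * j.val, by omega⟩ ⟨2 * j.val + 1, by omega⟩

theorem cartanOf_apply (Ω : Fin D → Fin D → Module.End ℂ M) (x : M) :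
    cartanOf Ω x =
      Complex.I • ∑ j : Fin (D / 2), Ω ⟨2 * j.val, by omega⟩ ⟨2 * j.val + 1, by omega⟩ x := by
  simp [cartanOf]

theorem cartanOf_comm [NeZero D] {Ω : Fin D → Fin D → Module.End ℂ M}
    (hΩ : IsRotationAction Ω) (hD : 2 ≤ D) (x : M) :
    Ω 0 1 (cartanOf Ω x) = cartanOf Ω (Ω 0 1 x) := by
  rw [cartanOf_apply, cartanOf_apply, map_smul, map_sum]
  congr 1
  refine Finset.sum_congr rfl fun j _ => ?_
  have e0 : (0 : Fin D).val = 0 := rfl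
  have e1 : (1 : Fin D).val = 1 := by
    obtain ⟨k, rfl⟩ := Nat.exists_eq_add_of_le' hD; rfl
  by_cases hj : j.val = 0
  · have h0 : (⟨2 * j.val, by omega⟩ : Fin D) = 0 := 
      Fin.ext (show 2 * j.val = (0 : Fin D).val by omega)
    have h1 : (⟨2 * j.val + 1, by omega⟩ : Fin D) = 1 := 
      Fin.ext (show 2 * j.val + 1 = (1 : Fin D).val by omega)
    rw [h0, h1]
  · rw [← sub_eq_zero, hΩ.comm, if_neg, if_neg, if_neg, if_neg]
    · simp
    all_goals
      intro h
      have := congrArg Fin.val h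
      simp only [e0, e1] at this
      omega

/-- All summands except the first rotate planes orthogonal to the first axis. This is what later
equates the two weights of a highest weight vector pairing non-trivially with `φ`. -/
theorem cartanOf_of_invariant [NeZero D] {Ω : Fin D → Fin D → Module.End ℂ M} (hD : 2 ≤ D) {φ : M}
    (hφ : ∀ α β, α ≠ 0 → β ≠ 0 → Ω α β φ = 0) : cartanOf Ω φ = Complex.I • Ω 0 1 φ := by
  rw [cartanOf_apply]
  congr 1
  have e0 : (0 : Fin D).val = 0 := rfl
  have e1 : (1 : Fin D).val = 1 := by
    obtain ⟨k, rfl⟩ := Nat.exists_eq_add_of_le' hD; rfl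
  rw [Finset.sum_eq_single (⟨0, by omega⟩ : Fin (D / 2))]
  · congr 2
    exact Fin.ext e1.symm
  · intro j _ hj
    refine hφ _ _ (fun h => hj (Fin.ext ?_)) (fun h => ?_)
    · have := congrArg Fin.val h
      simp only [e0] at this ⊢
      omega
    · have := congrArg Fin.val h
      simp only [e0] at this
      omega
  · simp

/-- Commuting operators `h` and `S` have a common eigenvector with a maximal eigenvalue of `h`. -/
theorem exists_top_eigenvector [FiniteDimensional ℂ M] [Nontrivial M] {h S : Module.End ℂ M}
    (hS : Commute h S) : ∃ (x : M) (c s : ℂ), x ≠ 0 ∧ h x = c • x ∧ S x = s • x ∧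
      ∀ y, h y = (c + 1) • y → y = 0 := by
  obtain ⟨c, hc, hmax⟩ := Set.exists_max_image {μ | Module.End.HasEigenvalue h μ} Complex.re
    (Module.End.finite_hasEigenvalue h) (Module.End.exists_eigenvalue h)
  let E := Module.End.eigenspace h c
  have hE : ∀ x ∈ E, S x ∈ E := fun x hx =>
    Module.End.mapsTo_genEigenspace_of_comm hS c 1 hx
  have : Nontrivial E := Submodule.nontrivial_iff_ne_bot.2 hc
  obtain ⟨s, hs⟩ := Module.End.exists_eigenvalue (S.restrict hE)
  obtain ⟨x, hx⟩ := hs.exists_hasEigenvector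
  refine ⟨x, c, s, fun h0 => hx.2 (Subtype.ext h0), Module.End.mem_eigenspace_iff.1 x.2,
    congrArg Subtype.val hx.apply_eq_smul, fun y hy => ?_⟩
  by_contra hy0
  have := hmax (c + 1)
    (Module.End.hasEigenvalue_of_hasEigenvector ⟨Module.End.mem_eigenspace_iff.2 hy, hy0⟩)
  simp at this
  linarith

/-- A proper invariant space of functionals has a non-zero invariant annihilator `P`. Take `x` in
`P` of maximal weight. The functional `J x` is then of highest weight, so it is represented by `0`
or by a multiple of an isotropic power; being represented, it vanishes at `x`, and definiteness of
`J` forces `x = 0`. -/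
theorem representedFunctionals_eq_top [NeZero D] [FiniteDimensional ℂ M]
    {Ω : Fin D → Fin D → Module.End ℂ M} (hΩ : IsRotationAction Ω) (hD : 2 ≤ D)
    (J : M →ₛₗ[starRingEnd ℂ] Module.Dual ℂ M) (hJ : ∀ x, J x x = 0 → x = 0)
    (hJΩ : ∀ α β x y, J (Ω α β x) y = -J x (Ω α β y))
    {φ : M} (hφ : ∀ α β, α ≠ 0 → β ≠ 0 → Ω α β φ = 0) {K : Set ℕ}
    (hK : ∀ (x : M) (c : ℂ), x ≠ 0 → Complex.I • Ω 0 1 x = c • x → cartanOf Ω x = c • x →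
      ∃ z : ℤ, c = z ∧ (0 ≤ z ∨ D = 2 → z.natAbs ∈ K)) :
    representedFunctionals Ω φ K = ⊤ := by
  set R := representedFunctionals Ω φ K with hR
  suffices hP : R.dualCoannihilator = ⊥ by
    have := Subspace.dualCoannihilator_dualAnnihilator_eq (W := R)
    rw [← this, hP, Submodule.dualAnnihilator_bot]
  by_contra hP
  set P := R.dualCoannihilator with hPdef
  have hmemP : ∀ x, x ∈ P ↔ ∀ l ∈ R, l x = 0 := fun x => Submodule.mem_dualCoannihilator x
  have hPΩ : ∀ α β, ∀ x ∈ P, Ω α β x ∈ P := fun α β x hx =>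
    (hmemP _).2 fun l hl => (hmemP x).1 hx _ (comp_mem_representedFunctionals hl α β)
  have h01 : (0 : Fin D) ≠ 1 := by
    obtain ⟨k, rfl⟩ := Nat.exists_eq_add_of_le' hD
    exact Fin.zero_ne_one
  have : Nontrivial P := Submodule.nontrivial_iff_ne_bot.2 hP
  have hhP : ∀ x ∈ P, (Complex.I • Ω 0 1) x ∈ P := fun x hx => P.smul_mem _ (hPΩ 0 1 x hx)
  have hSP : ∀ x ∈ P, cartanOf Ω x ∈ P := fun x hx => by
    rw [cartanOf_apply]
    exact P.smul_mem _ (sum_mem fun j _ => hPΩ _ _ x hx)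
  have hcomm : Commute ((Complex.I • Ω 0 1).restrict hhP) ((cartanOf Ω).restrict hSP) := by
    ext x
    simp only [Module.End.mul_apply, LinearMap.coe_restrict_apply, LinearMap.smul_apply]
    rw [cartanOf_comm hΩ hD, map_smul]
  obtain ⟨⟨x, hxP⟩, c, s, hx0, hhx, hSx, htop⟩ := exists_top_eigenvector hcomm
  have hx0 : x ≠ 0 := fun h => hx0 (Subtype.ext h)
  have hhx : Complex.I • Ω 0 1 x = c • x := congrArg Subtype.val hhx
  have hSx : cartanOf Ω x = s • x := congrArg Subtype.val hSx
  have htop : ∀ y ∈ P, Complex.I • Ω 0 1 y = (c + 1) • y → y = 0 := fun y hy h =>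
    congrArg Subtype.val (htop ⟨y, hy⟩ (Subtype.ext h))
  have hΩx : Ω 0 1 x = (-Complex.I * c) • x := by
    rw [mul_smul, ← hhx, smul_smul]; simp
  -- The left side has weight `c + 1` and lies in `P`, so maximality kills it.
  have hN : ∀ k, k ≠ 0 → k ≠ 1 → Ω 0 k x + Complex.I • Ω 1 k x = 0 := by
    intro k hk0 hk1
    refine htop _ (add_mem (hPΩ _ _ _ hxP) (P.smul_mem _ (hPΩ _ _ _ hxP))) ?_
    have c1 := hΩ.comm 0 1 0 k x
    have c2 := hΩ.comm 0 1 1 k x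
    simp only [if_true, if_neg hk1.symm, if_neg hk0.symm, if_neg h01.symm, if_neg h01] at c1 c2
    rw [sub_eq_iff_eq_add, hΩx, map_smul] at c1 c2
    rw [map_add, map_smul, c1, c2]
    have e : Complex.I * Complex.I = -1 := Complex.I_mul_I
    match_scalars
    · linear_combination (-Complex.I * c) * e
    · linear_combination (-c - 1) * e
  have hJh : ∀ y, J x (Complex.I • Ω 0 1 y) = (starRingEnd ℂ) c * J x y := by
    intro y
    have h1 := hJΩ 0 1 x y
    rw [hΩx, map_smulₛₗ, LinearMap.smul_apply] at h1
    rw [map_smul, smul_eq_mul, ← neg_neg (J x (Ω 0 1 y)), ← h1]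
    simp only [map_mul, map_neg, Complex.conj_I, smul_eq_mul, neg_neg]
    linear_combination (-(starRingEnd ℂ) c * J x y) * Complex.I_mul_I
  have hJΩ01 : ∀ y, J x (Ω 0 1 y) = (-Complex.I * (starRingEnd ℂ) c) * J x y := by
    intro y
    have := hJh y
    rw [map_smul, smul_eq_mul] at this
    linear_combination (-Complex.I) * this + J x (Ω 0 1 y) * Complex.I_mul_I
  have hJN : ∀ k, k ≠ 0 → k ≠ 1 → ∀ y, J x (Ω 0 k y - Complex.I • Ω 1 k y) = 0 := by
    intro k hk0 hk1 y
    have h1 := congrArg (fun w => J w y) (hN k hk0 hk1)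
    simp only [map_add, map_smulₛₗ, LinearMap.add_apply, LinearMap.smul_apply, map_zero,
      LinearMap.zero_apply, hJΩ, Complex.conj_I, smul_eq_mul] at h1
    rw [map_sub, map_smul, smul_eq_mul]
    linear_combination -h1
  refine hx0 (hJ x ((hmemP x).1 hxP _ ?_))
  have hrot := hΩ.withPolyDual
  have hinv : ∀ α β, α ≠ 0 → β ≠ 0 → withPolyDual Ω α β (φ, evalPole D) = 0 := by
    intro α β hα hβ
    refine Prod.ext (hφ α β hα hβ) ?_
    refine LinearMap.ext fun p => ?_
    change evalPole D (polyRot α β p) = 0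
    rw [evalPole_apply, polyRot_apply]
    simp [hα, hβ]
  -- A highest weight functional is determined on the closure by its value at `φ`; if that is zero,
  -- the polynomial `0` represents it.
  by_cases h0 : J x φ = 0
  · refine ⟨0, zero_mem _, fun z hz => ?_⟩
    rw [map_zero]
    exact hrot.eq_zero_of_highestWeight hinv (J x ∘ₗ LinearMap.fst ℂ M _)
      (-Complex.I * (starRingEnd ℂ) c) h0 (fun y => hJΩ01 y.1)
      (fun k hk0 hk1 y => hJN k hk0 hk1 y.1) hz
  · have hsc : s = c := by
      have h1 : J (cartanOf Ω x) φ = J x (cartanOf Ω φ) := by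
        rw [cartanOf_apply, cartanOf_apply, map_smulₛₗ, map_smul, map_sum, map_sum]
        simp [hJΩ]
      rw [hSx, cartanOf_of_invariant hD hφ, hJh, map_smulₛₗ, LinearMap.smul_apply,
        smul_eq_mul] at h1
      exact (starRingEnd ℂ).injective (mul_right_cancel₀ h0 h1)
    obtain ⟨z, hz, hzK⟩ := hK x c hx0 hhx (hsc ▸ hSx)
    have hconj : (starRingEnd ℂ) c = z := by rw [hz]; simp
    -- A third axis gives an `so(3)` and hence a weight in `ℕ`. For `D = 2` there is none, and both
    -- signs occur.
    have hpos : 0 ≤ z ∨ D = 2 := by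
      by_cases hD2 : D = 2
      · exact Or.inr hD2
      refine Or.inl ?_
      let k : Fin D := ⟨2, by omega⟩
      have e1 : (1 : Fin D).val = 1 := by
        obtain ⟨k, rfl⟩ := Nat.exists_eq_add_of_le' hD; rfl
      have hk0 : k ≠ 0 := fun h => by have := congrArg Fin.val h; simp [k] at this
      have hk1 : k ≠ 1 := fun h => by have := congrArg Fin.val h; rw [e1] at this; simp [k] at this
      obtain ⟨m, hm⟩ := hΩ.exists_nat_weight h01 hk0 hk1 (hφ 1 k h01.symm hk0) (J x)
        ((starRingEnd ℂ) c) h0 hJh (hJN k hk0 hk1)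
      rw [hconj] at hm
      have : z = m := by exact_mod_cast hm
      omega
    -- The sign in `z¹ ± i z²` is chosen so that the power of degree `|z|` has the weight of `J x`.
    -- The plus sign is needed only for `D = 2`, where there are no conditions for a third axis.
    obtain ⟨e, he, hesign⟩ : ∃ e : ℂ, e * e = -1 ∧ ((e = -Complex.I ∨ D = 2) ∧
        (z.natAbs : ℂ) * e = -Complex.I * z) := by
      rcases le_or_gt 0 z with hz0 | hz0
      · refine ⟨-Complex.I, by simp, Or.inl rfl, ?_⟩
        have : ((z.natAbs : ℕ) : ℂ) = z := by
          rw [← Int.cast_natCast, Int.natAbs_of_nonneg hz0]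
        rw [this]; ring
      · refine ⟨Complex.I, by simp, Or.inr (hpos.resolve_left (by omega)), ?_⟩
        have : ((z.natAbs : ℕ) : ℂ) = -z := by
          rw [← Int.cast_natCast, Int.ofNat_natAbs_of_nonpos hz0.le, Int.cast_neg]
        rw [this]; ring
    set q := isotropicForm D e ^ z.natAbs with hq
    refine ⟨J x φ • q, Submodule.smul_mem _ _ (mem_harmonicsOfDegrees (hzK hpos)
      (isotropicForm_pow_mem hD he _)), fun w hw => ?_⟩
    have key := hrot.eq_zero_of_highestWeight hinv
      (J x ∘ₗ LinearMap.fst ℂ M _ -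
        (Module.Dual.eval ℂ _ (J x φ • q)) ∘ₗ LinearMap.snd ℂ M _)
      (-Complex.I * (starRingEnd ℂ) c) ?_ ?_ ?_ hw
    · exact sub_eq_zero.1 key
    · change J x φ - evalPole D (J x φ • q) = 0
      rw [map_smul, evalPole_apply, hq, eval_isotropicForm_pow hD]
      simp
    · intro y
      change J x (Ω 0 1 y.1) - y.2 (polyRot 0 1 (J x φ • q)) = _ * (J x y.1 - y.2 (J x φ • q))
      rw [hJΩ01, map_smul, hq, polyRot_zero_one_isotropicForm_pow hD he, hesign.2, hconj]
      simp only [map_smul, smul_eq_mul]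
      ring
    · intro k hk0 hk1 y
      change J x (Ω 0 k y.1 - Complex.I • Ω 1 k y.1) -
        (y.2 (polyRot 0 k (J x φ • q)) - Complex.I • y.2 (polyRot 1 k (J x φ • q))) = 0
      rw [hJN k hk0 hk1, zero_sub, neg_eq_zero, ← map_smul, ← map_sub]
      rcases hesign.1 with h | h
      · have := polyRot_isotropicForm_pow_eq_zero he hk0 hk1 z.natAbs
        rw [← hq, h] at this
        rw [map_smul, map_smul, smul_comm, ← smul_sub, map_smul]
        rw [neg_smul, ← sub_eq_add_neg] at this
        rw [this, map_zero, smul_zero]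
      · exfalso
        have e1 : (1 : Fin D).val = 1 := by
          obtain ⟨k, rfl⟩ := Nat.exists_eq_add_of_le' hD; rfl
        have h2 := k.2
        have hk0' : k.val ≠ 0 := fun h => hk0 (Fin.ext h)
        have hk1' : k.val ≠ 1 := fun h => hk1 (Fin.ext (by rw [h, e1]))
        omega

end PolynomialRepresentation

section EquivariantBilinearMaps

open MvPolynomial

/-! ### Rotations of bilinear maps -/

section BilinearMaps

variable {W' W'' W : Type*} [AddCommGroup W'] [Module ℂ W'] [AddCommGroup W''] [Module ℂ W'']
  [AddCommGroup W] [Module ℂ W]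

/-- The derivation `T ↦ X ∘ T - T ∘ (X' ⊗ 1) - T ∘ (1 ⊗ X'')` of bilinear maps. -/
def bilinDerivation (X' : Module.End ℂ W') (X'' : Module.End ℂ W'') (X : Module.End ℂ W) :
    Module.End ℂ (W' →ₗ[ℂ] W'' →ₗ[ℂ] W) where
  toFun T := T.compr₂ X - T.comp X' - T.compl₂ X''
  map_add' S T := by ext; simp; abel
  map_smul' c T := by ext; simp [smul_sub]

@[simp]
theorem bilinDerivation_apply (X' : Module.End ℂ W') (X'' : Module.End ℂ W'') (X : Module.End ℂ W)
    (T : W' →ₗ[ℂ] W'' →ₗ[ℂ] W) (a : W') (b : W'') :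
    bilinDerivation X' X'' X T a b = X (T a b) - T (X' a) b - T a (X'' b) := rfl

/-- The action of the rotations on bilinear maps. -/
def bilinRotation {D : ℕ} (Ω' : Fin D → Fin D → Module.End ℂ W')
    (Ω'' : Fin D → Fin D → Module.End ℂ W'') (Ω : Fin D → Fin D → Module.End ℂ W) (α β : Fin D) :
    Module.End ℂ (W' →ₗ[ℂ] W'' →ₗ[ℂ] W) :=
  bilinDerivation (Ω' α β) (Ω'' α β) (Ω α β)

theorem IsRotationAction.bilinRotation {D : ℕ} {Ω' : Fin D → Fin D → Module.End ℂ W'}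
    {Ω'' : Fin D → Fin D → Module.End ℂ W''} {Ω : Fin D → Fin D → Module.End ℂ W}
    (h' : IsRotationAction Ω') (h'' : IsRotationAction Ω'') (h : IsRotationAction Ω) :
    IsRotationAction (bilinRotation Ω' Ω'' Ω) where
  antisymm α β T := by
    ext a b
    simp only [_root_.bilinRotation, bilinDerivation_apply, LinearMap.neg_apply]
    rw [h.antisymm, h'.antisymm, h''.antisymm]
    simp only [map_neg, LinearMap.neg_apply]
    abel
  comm α₁ β₁ α₂ β₂ T := by
    ext a b
    have hite : ∀ (P : Prop) [Decidable P] (α β : Fin D),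
        (if P then _root_.bilinRotation Ω' Ω'' Ω α β T else 0) a b =
          (if P then Ω α β (T a b) else 0) - T (if P then Ω' α β a else 0) b -
            T a (if P then Ω'' α β b else 0) := by
      intro P _ α β
      split_ifs <;> simp [_root_.bilinRotation]
    have e := h.comm α₁ β₁ α₂ β₂ (T a b)
    have e' := congrArg (fun x => T x b) (h'.comm α₁ β₁ α₂ β₂ a)
    have e'' := congrArg (T a) (h''.comm α₁ β₁ α₂ β₂ b)
    simp only [map_add, map_sub, LinearMap.add_apply, LinearMap.sub_apply] at e' e''
    have hl : (_root_.bilinRotation Ω' Ω'' Ω α₁ β₁ (_root_.bilinRotation Ω' Ω'' Ω α₂ β₂ T) -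
        _root_.bilinRotation Ω' Ω'' Ω α₂ β₂ (_root_.bilinRotation Ω' Ω'' Ω α₁ β₁ T)) a b =
        (Ω α₁ β₁ (Ω α₂ β₂ (T a b)) - Ω α₂ β₂ (Ω α₁ β₁ (T a b))) -
        (T (Ω' α₁ β₁ (Ω' α₂ β₂ a)) b - T (Ω' α₂ β₂ (Ω' α₁ β₁ a)) b) -
        (T a (Ω'' α₁ β₁ (Ω'' α₂ β₂ b)) - T a (Ω'' α₂ β₂ (Ω'' α₁ β₁ b))) := by
      simp only [_root_.bilinRotation, bilinDerivation_apply, LinearMap.sub_apply, map_sub]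
      abel
    rw [hl, e, e', e'']
    simp only [LinearMap.add_apply, LinearMap.sub_apply, hite]
    abel

theorem cartanOf_bilinRotation {D : ℕ} (Ω' : Fin D → Fin D → Module.End ℂ W')
    (Ω'' : Fin D → Fin D → Module.End ℂ W'') (Ω : Fin D → Fin D → Module.End ℂ W) :
    cartanOf (bilinRotation Ω' Ω'' Ω) =
      bilinDerivation (cartanOf Ω') (cartanOf Ω'') (cartanOf Ω) := by
  ext T a b
  rw [bilinDerivation_apply]
  simp only [cartanOf_apply, LinearMap.smul_apply, LinearMap.sum_apply, bilinRotation,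
    bilinDerivation_apply, Finset.sum_sub_distrib, smul_sub, map_smul, map_sum]

theorem smul_bilinDerivation (c : ℂ) (X' : Module.End ℂ W') (X'' : Module.End ℂ W'')
    (X : Module.End ℂ W) : c • bilinDerivation X' X'' X =
      bilinDerivation (c • X') (c • X'') (c • X) := by
  ext T a b
  simp [smul_sub]

end BilinearMaps

/-! ### Hermitian structure and weights of spaces of bilinear maps -/

section InnerProducts

variable {W' W'' W : Type*} [NormedAddCommGroup W'] [InnerProductSpace ℂ W']
  [FiniteDimensional ℂ W'] [NormedAddCommGroup W''] [InnerProductSpace ℂ W'']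
  [FiniteDimensional ℂ W''] [NormedAddCommGroup W] [InnerProductSpace ℂ W]

/-- The Hilbert-Schmidt form on bilinear maps. -/
def bilinInner : (W' →ₗ[ℂ] W'' →ₗ[ℂ] W) →ₛₗ[starRingEnd ℂ] Module.Dual ℂ (W' →ₗ[ℂ] W'' →ₗ[ℂ] W) :=
  LinearMap.mk₂'ₛₗ (starRingEnd ℂ) (RingHom.id ℂ)
    (fun S T => ∑ i, ∑ j, inner ℂ (S (stdOrthonormalBasis ℂ W' i) (stdOrthonormalBasis ℂ W'' j))
      (T (stdOrthonormalBasis ℂ W' i) (stdOrthonormalBasis ℂ W'' j)))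
    (fun S S' T => by simp [Finset.sum_add_distrib])
    (fun c S T => by simp [Finset.mul_sum, mul_comm])
    (fun S T T' => by simp [Finset.sum_add_distrib])
    (fun c S T => by simp [Finset.mul_sum])

theorem bilinInner_apply (S T : W' →ₗ[ℂ] W'' →ₗ[ℂ] W) :
    bilinInner S T =
      ∑ i, ∑ j, inner ℂ (S (stdOrthonormalBasis ℂ W' i) (stdOrthonormalBasis ℂ W'' j))
        (T (stdOrthonormalBasis ℂ W' i) (stdOrthonormalBasis ℂ W'' j)) := rfl

theorem eq_zero_of_bilinInner_self {S : W' →ₗ[ℂ] W'' →ₗ[ℂ] W} (h : bilinInner S S = 0) :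
    S = 0 := by
  rw [bilinInner_apply] at h
  simp only [inner_self_eq_norm_sq_to_K] at h
  have h2 : ∑ i, ∑ j, ‖S (stdOrthonormalBasis ℂ W' i) (stdOrthonormalBasis ℂ W'' j)‖ ^ 2 = 0 := by
    exact (RCLike.ofReal_eq_zero (K := ℂ)).1 (by exact_mod_cast h)
  refine (stdOrthonormalBasis ℂ W').toBasis.ext fun i => (stdOrthonormalBasis ℂ W'').toBasis.ext
    fun j => ?_
  rw [Finset.sum_eq_zero_iff_of_nonneg fun _ _ => Finset.sum_nonneg fun _ _ => sq_nonneg _] at h2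
  have h3 := h2 i (Finset.mem_univ _)
  rw [Finset.sum_eq_zero_iff_of_nonneg fun _ _ => sq_nonneg _] at h3
  simpa using h3 j (Finset.mem_univ _)

/-- Cyclicity of the trace in disguise: expand `X` in the orthonormal basis and exchange the two
summations. It moves an anti-Hermitian operator acting on the arguments across the Hilbert-Schmidt
form. -/
theorem sum_inner_comp_antihermitian {X : Module.End ℂ W'}
    (hX : ∀ x y, inner ℂ (X x) y = -inner ℂ x (X y)) (A B : W' →ₗ[ℂ] W) :
    ∑ i, inner ℂ (A (X (stdOrthonormalBasis ℂ W' i))) (B (stdOrthonormalBasis ℂ W' i)) =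
      -∑ i, inner ℂ (A (stdOrthonormalBasis ℂ W' i)) (B (X (stdOrthonormalBasis ℂ W' i))) := by
  have h1 : ∀ i, X (stdOrthonormalBasis ℂ W' i) =
      ∑ k, inner ℂ (stdOrthonormalBasis ℂ W' k) (X (stdOrthonormalBasis ℂ W' i)) •
        stdOrthonormalBasis ℂ W' k := fun i => ((stdOrthonormalBasis ℂ W').sum_repr' _).symm
  have hl : ∀ i, inner ℂ (A (X (stdOrthonormalBasis ℂ W' i))) (B (stdOrthonormalBasis ℂ W' i)) =
      ∑ k, inner ℂ (X (stdOrthonormalBasis ℂ W' i)) (stdOrthonormalBasis ℂ W' k) *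
        inner ℂ (A (stdOrthonormalBasis ℂ W' k)) (B (stdOrthonormalBasis ℂ W' i)) := by
    intro i
    conv_lhs => rw [h1 i]
    simp only [map_sum, map_smul, sum_inner, inner_smul_left, inner_conj_symm]
  have hr : ∀ i, inner ℂ (A (stdOrthonormalBasis ℂ W' i)) (B (X (stdOrthonormalBasis ℂ W' i))) =
      ∑ k, inner ℂ (stdOrthonormalBasis ℂ W' k) (X (stdOrthonormalBasis ℂ W' i)) *
        inner ℂ (A (stdOrthonormalBasis ℂ W' i)) (B (stdOrthonormalBasis ℂ W' k)) := by
    intro i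
    conv_lhs => rw [h1 i]
    simp only [map_sum, map_smul, inner_sum, inner_smul_right]
  simp only [hl, hr]
  rw [Finset.sum_comm, ← Finset.sum_neg_distrib]
  refine Finset.sum_congr rfl fun i _ => ?_
  rw [← Finset.sum_neg_distrib]
  refine Finset.sum_congr rfl fun k _ => ?_
  rw [hX, neg_mul]

theorem bilinInner_bilinDerivation {X' : Module.End ℂ W'} {X'' : Module.End ℂ W''}
    {X : Module.End ℂ W} (hX' : ∀ x y, inner ℂ (X' x) y = -inner ℂ x (X' y))
    (hX'' : ∀ x y, inner ℂ (X'' x) y = -inner ℂ x (X'' y))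
    (hX : ∀ x y, inner ℂ (X x) y = -inner ℂ x (X y)) (S T : W' →ₗ[ℂ] W'' →ₗ[ℂ] W) :
    bilinInner (bilinDerivation X' X'' X S) T = -bilinInner S (bilinDerivation X' X'' X T) := by
  simp only [bilinInner_apply, bilinDerivation_apply, inner_sub_left, inner_sub_right,
    Finset.sum_sub_distrib, hX]
  have h1 : ∑ i, ∑ j, inner ℂ (S (X' (stdOrthonormalBasis ℂ W' i)) (stdOrthonormalBasis ℂ W'' j))
        (T (stdOrthonormalBasis ℂ W' i) (stdOrthonormalBasis ℂ W'' j)) =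
      -∑ i, ∑ j, inner ℂ (S (stdOrthonormalBasis ℂ W' i) (stdOrthonormalBasis ℂ W'' j))
        (T (X' (stdOrthonormalBasis ℂ W' i)) (stdOrthonormalBasis ℂ W'' j)) := by
    rw [Finset.sum_comm]
    conv_rhs => rw [Finset.sum_comm]
    rw [← Finset.sum_neg_distrib]
    exact Finset.sum_congr rfl fun j _ => sum_inner_comp_antihermitian hX'
      (S.flip (stdOrthonormalBasis ℂ W'' j)) (T.flip (stdOrthonormalBasis ℂ W'' j))
  have h2 : ∑ i, ∑ j, inner ℂ (S (stdOrthonormalBasis ℂ W' i) (X'' (stdOrthonormalBasis ℂ W'' j)))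
        (T (stdOrthonormalBasis ℂ W' i) (stdOrthonormalBasis ℂ W'' j)) =
      -∑ i, ∑ j, inner ℂ (S (stdOrthonormalBasis ℂ W' i) (stdOrthonormalBasis ℂ W'' j))
        (T (stdOrthonormalBasis ℂ W' i) (X'' (stdOrthonormalBasis ℂ W'' j))) := by
    rw [← Finset.sum_neg_distrib]
    exact Finset.sum_congr rfl fun i _ => sum_inner_comp_antihermitian hX'' _ _
  rw [h1, h2]
  simp only [Finset.sum_neg_distrib]
  ring

/-- A weight of a bilinear map is a difference of weights of a value and of its arguments. -/
theorem exists_eigenvectors_of_bilinDerivation_eq_smul {X' : Module.End ℂ W'}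
    {X'' : Module.End ℂ W''} {X : Module.End ℂ W} (hX' : X'.IsSymmetric) (hX'' : X''.IsSymmetric)
    {T : W' →ₗ[ℂ] W'' →ₗ[ℂ] W} (hT : T ≠ 0) {c : ℂ} (hc : bilinDerivation X' X'' X T = c • T) :
    ∃ (j' j'' : ℝ) (a : W') (b : W''), T a b ≠ 0 ∧ X' a = (j' : ℂ) • a ∧ X'' b = (j'' : ℂ) • b ∧
      X (T a b) = (c + j' + j'') • T a b := by
  -- A non-zero bilinear map is non-zero on some pair from orthonormal eigenbases of `X'` and `X''`.
  obtain ⟨i, j, hij⟩ : ∃ i j, T (hX'.eigenvectorBasis rfl i) (hX''.eigenvectorBasis rfl j) ≠ 0 := by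
    by_contra hne
    push Not at hne
    refine hT ((hX'.eigenvectorBasis rfl).toBasis.ext fun i =>
      (hX''.eigenvectorBasis rfl).toBasis.ext fun j => ?_)
    simpa using hne i j
  have h' : X' _ = ((hX'.eigenvalues rfl i : ℝ) : ℂ) • _ := hX'.apply_eigenvectorBasis rfl i
  have h'' : X'' _ = ((hX''.eigenvalues rfl j : ℝ) : ℂ) • _ := hX''.apply_eigenvectorBasis rfl j
  refine ⟨_, _, _, _, hij, h', h'', ?_⟩
  have h := LinearMap.congr_fun₂ hc (hX'.eigenvectorBasis rfl i) (hX''.eigenvectorBasis rfl j)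
  rw [bilinDerivation_apply, h', h'', map_smul, map_smul, LinearMap.smul_apply,
    LinearMap.smul_apply, LinearMap.smul_apply, sub_eq_iff_eq_add, sub_eq_iff_eq_add] at h
  rw [h, add_smul, add_smul]
  abel

end InnerProducts

/-! ### Exponentials -/

/-- Two sequences of entire functions, each being the derivative of the preceding one, which agree
at the origin are equal. -/
theorem eq_of_hasDerivAt_succ {g p : ℕ → ℂ → ℂ} (hg : ∀ k t, HasDerivAt (g k) (g (k + 1) t) t)
    (hp : ∀ k t, HasDerivAt (p k) (p (k + 1) t) t) (h0 : ∀ k, g k 0 = p k 0) (t : ℂ) :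
    g 0 t = p 0 t := by
  have hiter : ∀ f : ℕ → ℂ → ℂ, (∀ k t, HasDerivAt (f k) (f (k + 1) t) t) →
      ∀ k, iteratedDeriv k (f 0) = f k := by
    intro f hf k
    induction k with
    | zero => simp
    | succ k ih =>
      rw [iteratedDeriv_succ, ih]
      exact funext fun t => (hf k t).deriv
  have hgd : Differentiable ℂ (g 0) := fun t => (hg 0 t).differentiableAt
  have hpd : Differentiable ℂ (p 0) := fun t => (hp 0 t).differentiableAt
  rw [← Complex.taylorSeries_eq_of_entire' 0 t hgd, ← Complex.taylorSeries_eq_of_entire' 0 t hpd]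
  simp only [hiter g hg, hiter p hp, h0]

section Exponential

variable {W' W'' W : Type*} [NormedAddCommGroup W'] [NormedSpace ℂ W']
  [FiniteDimensional ℂ W'] [NormedAddCommGroup W''] [NormedSpace ℂ W'']
  [FiniteDimensional ℂ W''] [NormedAddCommGroup W] [NormedSpace ℂ W] [FiniteDimensional ℂ W]

/-- The exponential of an operator on a finite-dimensional space. -/
def finExp (X : Module.End ℂ W) : W →L[ℂ] W := NormedSpace.exp (LinearMap.toContinuousLinearMap X)

theorem hasDerivAt_finExp_smul_apply (X : Module.End ℂ W) (w : W) (t : ℂ) :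
    HasDerivAt (fun s : ℂ => finExp (s • X) w) (X (finExp (t • X) w)) t := by
  have : CompleteSpace W := FiniteDimensional.complete ℂ W
  have h := hasDerivAt_exp_smul_const' (𝕂 := ℂ) (LinearMap.toContinuousLinearMap X) t
  have h2 := h.clm_apply (hasDerivAt_const t w)
  simp only [map_zero, add_zero] at h2
  simpa [finExp] using h2

/-- Differentiating the conjugate of `T` gives the conjugate of its derivation, so the derivatives
of all orders have the same form, with `T` replaced by its iterated derivations. -/
theorem hasDerivAt_conj_bilin (X' : Module.End ℂ W') (X'' : Module.End ℂ W'') (X : Module.End ℂ W)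
    (l : Module.Dual ℂ W) (T : W' →ₗ[ℂ] W'' →ₗ[ℂ] W) (a : W') (b : W'') (t : ℂ) :
    HasDerivAt (fun s : ℂ => l (finExp (s • X) (T (finExp (-(s • X')) a) (finExp (-(s • X'')) b))))
      (l (finExp (t • X) (bilinDerivation X' X'' X T (finExp (-(t • X')) a)
        (finExp (-(t • X'')) b)))) t := by
  have : CompleteSpace W := FiniteDimensional.complete ℂ W
  have h := hasDerivAt_exp_smul_const (𝕂 := ℂ) (LinearMap.toContinuousLinearMap X) t
  have h' := hasDerivAt_finExp_smul_apply (-X') a t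
  have h'' := hasDerivAt_finExp_smul_apply (-X'') b t
  have hT := (((LinearMap.toContinuousBilinearMap T).hasFDerivAt.comp_hasDerivAt t h').clm_apply h'')
  have hl := (LinearMap.toContinuousLinearMap l).hasFDerivAt.comp_hasDerivAt t (h.clm_apply hT)
  simp only [smul_neg] at hl
  refine hl.congr_deriv ?_
  simp [finExp]
  ring

end Exponential

end EquivariantBilinearMaps

section HarmonicRepresentation

open MvPolynomial

/-! ### The orbit of an invariant bilinear map is harmonic -/

section Orbit

variable {D : ℕ} [NeZero D]

/-- The curve is the orbit of the first axis under a one-parameter group, as `v` is a unit vector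
orthogonal to that axis; its velocity is the value of the corresponding linear vector field. -/
theorem hasDerivAt_eval_spherePoint {v : Fin D → ℂ} (hv0 : v 0 = 0) (hv : ∑ α, v α ^ 2 = 1)
    (q : MvPolynomial (Fin D) ℂ) (t : ℂ) :
    HasDerivAt (fun s => eval (spherePoint s v) q)
      (eval (spherePoint t v) (∑ α, v α • polyRot 0 α q)) t := by
  let γ' : Fin D → ℂ := fun α => if α = 0 then -Complex.sin t else Complex.cos t * v α
  have hγ : ∀ i, HasDerivAt (fun s => spherePoint s v i) (γ' i) t := by
    intro i
    simp only [spherePoint, γ']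
    split_ifs
    · exact Complex.hasDerivAt_cos t
    · exact (Complex.hasDerivAt_sin t).mul_const _
  refine (hasDerivAt_eval hγ q).congr_deriv ?_
  have h1 : ∀ α, eval (spherePoint t v) (v α • polyRot 0 α q) =
      v α * Complex.cos t * eval (spherePoint t v) (pderiv α q) -
        v α ^ 2 * (Complex.sin t * eval (spherePoint t v) (pderiv 0 q)) := by
    intro α
    rw [polyRot_apply, smul_eval, map_sub, map_mul, map_mul, eval_X, eval_X]
    by_cases h : α = 0
    · rw [h, hv0]; simp
    · simp only [spherePoint, if_true, if_neg h]; ring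
  have h2 : ∀ α, γ' α * eval (spherePoint t v) (pderiv α q) =
      v α * Complex.cos t * eval (spherePoint t v) (pderiv α q) -
        if α = 0 then Complex.sin t * eval (spherePoint t v) (pderiv 0 q) else 0 := by
    intro α
    by_cases h : α = 0
    · simp only [γ', h, hv0, if_true]; ring
    · simp only [γ', if_neg h]; ring
  rw [map_sum]
  simp only [h1, h2, Finset.sum_sub_distrib, ← Finset.sum_mul, hv]
  simp

variable {W' W'' W : Type*} [NormedAddCommGroup W'] [InnerProductSpace ℂ W']
  [FiniteDimensional ℂ W'] [NormedAddCommGroup W''] [InnerProductSpace ℂ W'']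
  [FiniteDimensional ℂ W''] [NormedAddCommGroup W] [InnerProductSpace ℂ W]
  [FiniteDimensional ℂ W]

/-- The functional `S ↦ l (S a b)` is represented by some polynomial `q`. Both sides are entire in
`θ`, and representation says exactly that their Taylor coefficients at `0` agree. -/
theorem exists_harmonics_eq_conj_bilin (hD : 2 ≤ D) {Ω' : Fin D → Fin D → Module.End ℂ W'}
    {Ω'' : Fin D → Fin D → Module.End ℂ W''} {Ω : Fin D → Fin D → Module.End ℂ W}
    (hr' : IsRotationAction Ω') (hr'' : IsRotationAction Ω'') (hr : IsRotationAction Ω)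
    (hu' : ∀ α β x y, inner ℂ (Ω' α β x) y = -inner ℂ x (Ω' α β y))
    (hu'' : ∀ α β x y, inner ℂ (Ω'' α β x) y = -inner ℂ x (Ω'' α β y))
    (hu : ∀ α β x y, inner ℂ (Ω α β x) y = -inner ℂ x (Ω α β y))
    {T : W' →ₗ[ℂ] W'' →ₗ[ℂ] W}
    (hT : ∀ α β, α ≠ 0 → β ≠ 0 → bilinRotation Ω' Ω'' Ω α β T = 0) {K : Set ℕ}
    (hK : ∀ (S : W' →ₗ[ℂ] W'' →ₗ[ℂ] W) (c : ℂ), S ≠ 0 →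
      Complex.I • bilinRotation Ω' Ω'' Ω 0 1 S = c • S →
      cartanOf (bilinRotation Ω' Ω'' Ω) S = c • S →
      ∃ z : ℤ, c = z ∧ (0 ≤ z ∨ D = 2 → z.natAbs ∈ K))
    (l : Module.Dual ℂ W) (a : W') (b : W'') :
    ∃ q ∈ harmonicsOfDegrees D K, ∀ (θ : ℂ) (v : Fin D → ℂ), v 0 = 0 → ∑ α, v α ^ 2 = 1 →
      l (finExp (θ • ∑ α, v α • Ω 0 α) (T (finExp (-(θ • ∑ α, v α • Ω' 0 α)) a)
        (finExp (-(θ • ∑ α, v α • Ω'' 0 α)) b))) = eval (spherePoint θ v) q := by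
  have htop := representedFunctionals_eq_top (hr'.bilinRotation hr'' hr) hD bilinInner
    (fun S h => eq_zero_of_bilinInner_self h)
    (fun α β S S' => bilinInner_bilinDerivation (hu' α β) (hu'' α β) (hu α β) S S') hT hK
  let ev : Module.Dual ℂ (W' →ₗ[ℂ] W'' →ₗ[ℂ] W) :=
    { toFun := fun S => l (S a b), map_add' := fun S S' => by simp,
      map_smul' := fun c S => by simp }
  obtain ⟨q, hq, hrep⟩ : ev ∈ representedFunctionals (bilinRotation Ω' Ω'' Ω) T K := by
    rw [htop]; trivial
  refine ⟨q, hq, fun θ v hv0 hv => ?_⟩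
  set 𝒟 : Module.End ℂ (W' →ₗ[ℂ] W'' →ₗ[ℂ] W) :=
    bilinDerivation (∑ α, v α • Ω' 0 α) (∑ α, v α • Ω'' 0 α) (∑ α, v α • Ω 0 α) with h𝒟
  set L : Module.End ℂ (MvPolynomial (Fin D) ℂ) := ∑ α, v α • polyRot 0 α with hL
  have h𝒟' : 𝒟 = ∑ α, v α • bilinRotation Ω' Ω'' Ω 0 α := by
    ext S x y
    simp only [h𝒟, bilinDerivation_apply, LinearMap.sum_apply, LinearMap.smul_apply,
      bilinRotation, smul_sub, Finset.sum_sub_distrib, map_sum, map_smul]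
  -- The `k`-th derivatives of the two orbits at `θ = 0`, as a single vector of the closure on which
  -- `l` and `q` are compared.
  let z : ℕ → (W' →ₗ[ℂ] W'' →ₗ[ℂ] W) × Module.Dual ℂ (MvPolynomial (Fin D) ℂ) :=
    fun k => ((𝒟 ^ k) T, evalPole D ∘ₗ L ^ k)
  have hz : ∀ k, z k ∈ rotationClosure (withPolyDual (bilinRotation Ω' Ω'' Ω)) (T, evalPole D) := by
    intro k
    induction k with
    | zero => exact mem_rotationClosure_self _ _
    | succ k ih =>
      have e : z (k + 1) = ∑ α, v α • withPolyDual (bilinRotation Ω' Ω'' Ω) 0 α (z k) := by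
        refine Prod.ext ?_ ?_
        · rw [Prod.fst_sum]
          simp only [z, withPolyDual, Prod.smul_fst, LinearMap.prodMap_apply]
          rw [pow_succ', Module.End.mul_apply, h𝒟']
          simp
        · rw [Prod.snd_sum]
          simp only [z, withPolyDual, Prod.smul_snd, LinearMap.prodMap_apply]
          refine LinearMap.ext fun p => ?_
          rw [pow_succ, hL]
          simp
      rw [e]
      exact sum_mem fun α _ => Submodule.smul_mem _ _ (map_mem_rotationClosure ih 0 α)
  refine eq_of_hasDerivAt_succ
    (g := fun k t => l (finExp (t • ∑ α, v α • Ω 0 α) ((𝒟 ^ k) T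
      (finExp (-(t • ∑ α, v α • Ω' 0 α)) a) (finExp (-(t • ∑ α, v α • Ω'' 0 α)) b))))
    (p := fun k t => eval (spherePoint t v) ((L ^ k) q)) ?_ ?_ ?_ θ
  · intro k t
    have := hasDerivAt_conj_bilin (∑ α, v α • Ω' 0 α) (∑ α, v α • Ω'' 0 α) (∑ α, v α • Ω 0 α)
      l ((𝒟 ^ k) T) a b t
    rw [pow_succ' 𝒟]
    exact this
  · intro k t
    have := hasDerivAt_eval_spherePoint hv0 hv ((L ^ k) q) t
    rw [pow_succ' L, Module.End.mul_apply]
    refine this.congr_deriv ?_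
    nth_rewrite 2 [hL]
    simp
  · intro k
    have h := hrep (z k) (hz k)
    have hs : spherePoint 0 v = Pi.single 0 1 := by
      funext i
      by_cases h : i = 0 <;> simp [spherePoint, h]
    simp only [zero_smul, neg_zero, hs]
    have h2 : finExp (0 : Module.End ℂ W') a = a := by simp [finExp]
    have h3 : finExp (0 : Module.End ℂ W'') b = b := by simp [finExp]
    have h4 : ∀ w, finExp (0 : Module.End ℂ W) w = w := by intro w; simp [finExp]
    rw [h2, h3, h4, ← evalPole_apply]
    exact h

end Orbit

/-! ### The exponential of a locally finite operator -/

theorem isExpApply_finExp {V : Type*} [AddCommGroup V] [Module ℂ V] {U : Type*}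
    [NormedAddCommGroup U] [NormedSpace ℂ U] [FiniteDimensional ℂ U] (i : U →ₗ[ℂ] V)
    (X : Module.End ℂ V) (Y : Module.End ℂ U) (h : ∀ u, i (Y u) = X (i u)) (u : U) :
    IsExpApply X (i u) (i (finExp Y u)) := by
  intro l
  have : CompleteSpace U := FiniteDimensional.complete ℂ U
  have h1 := NormedSpace.exp_series_hasSum_exp' (𝕂 := ℂ) (LinearMap.toContinuousLinearMap Y)
  let ev : (U →L[ℂ] U) →L[ℂ] ℂ :=
    (LinearMap.toContinuousLinearMap (l ∘ₗ i)).comp (ContinuousLinearMap.apply ℂ U u)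
  have h2 := ev.hasSum h1
  have hp : ∀ k : ℕ, i ((Y ^ k) u) = (X ^ k) (i u) := by
    intro k
    induction k with
    | zero => simp
    | succ k ih => rw [pow_succ', pow_succ', Module.End.mul_apply, Module.End.mul_apply, h, ih]
  have hq : ∀ k : ℕ, ((LinearMap.toContinuousLinearMap Y) ^ k) u = (Y ^ k) u := by
    intro k
    induction k with
    | zero => simp
    | succ k ih => rw [pow_succ', pow_succ']; simp [ih]
  have he : ∀ k : ℕ, ev (((k.factorial : ℂ))⁻¹ • (LinearMap.toContinuousLinearMap Y) ^ k) =
      ((k.factorial : ℂ))⁻¹ * l ((X ^ k) (i u)) := by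
    intro k
    simp [ev, hq, hp]
  simp only [he] at h2
  exact h2

end HarmonicRepresentation

/-! ### Invariant subspaces, energies and spins -/

namespace ConformalAction

variable {D : ℕ} {V : Type*} [AddCommGroup V] [Module ℂ V] (A : ConformalAction D V)

theorem isRotationAction : IsRotationAction A.Ω where
  antisymm α β x := LinearMap.congr_fun (A.Ω_antisymm α β) x
  comm α₁ β₁ α₂ β₂ x := by
    have hite : ∀ (P : Prop) [Decidable P] (X : Module.End ℂ V),
        (if P then X else 0) x = if P then X x else 0 := by
      intro P _ X; split_ifs <;> rfl
    have h := LinearMap.congr_fun (A.Ω_Ω α₁ β₁ α₂ β₂) x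
    simp only [lie_end_apply, LinearMap.add_apply, LinearMap.sub_apply, hite] at h
    exact h

theorem H_Ω_apply (α β : Fin D) (x : V) : A.H (A.Ω α β x) = A.Ω α β (A.H x) :=
  sub_eq_zero.1 (LinearMap.congr_fun (A.H_Ω α β) x)

variable {A}

/-- The action of the rotations on an invariant subspace. -/
def RotationInvariant.action {W : Submodule ℂ V} (hW : A.RotationInvariant W) (α β : Fin D) :
    Module.End ℂ W := (A.Ω α β).restrict (hW α β)

@[simp]
theorem RotationInvariant.action_coe {W : Submodule ℂ V} (hW : A.RotationInvariant W)
    (α β : Fin D) (w : W) : (hW.action α β w : V) = A.Ω α β w := rfl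

theorem RotationInvariant.isRotationAction {W : Submodule ℂ V} (hW : A.RotationInvariant W) :
    IsRotationAction hW.action where
  antisymm α β x := Subtype.ext (A.isRotationAction.antisymm α β x)
  comm α₁ β₁ α₂ β₂ x := by
    have hite : ∀ (P : Prop) [Decidable P] (α β : Fin D),
        (((if P then hW.action α β x else 0 : W)) : V) = if P then A.Ω α β x else 0 := by
      intro P _ α β; split_ifs <;> rfl
    refine Subtype.ext ?_
    have h := A.isRotationAction.comm α₁ β₁ α₂ β₂ x
    simp only [Submodule.coe_sub, Submodule.coe_add, hite, RotationInvariant.action_coe]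
    exact h

variable (A)

theorem rotationInvariant_eigenspace (c : ℂ) : A.RotationInvariant (A.H.eigenspace c) := by
  intro α β w hw
  rw [Module.End.mem_eigenspace_iff] at hw ⊢
  rw [H_Ω_apply, hw, map_smul]

theorem rotationInvariant_iSup {ι : Sort*} {W : ι → Submodule ℂ V}
    (h : ∀ i, A.RotationInvariant (W i)) : A.RotationInvariant (⨆ i, W i) := by
  intro α β
  have : (⨆ i, W i) ≤ (⨆ i, W i).comap (A.Ω α β) :=
    iSup_le fun i w hw => Submodule.mem_iSup_of_mem i (h i α β w hw)
  exact this

/-- Every finite-dimensional subspace of an eigenspace of `H` is contained in a rotation-invariant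
one. -/
theorem exists_rotationInvariant_ge (hA : A.Integrable) {c : ℂ} (U : Submodule ℂ V)
    [FiniteDimensional ℂ U] (hU : U ≤ A.H.eigenspace c) :
    ∃ W : Submodule ℂ V, FiniteDimensional ℂ W ∧ A.RotationInvariant W ∧ U ≤ W ∧
      W ≤ A.H.eigenspace c := by
  choose W hfin hmem hinv using hA
  let b := Module.finBasis ℂ U
  refine ⟨⨆ i, W (b i) ⊓ A.H.eigenspace c, inferInstance, A.rotationInvariant_iSup fun i α β w hw =>
    ⟨hinv _ α β w hw.1, A.rotationInvariant_eigenspace c α β w hw.2⟩, ?_,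
    iSup_le fun i => inf_le_right⟩
  intro u hu
  have h : (⟨u, hu⟩ : U) ∈ Submodule.span ℂ (Set.range b) := by rw [b.span_eq]; trivial
  have h2 := Submodule.mem_map_of_mem (f := U.subtype) h
  rw [Submodule.map_span] at h2
  refine Submodule.span_le.2 ?_ h2
  rintro _ ⟨_, ⟨i, rfl⟩, rfl⟩
  exact Submodule.mem_iSup_of_mem i ⟨hmem _, hU (b i).2⟩

variable {A}

/-- Eigenspaces of `H` are independent, and those of non-negative energy already span. -/
theorem eq_zero_of_negative_energy (hpos : A.PositiveEnergy) {Δ : ℝ} (hΔ : Δ < 0) {v : V}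
    (hv : A.H v = (Δ : ℂ) • v) : v = 0 := by
  have hind := Module.End.eigenspaces_iSupIndep A.H (Δ : ℂ)
  have hle : (⊤ : Submodule ℂ V) ≤ ⨆ μ, ⨆ _ : μ ≠ (Δ : ℂ), A.H.eigenspace μ := by
    rw [← show (⨆ k : ℕ, A.H.eigenspace ((k : ℂ) / 2)) = ⊤ from hpos]
    refine iSup_le fun k => le_iSup₂_of_le ((k : ℂ) / 2) (fun h => ?_) le_rfl
    have h2 : (k : ℝ) / 2 = Δ := by
      have h3 : (((k : ℝ) / 2 : ℝ) : ℂ) = (Δ : ℂ) := by push_cast; exact h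
      exact_mod_cast h3
    have : (0 : ℝ) ≤ (k : ℝ) / 2 := by positivity
    linarith
  have h0 := hind.mono_right hle
  rw [disjoint_top] at h0
  have : v ∈ A.H.eigenspace (Δ : ℂ) := Module.End.mem_eigenspace_iff.2 hv
  rwa [h0, Submodule.mem_bot] at this

theorem isEven_of_cartanOf_eq [NeZero D] (hint : A.StronglyIntegrable) {Δ s : ℂ} {v : V}
    (hv0 : v ≠ 0) (hv : A.H v = Δ • v) (hs : cartanOf A.Ω v = s • v) :
    ∃ k : ℤ, Δ + s = 2 * (k : ℂ) := by
  refine hint.2.2 _ ?_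
  refine Module.End.HasEigenvalue.mem_spectrum
    (Module.End.hasEigenvalue_of_hasEigenvector ⟨Module.End.mem_eigenspace_iff.2 ?_, hv0⟩)
  change A.H v + cartanOf A.Ω v = (Δ + s) • v
  rw [hv, hs, add_smul]

section Unitarity

variable {V : Type*} [NormedAddCommGroup V] [InnerProductSpace ℂ V] {A : ConformalAction D V}

/-- In a unitary representation with positive energy, the operator `H + a Ω₁₂` with `a² = -1` has
non-negative eigenvalues. -/
theorem add_weight_nonneg [NeZero D] (hD : 2 ≤ D) (hpos : A.PositiveEnergy)
    (hT : ∀ α x y, inner ℂ (A.T α x) y = -inner ℂ x (A.C α y))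
    {a : ℂ} (ha : a * a = -1) (haconj : (starRingEnd ℂ) a = -a) (n : ℕ) :
    ∀ (v : V) (Δ lam : ℝ), v ≠ 0 → Δ < n → A.H v = (Δ : ℂ) • v →
      A.H v + a • A.Ω 0 1 v = (lam : ℂ) • v → 0 ≤ lam := by
  have h01 : (0 : Fin D) ≠ 1 := by
    obtain ⟨k, rfl⟩ := Nat.exists_eq_add_of_le' hD
    exact Fin.zero_ne_one
  -- Induction on a strict upper bound `n` of the energy: `C` lowers the energy by one, and no
  -- vector has negative energy.
  induction n with
  | zero =>
    intro v Δ lam hv hΔ hH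
    exact absurd (eq_zero_of_negative_energy hpos (by simpa using hΔ) hH) hv
  | succ n ih =>
    intro v Δ lam hv hΔ hH hL
    have hHC : ∀ α x, A.H (A.C α x) = A.C α (A.H x) - A.C α x := by
      intro α x
      have := LinearMap.congr_fun (A.H_C α) x
      rw [lie_end_apply, LinearMap.neg_apply, sub_eq_iff_eq_add] at this
      rw [this]; abel
    have hΩC0 : ∀ x, A.Ω 0 1 (A.C 0 x) = A.C 0 (A.Ω 0 1 x) + A.C 1 x := by
      intro x
      have := LinearMap.congr_fun (A.Ω_C 0 1 0) x
      rw [if_pos rfl, if_neg h01.symm, sub_zero, lie_end_apply, sub_eq_iff_eq_add] at this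
      rw [this]; abel
    have hΩC1 : ∀ x, A.Ω 0 1 (A.C 1 x) = A.C 1 (A.Ω 0 1 x) - A.C 0 x := by
      intro x
      have := LinearMap.congr_fun (A.Ω_C 0 1 1) x
      rw [if_pos rfl, if_neg h01, zero_sub, lie_end_apply, LinearMap.neg_apply,
        sub_eq_iff_eq_add] at this
      rw [this]; abel
    -- Up to normalization, `T 0 + a T 1`, `C 0 - a C 1` and `H + a Ω 0 1` form an `sl₂`-triple. The
    -- vector `w` has energy `Δ - 1` and eigenvalue `lam - 2`.
    set w := A.C 0 v - a • A.C 1 v with hw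
    have hΩv : a • A.Ω 0 1 v = ((lam : ℂ) - Δ) • v := by
      rw [sub_smul, ← hL, ← hH]; abel
    have hΩv' : A.Ω 0 1 v = (-a * ((lam : ℂ) - Δ)) • v := by
      rw [mul_smul, ← hΩv, smul_smul, neg_mul, ha, neg_neg, one_smul]
    by_cases hw0 : w = 0
    · have hTC : ∀ α β x, A.C β (A.T α x) = A.T α (A.C β x) -
          ((if α = β then (2 : ℂ) • A.H x else 0) - (2 : ℂ) • A.Ω α β x) := by
        intro α β x
        have := LinearMap.congr_fun (A.T_C α β) x
        rw [lie_end_apply, LinearMap.sub_apply] at this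
        have hite : (if α = β then (2 : ℂ) • A.H else 0) x =
          if α = β then (2 : ℂ) • A.H x else 0 := by split_ifs <;> rfl
        rw [hite, LinearMap.smul_apply] at this
        rw [← this]; abel
      -- When `w = 0`, the vector `v` is of lowest weight, and unitarity gives `‖u‖² = 4 lam ‖v‖²`,
      -- whence the sign of `lam`.
      set u := A.T 0 v + a • A.T 1 v with hu
      have h1 : A.C 0 u - a • A.C 1 u = -((4 * lam : ℂ) • v) := by
        have e1 : A.C 0 u - a • A.C 1 u = A.T 0 w + a • A.T 1 w -
            ((2 : ℂ) • A.H v - (a * a) • (2 : ℂ) • A.H v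
              + a • (2 : ℂ) • A.Ω 0 1 v - a • (2 : ℂ) • A.Ω 1 0 v) := by
          rw [hu, hw]
          simp only [map_add, map_sub, map_smul, hTC, if_true, if_neg h01, if_neg h01.symm,
            A.isRotationAction.self_eq_zero]
          module
        rw [e1, hw0, map_zero, map_zero, A.isRotationAction.antisymm 1 0, ha, hH, hΩv']
        match_scalars
        linear_combination 4 * ((lam : ℂ) - Δ) * ha
      have h2 : inner ℂ u u = ((4 * lam : ℝ) : ℂ) * inner ℂ v v := by
        have h3 : inner ℂ u u = -inner ℂ v (A.C 0 u - a • A.C 1 u) := by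
          conv_lhs => rw [hu]
          rw [inner_add_left, inner_smul_left, hT, hT, haconj, inner_sub_right, inner_smul_right]
          ring
        rw [h3, h1, inner_neg_right, inner_smul_right]
        push_cast; ring
      rw [inner_self_eq_norm_sq_to_K, inner_self_eq_norm_sq_to_K] at h2
      have h3 : ((‖u‖ ^ 2 : ℝ) : ℂ) = ((4 * lam * ‖v‖ ^ 2 : ℝ) : ℂ) := by
        push_cast
        simpa using h2
      have h4 : ‖u‖ ^ 2 = 4 * lam * ‖v‖ ^ 2 := Complex.ofReal_injective h3
      have h5 : 0 < ‖v‖ ^ 2 := by positivity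
      nlinarith [sq_nonneg ‖u‖]
    · have := ih w (Δ - 1) (lam - 2) hw0 (by push_cast at hΔ; linarith) ?_ ?_
      · linarith
      · rw [hw, map_sub, map_smul, hHC, hHC, hH, map_smul, map_smul]
        push_cast; module
      · rw [hw, map_sub, map_smul, map_sub, map_smul, hHC, hHC, hΩC0, hΩC1, hH, hΩv']
        simp only [map_smul]
        push_cast
        match_scalars
        · linear_combination (-((lam : ℂ) - Δ) + 1) * ha
        · linear_combination (((lam : ℂ) - Δ) * a) * ha

/-- The unitarity bound: both `Δ + j` and `Δ - j` are non-negative, by `a = i` and `a = -i`. -/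
theorem abs_weight_le [NeZero D] (hD : 2 ≤ D) (hpos : A.PositiveEnergy)
    (hT : ∀ α x y, inner ℂ (A.T α x) y = -inner ℂ x (A.C α y)) {v : V} (hv : v ≠ 0) {Δ j : ℝ}
    (hH : A.H v = (Δ : ℂ) • v) (hj : Complex.I • A.Ω 0 1 v = (j : ℂ) • v) : |j| ≤ Δ := by
  obtain ⟨n, hn⟩ := exists_nat_gt Δ
  have h1 := add_weight_nonneg hD hpos hT Complex.I_mul_I Complex.conj_I n v Δ (Δ + j) hv hn hH
    (by rw [hH, hj]; push_cast; module)
  have h2 := add_weight_nonneg hD hpos hT (a := -Complex.I) (by simp) (by simp) n v Δ (Δ - j) hv hn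
    hH (by rw [hH, neg_smul, hj]; push_cast; module)
  rw [abs_le]
  constructor <;> linarith

end Unitarity

end ConformalAction

/-! ### Coefficients in a harmonic basis and their uniqueness -/

section Expansion

open MvPolynomial

theorem two_le_of_even {D : ℕ} [NeZero D] (hD : Even D) : 2 ≤ D := by
  obtain ⟨k, hk⟩ := hD
  have := NeZero.pos D
  omega

/-- Membership in the span of harmonic polynomials of degrees in `K` in terms of coefficients. -/
theorem exists_coeff_of_mem_harmonicsOfDegrees {D : ℕ} (h : HarmonicBasis D) {K : Set ℕ}
    {q : MvPolynomial (Fin D) ℂ} (hq : q ∈ harmonicsOfDegrees D K) :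
    ∃ d : (Σ m : ℕ, Fin (harmonicDim D m)) →₀ ℂ, (∀ s, d s ≠ 0 → s.1 ∈ K) ∧
      d.sum (fun s r => r • (h s.1 s.2 : MvPolynomial (Fin D) ℂ)) = q := by
  have hle : harmonicsOfDegrees D K ≤ Submodule.span ℂ
      ((fun s : Σ m : ℕ, Fin (harmonicDim D m) => (h s.1 s.2 : MvPolynomial (Fin D) ℂ)) ''
        {s | s.1 ∈ K}) := by
    refine iSup₂_le fun m hm p hp => ?_
    have h1 : (⟨p, hp⟩ : harmonicSubmodule D m) ∈ Submodule.span ℂ (Set.range (h m)) := by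
      rw [(h m).span_eq]; trivial
    have h2 := Submodule.mem_map_of_mem (f := (harmonicSubmodule D m).subtype) h1
    rw [Submodule.map_span] at h2
    refine Submodule.span_mono ?_ h2
    rintro _ ⟨_, ⟨σ, rfl⟩, rfl⟩
    exact ⟨⟨m, σ⟩, hm, rfl⟩
  obtain ⟨d, hd, hdq⟩ := (Finsupp.mem_span_image_iff_linearCombination ℂ).1 (hle hq)
  refine ⟨d, fun s hs => ?_, hdq⟩
  exact (Finsupp.mem_supported ℂ d).1 hd (Finsupp.mem_support_iff.2 hs)

variable {D : ℕ} {V : Type*} [AddCommGroup V] [Module ℂ V]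

/-- The value at `(cos θ, sin θ v)` of the polynomial with coefficients `c` in a harmonic basis. -/
def harmonicSum (h : HarmonicBasis D) (c : (Σ m : ℕ, Fin (harmonicDim D m)) →₀ V)
    (x : Fin D → ℂ) : V :=
  c.sum fun s w => eval x (h s.1 s.2 : MvPolynomial (Fin D) ℂ) • w

theorem harmonicSum_add (h : HarmonicBasis D) (c c' : (Σ m : ℕ, Fin (harmonicDim D m)) →₀ V)
    (x : Fin D → ℂ) : harmonicSum h (c + c') x = harmonicSum h c x + harmonicSum h c' x :=
  Finsupp.sum_add_index' (fun _ => smul_zero _) fun _ _ _ => smul_add _ _ _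

theorem harmonicSum_smul (h : HarmonicBasis D) (r : ℂ)
    (c : (Σ m : ℕ, Fin (harmonicDim D m)) →₀ V) (x : Fin D → ℂ) :
    harmonicSum h (r • c) x = r • harmonicSum h c x := by
  rw [harmonicSum, Finsupp.sum_smul_index' (fun _ => smul_zero _), harmonicSum, Finsupp.smul_sum]
  exact Finset.sum_congr rfl fun _ _ => smul_comm _ _ _

theorem harmonicSum_sum (h : HarmonicBasis D) {ι : Type*} (t : Finset ι)
    (c : ι → (Σ m : ℕ, Fin (harmonicDim D m)) →₀ V) (x : Fin D → ℂ) :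
    harmonicSum h (∑ i ∈ t, c i) x = ∑ i ∈ t, harmonicSum h (c i) x := by
  classical
  induction t using Finset.induction_on with
  | empty => simp [harmonicSum]
  | insert i t hi ih => rw [Finset.sum_insert hi, Finset.sum_insert hi, harmonicSum_add, ih]

/-- The coefficients in a harmonic basis are determined by the values on the sphere. -/
theorem eq_zero_of_harmonicSum_eq_zero [NeZero D] (hD : 2 ≤ D) (h : HarmonicBasis D)
    (c : (Σ m : ℕ, Fin (harmonicDim D m)) →₀ V)
    (hc : ∀ (θ : ℂ) (v : Fin D → ℂ), v 0 = 0 → ∑ α, v α ^ 2 = 1 →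
      harmonicSum h c (spherePoint θ v) = 0) : c = 0 := by
  ext s
  rw [Finsupp.zero_apply, ← Module.forall_dual_apply_eq_zero_iff ℂ]
  intro l
  let q : ℕ → MvPolynomial (Fin D) ℂ := fun m =>
    ∑ σ, l (c ⟨m, σ⟩) • (h m σ : MvPolynomial (Fin D) ℂ)
  have hq : ∀ m, q m ∈ harmonicSubmodule D m := fun m =>
    sum_mem fun σ _ => Submodule.smul_mem _ _ (h m σ).2
  let t : Finset ℕ := c.support.image Sigma.fst
  have hsum : ∀ x : Fin D → ℂ, eval x (∑ m ∈ t, q m) = l (harmonicSum h c x) := by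
    intro x
    have e : harmonicSum h c x = ∑ s ∈ t.sigma fun m => (Finset.univ : Finset (Fin (harmonicDim D m))),
        eval x (h s.1 s.2 : MvPolynomial (Fin D) ℂ) • c s := by
      refine Finset.sum_subset (fun s hs => ?_) fun s _ hs => ?_
      · exact Finset.mem_sigma.2 ⟨Finset.mem_image_of_mem _ hs, Finset.mem_univ _⟩
      · simp only [Finsupp.notMem_support_iff.1 hs, smul_zero]
    rw [e, Finset.sum_sigma, map_sum, map_sum]
    refine Finset.sum_congr rfl fun m _ => ?_
    rw [map_sum, map_sum]
    refine Finset.sum_congr rfl fun σ _ => ?_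
    rw [smul_eval, map_smul, smul_eq_mul, mul_comm]
  have hvan : ∑ m ∈ t, q m ∈ sphereVanishing D := by
    intro x hx
    rw [hsum]
    suffices H : ∃ (θ : ℂ) (v : Fin D → ℂ), v 0 = 0 ∧ ∑ α, v α ^ 2 = 1 ∧
        spherePoint θ v = fun i => (x i : ℂ) by
      obtain ⟨θ, v, hv0, hv, hx⟩ := H
      rw [← hx, hc θ v hv0 hv, map_zero]
    have hxs : ∑ i, (x i : ℂ) ^ 2 = 1 := by exact_mod_cast congrArg (fun r : ℝ => (r : ℂ)) hx
    have hx0 : x 0 ^ 2 ≤ 1 := by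
      rw [← hx]
      exact Finset.single_le_sum (f := fun i => x i ^ 2) (fun i _ => sq_nonneg _)
        (Finset.mem_univ 0)
    have hx1 : -1 ≤ x 0 ∧ x 0 ≤ 1 := abs_le.1 ((sq_le_one_iff_abs_le_one _).1 hx0)
    set θ := Real.arccos (x 0) with hθ
    have hcos : Complex.cos θ = x 0 := by
      rw [← Complex.ofReal_cos, hθ, Real.cos_arccos hx1.1 hx1.2]
    have hsq : ∑ i, (if i = 0 then 0 else (x i : ℂ)) ^ 2 = Complex.sin θ ^ 2 := by
      have h1 : ∀ i, (if i = 0 then 0 else (x i : ℂ)) ^ 2 =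
          (x i : ℂ) ^ 2 - if i = 0 then (x i : ℂ) ^ 2 else 0 := by
        intro i; split_ifs <;> simp
      simp only [h1, Finset.sum_sub_distrib, hxs]
      have := Complex.sin_sq_add_cos_sq (θ : ℂ)
      rw [hcos] at this
      simp
      linear_combination -this
    -- At the poles the direction is undetermined, and any unit vector orthogonal to the first axis
    -- serves as `v`.
    by_cases hs : Complex.sin θ = 0
    · have h01 : (1 : Fin D) ≠ 0 := by
        obtain ⟨k, rfl⟩ := Nat.exists_eq_add_of_le' hD
        exact Fin.zero_ne_one.symm
      refine ⟨θ, Pi.single 1 1, by simp [h01.symm], ?_, ?_⟩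
      · rw [Finset.sum_eq_single 1] <;> simp +contextual
      · rw [hs] at hsq
        have h2 : ∀ i, i ≠ 0 → x i = 0 := by
          intro i hi
          have h3 : ∑ i, (if i = 0 then 0 else x i) ^ 2 = 0 := by
            have : ((∑ i, (if i = 0 then 0 else x i) ^ 2 : ℝ) : ℂ) = 0 := by
              push_cast
              refine Eq.trans ?_ (hsq.trans (zero_pow two_ne_zero))
              exact Finset.sum_congr rfl fun i _ => by split_ifs <;> simp
            exact_mod_cast this
          rw [Finset.sum_eq_zero_iff_of_nonneg fun _ _ => sq_nonneg _] at h3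
          have := h3 i (Finset.mem_univ i)
          rw [if_neg hi] at this
          exact pow_eq_zero_iff two_ne_zero |>.1 this
        funext i
        by_cases hi : i = 0
        · simp [spherePoint, hi, hcos]
        · simp [spherePoint, hi, hs, h2 i hi]
    · refine ⟨θ, fun i => if i = 0 then 0 else (x i : ℂ) / Complex.sin θ, by simp, ?_, ?_⟩
      · have h1 : ∀ i, (if i = 0 then 0 else (x i : ℂ) / Complex.sin θ) ^ 2 =
            (if i = 0 then 0 else (x i : ℂ)) ^ 2 / Complex.sin θ ^ 2 := by
          intro i; split_ifs <;> simp [div_pow]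
        simp only [h1]
        rw [← Finset.sum_div, hsq, div_self (pow_ne_zero 2 hs)]
      · funext i
        by_cases hi : i = 0
        · simp [spherePoint, hi, hcos]
        · simp only [spherePoint, if_neg hi]
          field_simp
  by_cases hst : s.1 ∈ t
  · have h1 := harmonic_eq_zero_of_sum_mem_sphereVanishing hD t q (fun m _ => hq m) hvan s.1 hst
    have h2 : ∑ σ, l (c ⟨s.1, σ⟩) • h s.1 σ = 0 := by
      apply Subtype.ext
      rw [Submodule.coe_sum]
      exact h1
    exact Fintype.linearIndependent_iff.1 (h s.1).linearIndependent _ h2 s.2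
  · have : c s = 0 := by
      rw [← Finsupp.notMem_support_iff]
      exact fun h => hst (Finset.mem_image_of_mem _ h)
    rw [this, map_zero]

end Expansion

/-! ### Harmonic expansion of the rotated product, with parity and pole bound -/

section UnitaryExpansion

open MvPolynomial

variable {D : ℕ} {V : Type*} [NormedAddCommGroup V] [InnerProductSpace ℂ V]

theorem cartanOf_action_coe {A : ConformalAction D V} {W : Submodule ℂ V}
    (hW : A.RotationInvariant W) (w : W) :
    (cartanOf hW.action w : V) = cartanOf A.Ω (w : V) := by
  rw [cartanOf_apply, cartanOf_apply, Submodule.coe_smul, Submodule.coe_sum]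
  rfl

theorem isSymmetric_smul_I {W : Type*} [NormedAddCommGroup W] [InnerProductSpace ℂ W]
    {X : Module.End ℂ W} (hX : ∀ x y, inner ℂ (X x) y = -inner ℂ x (X y)) :
    (Complex.I • X).IsSymmetric := by
  intro x y
  simp [inner_smul_left, inner_smul_right, hX]

/-- Everything happens in three finite-dimensional invariant spaces of fixed energies. Locality
makes the product invariant under the rotations fixing the first axis; strong integrability fixes
the parity of the degrees, and the unitarity bound on the target limits their size. -/
theorem exists_expansion [NeZero D] (hD : Even D) (𝒱 : VertexAlgebra V) (A : ConformalAction D V)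
    (heven : ∀ X ∈ A.operators, 𝒱.IsEvenEnd X) (hlocal : ∀ X ∈ A.operators, 𝒱.IsLocalEnd X)
    (hint : A.StronglyIntegrable) (hpos : A.PositiveEnergy)
    (hΩ : ∀ α β x y, inner ℂ (A.Ω α β x) y = -inner ℂ x (A.Ω α β y))
    (hTC : ∀ α x y, inner ℂ (A.T α x) y = -inner ℂ x (A.C α y))
    (hvac : ∀ X ∈ A.operators, X 𝒱.vac = 0) (hT : A.T 0 = 𝒱.translation) (h : HarmonicBasis D)
    {Δ' Δ'' J' J'' : ℝ} {W' W'' : Submodule ℂ V} [FiniteDimensional ℂ W'] [FiniteDimensional ℂ W'']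
    (hW' : A.RotationInvariant W') (hW'' : A.RotationInvariant W'')
    (hH' : W' ≤ A.H.eigenspace (Δ' : ℂ)) (hH'' : W'' ≤ A.H.eigenspace (Δ'' : ℂ))
    (hJ' : ∀ j ∈ A.spins W', -J' ≤ j ∧ (D = 2 → j ≤ J'))
    (hJ'' : ∀ j ∈ A.spins W'', -J'' ≤ j ∧ (D = 2 → j ≤ J'')) (n : ℤ) {a b : V} (ha : a ∈ W')
    (hb : b ∈ W'') :
    ∃ c : (Σ m : ℕ, Fin (harmonicDim D m)) →₀ V,
      (∀ s, c s ≠ 0 → (∃ k : ℤ, n - s.1 = 2 * k) ∧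
        ((s.1 : ℝ) - n) / 2 ≤ (Δ' + J' + Δ'' + J'') / 2) ∧
      ∀ (θ : ℂ) (v : Fin D → ℂ), v 0 = 0 → ∑ α, v α ^ 2 = 1 →
        harmonicSum h c (spherePoint θ v) = expApply (θ • A.rotationTo v)
          (𝒱.mu1 n (expApply (-(θ • A.rotationTo v)) a) (expApply (-(θ • A.rotationTo v)) b)) := by
  have hD2 := two_le_of_even hD
  have hHop : A.H ∈ A.operators := Submodule.subset_span (Or.inl (Or.inr rfl))
  have hΩop : ∀ α β, A.Ω α β ∈ A.operators := fun α β =>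
    Submodule.subset_span (Or.inr ⟨(α, β), rfl⟩)
  have hμH : ∀ a b, A.H (𝒱.mu1 n a b) =
      𝒱.mu1 n (A.H a) b + 𝒱.mu1 n a (A.H b) + (n : ℂ) • 𝒱.mu1 n a b := by
    intro a b
    have := 𝒱.map_mu1 (heven _ hHop) (hlocal _ hHop) (hvac _ hHop) 1
      (by rw [← hT, A.H_T, one_smul]) n a b
    rwa [one_mul] at this
  have hμΩ : ∀ α β, α ≠ 0 → β ≠ 0 → ∀ a b, A.Ω α β (𝒱.mu1 n a b) =
      𝒱.mu1 n (A.Ω α β a) b + 𝒱.mu1 n a (A.Ω α β b) := by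
    intro α β hα hβ a b
    have := 𝒱.map_mu1 (heven _ (hΩop α β)) (hlocal _ (hΩop α β)) (hvac _ (hΩop α β)) 0
      (by rw [← hT, A.Ω_T, if_neg hα, if_neg hβ, sub_zero, zero_smul]) n a b
    rwa [zero_mul, zero_smul, add_zero] at this
  have hUfin : FiniteDimensional ℂ (Submodule.map₂ (𝒱.mu1Bilin n) W' W'') :=
    Module.Finite.iff_fg.2 (Submodule.FG.map₂ _ (Module.Finite.iff_fg.1 ‹_›)
      (Module.Finite.iff_fg.1 ‹_›))
  obtain ⟨W, hWfin, hW, hUW, hH⟩ := A.exists_rotationInvariant_ge (c := ((Δ' + Δ'' + n : ℝ) : ℂ))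
    hint.1 (Submodule.map₂ (𝒱.mu1Bilin n) W' W'') (Submodule.map₂_le.2 fun x hx y hy => by
      have h1 := Module.End.mem_eigenspace_iff.1 (hH' hx)
      have h2 := Module.End.mem_eigenspace_iff.1 (hH'' hy)
      rw [Module.End.mem_eigenspace_iff, VertexAlgebra.mu1Bilin_apply, hμH, h1, h2]
      rw [← VertexAlgebra.mu1Bilin_apply, ← VertexAlgebra.mu1Bilin_apply,
        ← VertexAlgebra.mu1Bilin_apply, map_smul, map_smul, LinearMap.smul_apply]
      push_cast
      module)
  have hmem : ∀ (x : W') (y : W''), 𝒱.mu1 n x y ∈ W := fun x y =>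
    hUW (Submodule.apply_mem_map₂ (𝒱.mu1Bilin n) x.2 y.2)
  let T : W' →ₗ[ℂ] W'' →ₗ[ℂ] W := LinearMap.mk₂ ℂ (fun x y => ⟨𝒱.mu1 n x y, hmem x y⟩)
    (fun x x' y => Subtype.ext (𝒱.mu1Bilin n |>.map_add₂ (x : V) x' (y : V)))
    (fun r x y => Subtype.ext (𝒱.mu1Bilin n |>.map_smul₂ r (x : V) (y : V)))
    (fun x y y' => Subtype.ext ((𝒱.mu1Bilin n (x : V)).map_add (y : V) y'))
    (fun r x y => Subtype.ext ((𝒱.mu1Bilin n (x : V)).map_smul r (y : V)))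
  have hTcoe : ∀ x y, (T x y : V) = 𝒱.mu1 n x y := fun x y => rfl
  have hTinv : ∀ α β, α ≠ 0 → β ≠ 0 → bilinRotation hW'.action hW''.action hW.action α β T = 0 := by
    intro α β hα hβ
    ext x y
    simp only [bilinRotation, bilinDerivation_apply, Submodule.coe_sub, hTcoe,
      ConformalAction.RotationInvariant.action_coe, hμΩ α β hα hβ, LinearMap.zero_apply,
      Submodule.coe_zero]
    abel
  have hu : ∀ {U : Submodule ℂ V} (hU : A.RotationInvariant U) (α β : Fin D) (x y : U),
      inner ℂ (hU.action α β x) y = -inner ℂ x (hU.action α β y) :=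
    fun hU α β x y => hΩ α β x y
  have hcsym : ∀ {U : Submodule ℂ V} (hU : A.RotationInvariant U),
      (cartanOf hU.action).IsSymmetric := by
    intro U hU
    refine isSymmetric_smul_I fun x y => ?_
    simp only [LinearMap.sum_apply, sum_inner, inner_sum, hu hU, Finset.sum_neg_distrib]
  let K : Set ℕ := {m | (∃ k : ℤ, n - m = 2 * k) ∧
    ((m : ℝ) - n) / 2 ≤ (Δ' + J' + Δ'' + J'') / 2}
  have hK : ∀ (S : W' →ₗ[ℂ] W'' →ₗ[ℂ] W) (c : ℂ), S ≠ 0 →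
      Complex.I • bilinRotation hW'.action hW''.action hW.action 0 1 S = c • S →
      cartanOf (bilinRotation hW'.action hW''.action hW.action) S = c • S →
      ∃ z : ℤ, c = z ∧ (0 ≤ z ∨ D = 2 → z.natAbs ∈ K) := by
    intro S c hS0 hS1 hS2
    rw [cartanOf_bilinRotation] at hS2
    rw [← LinearMap.smul_apply, bilinRotation, smul_bilinDerivation] at hS1
    -- Parity uses eigenvectors of the Cartan sum, the bound uses eigenvectors of `i Ω 0 1`. The two
    -- pairs need not coincide, since the eigenvalue `c` of `S` is common to both operators.
    obtain ⟨s', s'', x, y, hxy, hx, hy, hs⟩ :=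
      exists_eigenvectors_of_bilinDerivation_eq_smul (hcsym hW') (hcsym hW'') hS0 hS2
    obtain ⟨j', j'', x1, y1, hxy1, hx1, hy1, hj⟩ :=
      exists_eigenvectors_of_bilinDerivation_eq_smul (isSymmetric_smul_I (hu hW' 0 1))
        (isSymmetric_smul_I (hu hW'' 0 1)) hS0 hS1
    have hne : ∀ {x y}, S x y ≠ 0 → (x : V) ≠ 0 ∧ (y : V) ≠ 0 ∧ (S x y : V) ≠ 0 := by
      intro x y hxy
      refine ⟨fun h0 => hxy ?_, fun h0 => hxy ?_, fun h0 => hxy (Subtype.ext h0)⟩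
      · rw [show x = 0 from Subtype.ext h0, map_zero, LinearMap.zero_apply]
      · rw [show y = 0 from Subtype.ext h0, map_zero]
    obtain ⟨hx0, hy0, hz0⟩ := hne hxy
    obtain ⟨hx10, hy10, hz10⟩ := hne hxy1
    obtain ⟨k1, hk1⟩ := ConformalAction.isEven_of_cartanOf_eq hint hx0
      (Module.End.mem_eigenspace_iff.1 (hH' x.2))
      (by rw [← cartanOf_action_coe hW']; exact congrArg Subtype.val hx)
    obtain ⟨k2, hk2⟩ := ConformalAction.isEven_of_cartanOf_eq hint hy0
      (Module.End.mem_eigenspace_iff.1 (hH'' y.2))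
      (by rw [← cartanOf_action_coe hW'']; exact congrArg Subtype.val hy)
    obtain ⟨k3, hk3⟩ := ConformalAction.isEven_of_cartanOf_eq hint hz0
      (Module.End.mem_eigenspace_iff.1 (hH (S x y).2))
      (by rw [← cartanOf_action_coe hW]; exact congrArg Subtype.val hs)
    -- The value has energy `Δ' + Δ'' + n`; subtracting the two even numbers of the arguments from
    -- that of the value cancels `Δ'` and `Δ''` and leaves `c + n` even.
    have hc : c = ((2 * (k3 - k1 - k2) - n : ℤ) : ℂ) := by
      push_cast at hk3 ⊢
      linear_combination hk3 - hk1 - hk2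
    obtain ⟨hb1, hb1'⟩ := hJ' j' ⟨x1, x1.2, hx10, congrArg Subtype.val hx1⟩
    obtain ⟨hb2, hb2'⟩ := hJ'' j'' ⟨y1, y1.2, hy10, congrArg Subtype.val hy1⟩
    have hbound := ConformalAction.abs_weight_le hD2 hpos hTC hz10
      (j := ((2 * (k3 - k1 - k2) - n : ℤ) : ℝ) + j' + j'')
      (Module.End.mem_eigenspace_iff.1 (hH (S x1 y1).2)) (by
        have := congrArg Subtype.val hj
        rw [hc] at this
        push_cast at this ⊢
        exact this)
    rw [abs_le] at hbound
    refine ⟨_, hc, fun hz => ?_⟩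
    generalize hzdef : 2 * (k3 - k1 - k2) - n = z at *
    rcases le_or_gt 0 z with hz0 | hz0
    · have e : ((z.natAbs : ℕ) : ℤ) = z := Int.natAbs_of_nonneg hz0
      have e' : ((z.natAbs : ℕ) : ℝ) = z := by rw [← Int.cast_natCast, e]
      refine ⟨⟨n - (k3 - k1 - k2), by rw [e, ← hzdef]; ring⟩, ?_⟩
      rw [e']
      linarith
    -- A negative weight has degree `-z`, so the lower half of `|z + j' + j''| ≤ Δ' + Δ'' + n` is
    -- used. It needs upper bounds on the spins, hence maximal absolute values for `D = 2`.
    · have hD3 := hz.resolve_left (by omega)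
      have hb1' := hb1' hD3
      have hb2' := hb2' hD3
      have e : ((z.natAbs : ℕ) : ℤ) = -z := Int.ofNat_natAbs_of_nonpos hz0.le
      have e' : ((z.natAbs : ℕ) : ℝ) = -z := by
        rw [← Int.cast_natCast, e, Int.cast_neg]
      refine ⟨⟨k3 - k1 - k2, by rw [e, ← hzdef]; ring⟩, ?_⟩
      rw [e']
      linarith
  have hrep := fun l => exists_harmonics_eq_conj_bilin hD2 hW'.isRotationAction hW''.isRotationAction
    hW.isRotationAction (hu hW') (hu hW'') (hu hW) hTinv hK l ⟨a, ha⟩ ⟨b, hb⟩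
  -- The scalar expansions of the coordinates in `W` are reassembled into one vector-valued
  -- expansion.
  let B := Module.finBasis ℂ W
  choose q hqK hq using fun i => hrep (B.coord i)
  choose d hdK hd using fun i => exists_coeff_of_mem_harmonicsOfDegrees h (hqK i)
  let c : (Σ m : ℕ, Fin (harmonicDim D m)) →₀ V :=
    ∑ i, (d i).mapRange (fun r : ℂ => r • (B i : V)) (zero_smul _ _)
  refine ⟨c, fun s hs => ?_, fun θ v hv0 hv => ?_⟩
  · have : ∃ i, d i s ≠ 0 := by
      by_contra hne
      push Not at hne
      refine hs ?_
      simp only [c, Finsupp.finsetSum_apply, Finsupp.mapRange_apply, hne, zero_smul,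
        Finset.sum_const_zero]
    obtain ⟨i, hi⟩ := this
    exact hdK i s hi
  · have hY : ∀ {U : Submodule ℂ V} (hU : A.RotationInvariant U) [FiniteDimensional ℂ U] (u : U),
        expApply (θ • A.rotationTo v) (u : V) =
          (finExp (θ • ∑ α, v α • hU.action 0 α) u : V) := by
      intro U hU _ u
      refine IsExpApply.expApply_eq (isExpApply_finExp U.subtype _ _ (fun w => ?_) u)
      simp [ConformalAction.rotationTo]
    have hYneg : ∀ {U : Submodule ℂ V} (hU : A.RotationInvariant U) [FiniteDimensional ℂ U] (u : U),
        expApply (-(θ • A.rotationTo v)) (u : V) =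
          (finExp (-(θ • ∑ α, v α • hU.action 0 α)) u : V) := by
      intro U hU _ u
      refine IsExpApply.expApply_eq (isExpApply_finExp U.subtype _ _ (fun w => ?_) u)
      simp [ConformalAction.rotationTo]
    have e1 := hYneg hW' ⟨a, ha⟩
    have e2 := hYneg hW'' ⟨b, hb⟩
    simp only at e1 e2
    rw [e1, e2, ← hTcoe, hY hW]
    generalize hw : finExp (θ • ∑ α, v α • hW.action 0 α)
      (T (finExp (-(θ • ∑ α, v α • hW'.action 0 α)) ⟨a, ha⟩)
        (finExp (-(θ • ∑ α, v α • hW''.action 0 α)) ⟨b, hb⟩)) = w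
    have hcoord : ∀ i, B.coord i w = eval (spherePoint θ v) (q i) := by
      intro i
      rw [← hw]
      exact hq i θ v hv0 hv
    rw [harmonicSum_sum]
    have hterm : ∀ i, harmonicSum h ((d i).mapRange (fun r : ℂ => r • (B i : V)) (zero_smul _ _))
        (spherePoint θ v) = B.coord i w • (B i : V) := by
      intro i
      rw [harmonicSum, Finsupp.sum_mapRange_index (fun _ => smul_zero _), hcoord, ← hd i,
        Finsupp.sum, Finsupp.sum, map_sum, Finset.sum_smul]
      refine Finset.sum_congr rfl fun s _ => ?_
      rw [smul_eval, smul_smul, mul_comm]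
    simp only [hterm]
    conv_rhs => rw [← B.sum_repr w]
    rw [Submodule.coe_sum]
    rfl

end UnitaryExpansion

/-! ### Linearity of the exponential -/

section ExpApplyLinear

variable {V : Type*} [AddCommGroup V] [Module ℂ V]

theorem IsExpApply.add {X : Module.End ℂ V} {v v' w w' : V} (h : IsExpApply X v w)
    (h' : IsExpApply X v' w') : IsExpApply X (v + v') (w + w') := by
  intro l
  have := (h l).add (h' l)
  simpa [mul_add] using this

theorem IsExpApply.smul {X : Module.End ℂ V} {v w : V} (h : IsExpApply X v w) (r : ℂ) :
    IsExpApply X (r • v) (r • w) := by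
  intro l
  have := (h l).mul_left r
  simpa [mul_left_comm] using this

theorem expApply_add {X : Module.End ℂ V} (hX : ∀ v, ∃ w, IsExpApply X v w) (v v' : V) :
    expApply X (v + v') = expApply X v + expApply X v' := by
  obtain ⟨w, hw⟩ := hX v
  obtain ⟨w', hw'⟩ := hX v'
  rw [hw.expApply_eq, hw'.expApply_eq, (hw.add hw').expApply_eq]

theorem expApply_smul {X : Module.End ℂ V} (hX : ∀ v, ∃ w, IsExpApply X v w) (r : ℂ) (v : V) :
    expApply X (r • v) = r • expApply X v := by
  obtain ⟨w, hw⟩ := hX v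
  rw [hw.expApply_eq, (hw.smul r).expApply_eq]

end ExpApplyLinear

/-! ### Series localized at the quadratic form -/

section LocalizedSeries

open MvPolynomial

variable {D : ℕ}

theorem isHomogeneous_zSq : (zSq D).IsHomogeneous 2 :=
  IsHomogeneous.sum _ _ _ fun α _ => isHomogeneous_X_pow α 2

/-- A family of coefficients with even degree differences and bounded pole order defines a series
localized at `z²`. -/
theorem exists_equalsLocalizedSeries {V : Type*} [AddCommGroup V] [Module ℂ V]
    (h : HarmonicBasis D) (c : ℤ → (Σ m : ℕ, Fin (harmonicDim D m)) →₀ V) (N : ℕ)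
    (hc : ∀ n s, c n s ≠ 0 → (∃ k : ℤ, n - s.1 = 2 * k) ∧ ((s.1 : ℝ) - n) / 2 ≤ N) :
    ∃ f : (Fin D →₀ ℕ) → V, EqualsLocalizedSeries h (fun n m σ => c n ⟨m, σ⟩) N f := by
  have hk : ∀ n s, c n s ≠ 0 → ∃ k : ℕ, n - s.1 + 2 * N = 2 * (k : ℤ) := by
    intro n s hs
    obtain ⟨⟨k, hk⟩, hN⟩ := hc n s hs
    have h1 : (0 : ℝ) ≤ ((k + N : ℤ) : ℝ) := by
      have : ((n : ℝ) - s.1) = 2 * k := by exact_mod_cast congrArg (Int.cast (R := ℝ)) hk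
      push_cast
      linarith
    have h2 : 0 ≤ k + N := by exact_mod_cast h1
    exact ⟨(k + N).toNat, by rw [Int.toNat_of_nonneg h2]; linarith⟩
  refine ⟨fun e => _, fun n m σ hs => hk n ⟨m, σ⟩ hs, fun e => ⟨?_, rfl⟩⟩
  -- The term of index `(n, m)` is homogeneous of degree `n + 2N`, independently of `m`; so only `n
  -- = |e| - 2N` contributes to the exponent `e`, with finitely many harmonic coefficients.
  refine (((c (e.degree - 2 * N)).support.finite_toSet.image
    fun s => ((e.degree : ℤ) - 2 * N, s))).subset ?_
  rintro ⟨n, s⟩ hs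
  obtain ⟨hcoeff, hcs⟩ := smul_ne_zero_iff.1 hs
  simp only at hcoeff hcs
  obtain ⟨k, hk⟩ := hk n s hcs
  have hhom := (isHomogeneous_zSq (D := D).pow k).mul (mem_harmonicSubmodule.1 (h s.1 s.2).2).1
  have hk2 : ((n - s.1 + 2 * N) / 2).toNat = k := by rw [hk]; simp
  rw [hk2] at hcoeff
  have hdeg : e.degree = 2 * k + s.1 := by
    by_contra hne
    exact hcoeff (hhom.coeff_eq_zero hne)
  have hn : (e.degree : ℤ) - 2 * N = n := by
    rw [hdeg]; push_cast; linarith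
  rw [hn]
  exact ⟨s, Finsupp.mem_support_iff.2 hcs, rfl⟩

end LocalizedSeries

/-! ### Assembly of the reconstructed bilinear maps -/

section Reconstruction

variable {D : ℕ} {V : Type*} [NormedAddCommGroup V] [InnerProductSpace ℂ V]

theorem exists_isExpApply [NeZero D] {A : ConformalAction D V} (hA : A.Integrable) (r : ℂ)
    (v : Fin D → ℂ) (x : V) : ∃ y, IsExpApply (r • A.rotationTo v) x y := by
  obtain ⟨W, hfin, hx, hW⟩ := hA x
  exact ⟨_, isExpApply_finExp W.subtype _ (r • ∑ α, v α • hW.action 0 α)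
    (fun w => by simp [ConformalAction.rotationTo]) ⟨x, hx⟩⟩

/-- The expression `U(g) μ¹_n (U(g)⁻¹ a ⊗ U(g)⁻¹ b)` for the rotation `g = exp (θ Ω_{1,v})`. -/
def rotatedMu1 [NeZero D] (𝒱 : VertexAlgebra V) (A : ConformalAction D V) (n : ℤ) (θ : ℂ)
    (v : Fin D → ℂ) (a b : V) : V :=
  expApply (θ • A.rotationTo v)
    (𝒱.mu1 n (expApply (-(θ • A.rotationTo v)) a) (expApply (-(θ • A.rotationTo v)) b))

section

variable [NeZero D] {𝒱 : VertexAlgebra V} {A : ConformalAction D V} (hA : A.Integrable) (n : ℤ)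
  (θ : ℂ) (v : Fin D → ℂ)

include hA

theorem rotatedMu1_add_left (a a' b : V) : rotatedMu1 𝒱 A n θ v (a + a') b =
    rotatedMu1 𝒱 A n θ v a b + rotatedMu1 𝒱 A n θ v a' b := by
  have h1 := exists_isExpApply hA θ v
  have h2 := exists_isExpApply hA (-θ) v
  simp only [rotatedMu1, ← neg_smul]
  rw [expApply_add h2, ← expApply_add h1, ← VertexAlgebra.mu1Bilin_apply, map_add]
  rfl

theorem rotatedMu1_add_right (a b b' : V) : rotatedMu1 𝒱 A n θ v a (b + b') =
    rotatedMu1 𝒱 A n θ v a b + rotatedMu1 𝒱 A n θ v a b' := by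
  have h1 := exists_isExpApply hA θ v
  have h2 := exists_isExpApply hA (-θ) v
  simp only [rotatedMu1, ← neg_smul]
  rw [expApply_add h2, ← expApply_add h1, ← VertexAlgebra.mu1Bilin_apply, map_add]
  rfl

theorem rotatedMu1_smul_left (r : ℂ) (a b : V) :
    rotatedMu1 𝒱 A n θ v (r • a) b = r • rotatedMu1 𝒱 A n θ v a b := by
  have h1 := exists_isExpApply hA θ v
  have h2 := exists_isExpApply hA (-θ) v
  simp only [rotatedMu1, ← neg_smul]
  rw [expApply_smul h2, ← expApply_smul h1, ← VertexAlgebra.mu1Bilin_apply, map_smul]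
  rfl

theorem rotatedMu1_smul_right (r : ℂ) (a b : V) :
    rotatedMu1 𝒱 A n θ v a (r • b) = r • rotatedMu1 𝒱 A n θ v a b := by
  have h1 := exists_isExpApply hA θ v
  have h2 := exists_isExpApply hA (-θ) v
  simp only [rotatedMu1, ← neg_smul]
  rw [expApply_smul h2, ← expApply_smul h1, ← VertexAlgebra.mu1Bilin_apply, map_smul]
  rfl

end

/-- The coefficients `c` represent `rotatedMu1` as a polynomial on the sphere. -/
def IsExpansion [NeZero D] (𝒱 : VertexAlgebra V) (A : ConformalAction D V) (h : HarmonicBasis D)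
    (n : ℤ) (a b : V) (c : (Σ m : ℕ, Fin (harmonicDim D m)) →₀ V) : Prop :=
  ∀ (θ : ℂ) (v : Fin D → ℂ), v 0 = 0 → ∑ α, v α ^ 2 = 1 →
    harmonicSum h c (spherePoint θ v) = rotatedMu1 𝒱 A n θ v a b

theorem IsExpansion.unique [NeZero D] {𝒱 : VertexAlgebra V} {A : ConformalAction D V}
    {h : HarmonicBasis D} {n : ℤ} {a b : V} {c c' : (Σ m : ℕ, Fin (harmonicDim D m)) →₀ V}
    (hD : 2 ≤ D) (hc : IsExpansion 𝒱 A h n a b c) (hc' : IsExpansion 𝒱 A h n a b c') : c = c' := by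
  rw [← sub_eq_zero]
  refine eq_zero_of_harmonicSum_eq_zero hD h _ fun θ v hv0 hv => ?_
  rw [sub_eq_add_neg, ← neg_one_smul ℂ c', harmonicSum_add, harmonicSum_smul, hc θ v hv0 hv,
    hc' θ v hv0 hv]
  simp

/-- Expansions of homogeneous pairs add up to expansions of all pairs. Their uniqueness makes the
coefficients bilinear, determines the family, and allows comparison with the expansion attached to
any given `W'` and `W''`. -/
theorem exists_reconstruction [NeZero D] (hD : Even D) (𝒱 : VertexAlgebra V)
    (A : ConformalAction D V)
    (heven : ∀ X ∈ A.operators, 𝒱.IsEvenEnd X) (hlocal : ∀ X ∈ A.operators, 𝒱.IsLocalEnd X)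
    (hint : A.StronglyIntegrable) (hpos : A.PositiveEnergy)
    (hΩ : ∀ α β x y, inner ℂ (A.Ω α β x) y = -inner ℂ x (A.Ω α β y))
    (hTC : ∀ α x y, inner ℂ (A.T α x) y = -inner ℂ x (A.C α y))
    (hvac : ∀ X ∈ A.operators, X 𝒱.vac = 0) (hT : A.T 0 = 𝒱.translation) (h : HarmonicBasis D) :
    ∃ μ : ℤ → (m : ℕ) → Fin (harmonicDim D m) → V →ₗ[ℂ] V →ₗ[ℂ] V,
      IsReconstruction 𝒱 A h μ ∧
      (∀ μ', IsReconstruction 𝒱 A h μ' → μ' = μ) ∧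
      (∀ a b : V, ∃ N : ℕ,
        (∀ (n : ℤ) (m : ℕ) (σ : Fin (harmonicDim D m)),
          (N : ℝ) < ((m : ℝ) - (n : ℝ)) / 2 → μ n m σ a b = 0) ∧
        ∃ f : (Fin D →₀ ℕ) → V,
          EqualsLocalizedSeries h (fun n m σ => μ n m σ a b) N f) ∧
      (∀ (Δ' Δ'' J' J'' : ℝ) (W' W'' : Submodule ℂ V),
        FiniteDimensional ℂ W' → FiniteDimensional ℂ W'' →
        A.RotationInvariant W' → A.RotationInvariant W'' →
        W' ≤ A.H.eigenspace (Δ' : ℂ) → W'' ≤ A.H.eigenspace (Δ'' : ℂ) →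
        ((4 ≤ D ∧ IsLeast (A.spins W') (-J') ∧ IsLeast (A.spins W'') (-J'')) ∨
          (D = 2 ∧ IsGreatest ((fun j => |j|) '' A.spins W') J' ∧
            IsGreatest ((fun j => |j|) '' A.spins W'') J'')) →
        ∀ a ∈ W', ∀ b ∈ W'', ∀ (n : ℤ) (m : ℕ) (σ : Fin (harmonicDim D m)),
          μ n m σ a b ≠ 0 →
            ((m : ℝ) - (n : ℝ)) / 2 ≤ (Δ' + J' + Δ'' + J'') / 2) := by
  have hD2 := two_le_of_even hD
  have hA := hint.1
  -- The bound `N` is chosen before `n`, so that it bounds the order of the pole of the whole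
  -- series.
  let P : V → V → Prop := fun a b => ∃ N : ℕ, ∀ n : ℤ,
    ∃ c : (Σ m : ℕ, Fin (harmonicDim D m)) →₀ V,
      (∀ s, c s ≠ 0 → (∃ k : ℤ, n - s.1 = 2 * k) ∧ ((s.1 : ℝ) - n) / 2 ≤ N) ∧
      IsExpansion 𝒱 A h n a b c
  have hadd : ∀ {a b a' b' a'' b''}, (∀ n θ v, rotatedMu1 𝒱 A n θ v a'' b'' =
      rotatedMu1 𝒱 A n θ v a b + rotatedMu1 𝒱 A n θ v a' b') → P a b → P a' b' → P a'' b'' := by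
    rintro a b a' b' a'' b'' hsum ⟨N, hN⟩ ⟨N', hN'⟩
    refine ⟨max N N', fun n => ?_⟩
    obtain ⟨c, hc, hexp⟩ := hN n
    obtain ⟨c', hc', hexp'⟩ := hN' n
    refine ⟨c + c', fun s hs => ?_, fun θ v hv0 hv => ?_⟩
    · by_cases h0 : c s = 0
      · have : c' s ≠ 0 := fun h1 => hs (by rw [Finsupp.add_apply, h0, h1, add_zero])
        exact ⟨(hc' s this).1, (hc' s this).2.trans (by exact_mod_cast le_max_right _ _)⟩
      · exact ⟨(hc s h0).1, (hc s h0).2.trans (by exact_mod_cast le_max_left _ _)⟩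
    · rw [harmonicSum_add, hexp θ v hv0 hv, hexp' θ v hv0 hv, hsum]
  have hhom : ∀ (k k' : ℕ), ∀ a ∈ A.H.eigenspace ((k : ℂ) / 2),
      ∀ b ∈ A.H.eigenspace ((k' : ℂ) / 2), P a b := by
    intro k k' a ha b hb
    have hspin : ∀ (k : ℕ) (a : V), a ∈ A.H.eigenspace ((k : ℂ) / 2) →
        ∃ W : Submodule ℂ V, FiniteDimensional ℂ W ∧ A.RotationInvariant W ∧ a ∈ W ∧
          W ≤ A.H.eigenspace (((k / 2 : ℝ)) : ℂ) ∧
          ∀ j ∈ A.spins W, -(k / 2 : ℝ) ≤ j ∧ (D = 2 → j ≤ (k / 2 : ℝ)) := by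
      intro k a ha
      have e : ((k / 2 : ℝ) : ℂ) = (k : ℂ) / 2 := by push_cast; rfl
      obtain ⟨W, hfin, hW, hU, hH⟩ := A.exists_rotationInvariant_ge (c := ((k / 2 : ℝ) : ℂ)) hA
        (Submodule.span ℂ {a}) (by rw [e, Submodule.span_singleton_le_iff_mem]; exact ha)
      refine ⟨W, hfin, hW, hU (Submodule.mem_span_singleton_self a), hH, ?_⟩
      rintro j ⟨w, hw, hw0, hj⟩
      have := abs_le.1 (ConformalAction.abs_weight_le hD2 hpos hTC hw0
        (Module.End.mem_eigenspace_iff.1 (hH hw)) hj)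
      exact ⟨this.1, fun _ => this.2⟩
    obtain ⟨W', _, hW', ha', hH', hJ'⟩ := hspin k a ha
    obtain ⟨W'', _, hW'', hb', hH'', hJ''⟩ := hspin k' b hb
    -- Spins are bounded by energies, so `J' = Δ' = k/2` and `J'' = Δ'' = k'/2` are admissible; the
    -- resulting bound `(k + k')/2` is at most the integer `k + k'`.
    refine ⟨k + k', fun n => ?_⟩
    obtain ⟨c, hc, hexp⟩ := exists_expansion hD 𝒱 A heven hlocal hint hpos hΩ hTC hvac hT h hW' hW''
      hH' hH'' hJ' hJ'' n ha' hb'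
    refine ⟨c, fun s hs => ⟨(hc s hs).1, (hc s hs).2.trans ?_⟩, hexp⟩
    have h1 : (0 : ℝ) ≤ k := Nat.cast_nonneg k
    have h2 : (0 : ℝ) ≤ k' := Nat.cast_nonneg k'
    push_cast
    linarith
  have hmem : ∀ a : V, a ∈ ⨆ k : ℕ, A.H.eigenspace ((k : ℂ) / 2) := by
    intro a
    rw [show (⨆ k : ℕ, A.H.eigenspace ((k : ℂ) / 2)) = ⊤ from hpos]
    trivial
  have hP : ∀ a b, P a b := by
    intro a b
    refine Submodule.iSup_induction _ (motive := fun a => P a b) (hmem a) (fun k a ha => ?_) ?_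
      fun a a' => hadd fun n θ v => rotatedMu1_add_left hA n θ v a a' b
    · exact Submodule.iSup_induction _ (motive := fun b => P a b) (hmem b)
        (fun k' b hb => hhom k k' a ha b hb) (hhom k 0 a ha 0 (zero_mem _))
        fun b b' => hadd fun n θ v => rotatedMu1_add_right hA n θ v a b b'
    · exact Submodule.iSup_induction _ (motive := fun b => P 0 b) (hmem b)
        (fun k' b hb => hhom 0 k' 0 (zero_mem _) b hb) (hhom 0 0 0 (zero_mem _) 0 (zero_mem _))
        fun b b' => hadd fun n θ v => rotatedMu1_add_right hA n θ v 0 b b'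
  choose N c hc hexp using hP
  let μ : ℤ → (m : ℕ) → Fin (harmonicDim D m) → V →ₗ[ℂ] V →ₗ[ℂ] V := fun n m σ =>
    LinearMap.mk₂ ℂ (fun a b => c a b n ⟨m, σ⟩)
      (fun a a' b => by
        rw [IsExpansion.unique hD2 (hexp (a + a') b n) (c' := c a b n + c a' b n)
          fun θ v hv0 hv => by rw [harmonicSum_add, hexp a b n θ v hv0 hv, hexp a' b n θ v hv0 hv,
            rotatedMu1_add_left hA]]
        rfl)
      (fun r a b => by
        rw [IsExpansion.unique hD2 (hexp (r • a) b n) (c' := r • c a b n)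
          fun θ v hv0 hv => by rw [harmonicSum_smul, hexp a b n θ v hv0 hv,
            rotatedMu1_smul_left hA]]
        rfl)
      (fun a b b' => by
        rw [IsExpansion.unique hD2 (hexp a (b + b') n) (c' := c a b n + c a b' n)
          fun θ v hv0 hv => by rw [harmonicSum_add, hexp a b n θ v hv0 hv, hexp a b' n θ v hv0 hv,
            rotatedMu1_add_right hA]]
        rfl)
      (fun r a b => by
        rw [IsExpansion.unique hD2 (hexp a (r • b) n) (c' := r • c a b n)
          fun θ v hv0 hv => by rw [harmonicSum_smul, hexp a b n θ v hv0 hv,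
            rotatedMu1_smul_right hA]]
        rfl)
  have hμ : ∀ n m σ a b, μ n m σ a b = c a b n ⟨m, σ⟩ := fun _ _ _ _ _ => rfl
  refine ⟨μ, ⟨fun n a b => ?_, fun n a b θ v hv0 hv => ?_⟩, fun μ' hμ' => ?_, fun a b => ?_, ?_⟩
  · refine (c a b n).support.finite_toSet.subset fun s hs => ?_
    exact Finsupp.mem_support_iff.2 hs
  · rw [finsum_eq_sum_of_support_subset (s := (c a b n).support)]
    · exact hexp a b n θ v hv0 hv
    · intro s hs
      exact Finsupp.mem_support_iff.2 (smul_ne_zero_iff.1 hs).2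
  · funext n m σ
    ext a b
    let c' : (Σ m : ℕ, Fin (harmonicDim D m)) →₀ V :=
      Finsupp.ofSupportFinite (fun s => μ' n s.1 s.2 a b) (hμ'.1 n a b)
    have hc' : IsExpansion 𝒱 A h n a b c' := by
      intro θ v hv0 hv
      refine Eq.trans ?_ (hμ'.2 n a b θ v hv0 hv)
      rw [finsum_eq_sum_of_support_subset (s := c'.support)]
      · rfl
      · intro s hs
        exact Finsupp.mem_support_iff.2 (smul_ne_zero_iff.1 hs).2
    rw [hμ, ← hc'.unique hD2 (hexp a b n)]
    rfl
  · refine ⟨N a b, fun n m σ hlt => ?_, exists_equalsLocalizedSeries h (c a b) (N a b)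
      fun n s hs => hc a b n s hs⟩
    by_contra hne
    exact absurd (hc a b n ⟨m, σ⟩ hne).2 (not_le.2 hlt)
  · intro Δ' Δ'' J' J'' W' W'' _ _ hW' hW'' hH' hH'' hJ a ha b hb n m σ hne
    have hJ2 : (∀ j ∈ A.spins W', -J' ≤ j ∧ (D = 2 → j ≤ J')) ∧
        (∀ j ∈ A.spins W'', -J'' ≤ j ∧ (D = 2 → j ≤ J'')) := by
      rcases hJ with ⟨h4, h1, h2⟩ | ⟨_, h1, h2⟩
      · exact ⟨fun j hj => ⟨h1.2 hj, fun h => by omega⟩, fun j hj => ⟨h2.2 hj, fun h => by omega⟩⟩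
      · exact ⟨fun j hj => (abs_le.1 (h1.2 ⟨j, hj, rfl⟩)).imp_right fun h _ => h,
          fun j hj => (abs_le.1 (h2.2 ⟨j, hj, rfl⟩)).imp_right fun h _ => h⟩
    obtain ⟨c', hc', hexp'⟩ := exists_expansion hD 𝒱 A heven hlocal hint hpos hΩ hTC hvac hT h
      hW' hW'' hH' hH'' hJ2.1 hJ2.2 n ha hb
    -- The expansion chosen for `a`, `b` is also the one obtained from the given `W'`, `W''`, so the
    -- sharper bound applies to it.
    have e : c a b n = c' := (hexp a b n).unique hD2 hexp'
    rw [hμ, e] at hne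
    exact (hc' _ hne).2

end Reconstruction

end

theorem lemma4p9 {D : ℕ} [NeZero D] (hD : Even D)
    {V : Type*} [AddCommGroup V] [Module ℂ V]
    (𝒱 : VertexAlgebra V) (A : ConformalAction D V)
    (heven : ∀ X ∈ A.operators, 𝒱.IsEvenEnd X)
    (hlocal : ∀ X ∈ A.operators, 𝒱.IsLocalEnd X)
    (hint : A.StronglyIntegrable) (hpos : A.PositiveEnergy) (hunitary : A.Unitary)
    (hvac : ∀ X ∈ A.operators, X 𝒱.vac = 0)
    (hT : A.T 0 = 𝒱.translation)
    (h : HarmonicBasis D) :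
    ∃ μ : ℤ → (m : ℕ) → Fin (harmonicDim D m) → V →ₗ[ℂ] V →ₗ[ℂ] V,
      -- the reconstructed coefficients exist and are unique
      IsReconstruction 𝒱 A h μ ∧
      (∀ μ', IsReconstruction 𝒱 A h μ' → μ' = μ) ∧
      -- pole bounds, and the series `Y_D(a,z)b` lies in `V[[z]]` localized at `z²`
      (∀ a b : V, ∃ N : ℕ,
        (∀ (n : ℤ) (m : ℕ) (σ : Fin (harmonicDim D m)),
          (N : ℝ) < ((m : ℝ) - (n : ℝ)) / 2 → μ n m σ a b = 0) ∧
        ∃ f : (Fin D →₀ ℕ) → V,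
          EqualsLocalizedSeries h (fun n m σ => μ n m σ a b) N f) ∧
      -- the explicit bound
      (∀ (Δ' Δ'' J' J'' : ℝ) (W' W'' : Submodule ℂ V),
        FiniteDimensional ℂ W' → FiniteDimensional ℂ W'' →
        A.RotationInvariant W' → A.RotationInvariant W'' →
        W' ≤ A.H.eigenspace (Δ' : ℂ) → W'' ≤ A.H.eigenspace (Δ'' : ℂ) →
        ((4 ≤ D ∧ IsLeast (A.spins W') (-J') ∧ IsLeast (A.spins W'') (-J'')) ∨
          (D = 2 ∧ IsGreatest ((fun j => |j|) '' A.spins W') J' ∧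
            IsGreatest ((fun j => |j|) '' A.spins W'') J'')) →
        ∀ a ∈ W', ∀ b ∈ W'', ∀ (n : ℤ) (m : ℕ) (σ : Fin (harmonicDim D m)),
          μ n m σ a b ≠ 0 →
            ((m : ℝ) - (n : ℝ)) / 2 ≤ (Δ' + J' + Δ'' + J'') / 2) := by
  obtain ⟨B, -, hBΩ, hBT⟩ := hunitary
  -- The Hermitian form is turned into an inner product structure on `V`, so that subspaces inherit
  -- norms and orthonormal bases.
  let _ : NormedAddCommGroup V := B.toNormedAddCommGroup
  let _ : InnerProductSpace ℂ V := InnerProductSpace.ofCore B.toCore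
  exact exists_reconstruction hD 𝒱 A heven hlocal hint hpos hBΩ hBT hvac hT h
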